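/- Let $M,T>0$ and $\mathcal M=[0,M[$. Let $r:[0,T]\to\mathbb R$ be measurable with $0\le r(t)\le R$. Let $\sigma:[0,T]\times[0,M]\to\mathbb R$ be measurable, differentiable in $x$, with $0<\underline\sigma\le\sigma\le\overline\sigma$ and $|x\,\partial_x\sigma|\le C_\sigma$. Let $\mathcal D(\mathcal M)$ be the smooth functions with compact support in $[0,M[$. Let $V_{\mathcal M}$ be its closure in $\{v\in L^2(0,M): x\,\partial_x v\in L^2(0,M)\}$, i.e. the functions $v$ in the latter space with $v(M)=0$, each identified with its continuous representative on $]0,M[$. Put $$B(u,v)=\int_0^M\frac{\sigma^2x^2}{2}\,\partial_xu\,\partial_xv\,dx+\int_0^M\bigl(\sigma^2+x\sigma\,\partial_x\sigma-r\bigr)\,x\,\partial_xu\;v\,dx+\int_0^M r\,u\,v\,dx .$$ Fix constants $C_0,C_1>0$ and let $\tilde{\mathcal P}$ be the set of positive Radon measures $\mu$ on $[0,M]$ with $\mu([0,M])=M$ such that, for all $\varphi\in\mathcal D(\mathcal M)$, $$\|\varphi\|_{L^2_\mu(\mathcal M)}\le C_0\,\|x\varphi'\|_{L^2(\mathcal M)},\qquad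 \|\varphi\|_{L^2(\mathcal M)}\le C_1\,\|\varphi\|_{L^2_\mu(\mathcal M)} .$$ Assume that $\tilde{\mathcal P}$ is non-empty (it contains Lebesgue measure if $C_0\ge2$ and $C_1\ge1$). Let $h\in V_{\mathcal M}$, $u^\varepsilon\in L^2(\mathcal M)$ and $\alpha\in\mathbb R$. A weak solution of the measure based Black–Scholes problem for $\mu$ is a function $u\in L^2(0,T;V_{\mathcal M})$ with $u(t,\cdot)\in V_{\mathcal M}$ for every $t\in[0,T]$, $u(T,\cdot)=h$, and $\frac{d}{dt}\int_{\mathcal M}u\,v\,d\mu=B(u,v)$ for all $v\in\mathcal D(\mathcal M)$, in the integrated sense $$\int_{\mathcal M}h\,v\,d\mu-\int_{\mathcal M}u(t,\cdot)\,v\,d\mu=\int_t^TB(u(s,\cdot),v)\,ds\qquad\text{for all }t\in[0,T].$$ **Theorem.** For every $\mu\in\tilde{\mathcal P}$ there is exactly one weak solution $u_\mu$, so that $\Psi(\mu)=u_\mu(0,\cdot)$ is well defined, and the Tikhonov functional $$\mathcal T_\alpha(\mu)=\tfrac12\,\|\Psi(\mu)-u^\varepsilon\|^2_{L^2(\mathcal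 M)}+\alpha\,\|\mu\|_{TV}$$ attains its minimum over $\tilde{\mathcal P}$. -/

import Mathlib

open MeasureTheory Set Filter Topology
open scoped ContDiff

namespace MeasureBlackScholes

/-- Lebesgue measure on the asset domain `𝓜 = [0, M[`. -/
noncomputable def leb (M : ℝ) : Measure ℝ := volume.restrict (Ico 0 M)

/-- `φ` is a test function on `𝓜 = [0, M[`: smooth, with support a compact subset of `[0, M[`
(so `φ` vanishes near `M` but need not vanish at `0`). Only the values on `[0, M[` are used. -/
def IsTest (M : ℝ) (φ : ℝ → ℝ) : Prop :=
  ContDiff ℝ ∞ φ ∧ HasCompactSupport φ ∧ tsupport φ ⊆ Iio M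

/-- `v` belongs to the weighted Sobolev space `V_𝓜` and `g` is its weak derivative:
`v ∈ L²`, `x ∂ₓv = x g ∈ L²`. The space is the one in which test functions on `[0, M[` are
dense, so its elements have trace `0` at `M`; elements are given by their continuous
representative on `]0, M[`, as they are to be integrated against measures that charge points. -/
structure HasVDeriv (M : ℝ) (v g : ℝ → ℝ) : Prop where
  memLp : MemLp v 2 (leb M)
  memLp_deriv : MemLp (fun x => x * g x) 2 (leb M)
  weak_deriv : ∀ φ : ℝ → ℝ, ContDiff ℝ ∞ φ → HasCompactSupport φ → tsupport φ ⊆ Ioo 0 M →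
    ∫ x in Ioo 0 M, v x * deriv φ x = - ∫ x in Ioo 0 M, g x * φ x
  continuousOn : ContinuousOn v (Ioo 0 M)
  trace_zero : Tendsto v (𝓝[<] M) (𝓝 0)

/-- Membership in `V_𝓜`. -/
def MemV (M : ℝ) (v : ℝ → ℝ) : Prop := ∃ g : ℝ → ℝ, HasVDeriv M v g

/-- The bilinear form at time `t`,
`B(u,v) = ∫ σ²x²/2 ∂ₓu ∂ₓv + ∫ (σ² + x σ ∂ₓσ - r) x ∂ₓu v + ∫ r u v` over `[0, M[`;
`ux`, `vx` are the space derivatives of `u`, `v`. -/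
noncomputable def bsForm (M : ℝ) (σ : ℝ → ℝ → ℝ) (r : ℝ → ℝ) (t : ℝ)
    (u ux v vx : ℝ → ℝ) : ℝ :=
  (∫ x, (σ t x) ^ 2 * x ^ 2 / 2 * ux x * vx x ∂(leb M))
    + (∫ x, ((σ t x) ^ 2 + x * σ t x * deriv (σ t) x - r t) * x * ux x * v x ∂(leb M))
    + ∫ x, r t * u x * v x ∂(leb M)

/-- `u` is a weak solution of the measure based Black-Scholes problem with terminal value `h`:
`u ∈ L²(0,T; V_𝓜)` with `u(t) ∈ V_𝓜` for every `t ∈ [0,T]`, `u(T) = h`, and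
`d/dt ∫ u v dμ = B(u, v)` for all test functions `v` (integrated over `[t, T]`). -/
structure IsWeakSolution (M T : ℝ) (σ : ℝ → ℝ → ℝ) (r : ℝ → ℝ) (h : ℝ → ℝ)
    (μ : Measure ℝ) (u : ℝ → ℝ → ℝ) : Prop where
  terminal : ∀ x ∈ Ioo 0 M, u T x = h x
  weak_form : ∃ ux : ℝ → ℝ → ℝ,
    (∀ t ∈ Icc 0 T, HasVDeriv M (u t) (ux t)) ∧
    MemLp (fun p : ℝ × ℝ => u p.1 p.2) 2 ((volume.restrict (Icc 0 T)).prod (leb M)) ∧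
    MemLp (fun p : ℝ × ℝ => p.2 * ux p.1 p.2) 2 ((volume.restrict (Icc 0 T)).prod (leb M)) ∧
    ∀ v : ℝ → ℝ, IsTest M v → ∀ t ∈ Icc 0 T,
      (∫ x in Ico 0 M, h x * v x ∂μ) - (∫ x in Ico 0 M, u t x * v x ∂μ)
        = ∫ s in t..T, bsForm M σ r s (u s) (ux s) v (deriv v)

/-- The admissible measures: (positive) finite Borel measures on `[0, M]` of total mass `M` with
`‖φ‖_{L²_μ} ≤ C₀ ‖x φ'‖_{L²}` and `‖φ‖_{L²} ≤ C₁ ‖φ‖_{L²_μ}` for all test functions `φ`. -/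
def admissible (M C₀ C₁ : ℝ) : Set (FiniteMeasure ℝ) :=
  {μ | (μ : Measure ℝ) (Icc 0 M)ᶜ = 0 ∧
    (μ : Measure ℝ) (Icc 0 M) = ENNReal.ofReal M ∧
    ∀ φ : ℝ → ℝ, IsTest M φ →
      eLpNorm φ 2 ((μ : Measure ℝ).restrict (Ico 0 M))
          ≤ ENNReal.ofReal C₀ * eLpNorm (fun x => x * deriv φ x) 2 (leb M) ∧
      eLpNorm φ 2 (leb M)
          ≤ ENNReal.ofReal C₁ * eLpNorm φ 2 ((μ : Measure ℝ).restrict (Ico 0 M))}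

open Classical in
/-- The solution operator `Ψ(μ) = u_μ(0, ·)`, where `u_μ` is the weak solution
(and the zero function when there is none). -/
noncomputable def solutionOperator (M T : ℝ) (σ : ℝ → ℝ → ℝ) (r : ℝ → ℝ) (h : ℝ → ℝ)
    (μ : FiniteMeasure ℝ) : ℝ → ℝ :=
  if hu : ∃ u : ℝ → ℝ → ℝ, IsWeakSolution M T σ r h (μ : Measure ℝ) u then hu.choose 0 else 0

/-- The total variation norm of a finite measure. -/
noncomputable def tvNorm (μ : FiniteMeasure ℝ) : ℝ :=
  ((μ : Measure ℝ).toSignedMeasure.totalVariation univ).toReal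

/-- The Tikhonov functional `½ ‖Ψ(μ) - u^ε‖²_{L²(𝓜)} + α ‖μ‖_TV`. -/
noncomputable def tikhonov (M T : ℝ) (σ : ℝ → ℝ → ℝ) (r : ℝ → ℝ) (h uε : ℝ → ℝ) (α : ℝ)
    (μ : FiniteMeasure ℝ) : ℝ :=
  (eLpNorm (fun x => solutionOperator M T σ r h μ x - uε x) 2 (leb M)).toReal ^ 2 / 2
    + α * tvNorm μ

end MeasureBlackScholes

/-!
# Well-posedness and Tikhonov regularisation of the measure based Black–Scholes problem

**The space.** A function `u` in `V_𝓜` is determined by `f = x ∂ₓu`, which is an arbitrary element of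
`W = L²(0, M)`: one has `u = logPrimitive M f`, the primitive of `f` with respect to `dx / x` that
vanishes at `M` (`HasVDeriv.eq_logPrimitive`). Test functions supported away from `0` are dense in
`W` (`dense_testVector`), because a vector orthogonal to them is a multiple of `1 / x`, which is not
square integrable. The inequalities that define an admissible measure `μ` therefore extend to
embeddings `K_μ : f ↦ u` into `L²_μ` and `J : f ↦ u` into `L²`, with `‖K_μ f‖ ≤ C₀ ‖f‖` and
`‖J f‖ ≤ C₁ ‖K_μ f‖`. By dilation invariance of `x ∂ₓ`, such a measure has no mass at `0`, where
elements of `V_𝓜` have no value. A weak solution is the same as a solution of the implicit equation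
`(K_μ† K_μ f)' = B f`, `f(T) = x ∂ₓh`, in `W` (`isWeakSolution_logPrimitive`,
`IsWeakSolution.exists_vector`).

**Existence.** The solution must lie in `V_𝓜` at every time, which the energy estimate for
`‖u‖_{L²_μ}` does not give when `σ` is only measurable in time. The remedy is to test with `σ² w`
instead of `w`. The form then becomes `½ ⟪f, q⟫` plus terms of lower order, where `q` represents
`σ² w` (`Coefficients.form_eq`), and the left side becomes `⟪(K_μ f)', σ⁻² K_μ q⟫`. As the principal
part is constant in time, choosing `q = ∂ₜ f` bounds both `(K_μ f)'` in `L²(0, T; L²_μ)` and `f(τ)`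
in `W`, for every `τ` and without regularity of `σ` in time. This a priori estimate is turned into
existence by Lions' projection lemma (`exists_lions_solution`, `coercive_spacetime`,
`exists_implicit_solution`), and the bound `stabilityConst` does not depend on `μ`. Uniqueness
follows from Gårding's inequality and an exponentially weighted energy estimate
(`implicit_solution_unique`); it also shows that the solutions on the intervals `[τ, T]` fit
together (`ImplicitSystem.exists_solution`).

**Minimisation.** The set of admissible measures is weakly compact by Prokhorov's theorem
(`isCompact_admissible`), since test functions vanish at `M`, and the total variation is equal to
`M` on it, so that the sign of `α` plays no role. It remains to see that the misfit is lower
semicontinuous. If `μ_i → μ` along an ultrafilter, then `K_{μ_i}† K_{μ_i} → K_μ† K_μ` strongly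
(`tendsto_gram_embedding`), because weakly convergent `f_i` have locally uniformly convergent
primitives, by Hölder continuity. The solutions `f_i` are bounded in `W`, uniformly in time and in
`i`; their weak limits solve the limit equation, hence `f_i(0) ⇀ f(0)` weakly by uniqueness
(`ImplicitSystem.tendsto_inner_initial_value`). The norm of `L²` is weakly lower semicontinuous.
-/

namespace MeasureBlackScholes
open scoped RealInnerProductSpace ENNReal NNReal




/-! ### Lions' projection lemma -/

/-- **Lions' projection lemma**: if `⟪Γ q, L q⟫` is coercive in `‖Γ q‖`, then every functional `ℓ`
that is bounded by `‖Γ q‖` has the form `q ↦ ⟪x, L q⟫`, with `x` in the closure of the range of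
`Γ`. -/
theorem exists_lions_solution {X Q : Type*} [NormedAddCommGroup X] [InnerProductSpace ℝ X]
    [CompleteSpace X] [AddCommGroup Q] [Module ℝ Q] (Γ L : Q →ₗ[ℝ] X) (ℓ : Q →ₗ[ℝ] ℝ)
    {c C : ℝ} (hc : 0 < c) (hcoer : ∀ q, c * ‖Γ q‖ ^ 2 ≤ ⟪Γ q, L q⟫)
    (hℓ : ∀ q, |ℓ q| ≤ C * ‖Γ q‖) (hC : 0 ≤ C) :
    ∃ x ∈ closure (range Γ), (∀ q, ⟪x, L q⟫ = ℓ q) ∧ ‖x‖ ≤ C / c := by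
  set G : Submodule ℝ X := (LinearMap.range Γ).topologicalClosure with hG
  have hGc : IsClosed (G : Set X) := Submodule.isClosed_topologicalClosure _
  have : CompleteSpace G := hGc.completeSpace_coe
  set P : X →L[ℝ] G := G.orthogonalProjectionOnto
  have hPin : ∀ (g : G) (x : X), ⟪(g : X), x⟫ = ⟪g, P x⟫ := by
    intro g x
    exact (Submodule.inner_orthogonalProjectionOnto_eq_of_mem_left g x).symm
  have hΓG : ∀ q, Γ q ∈ G := fun q => Submodule.le_topologicalClosure _ ⟨q, rfl⟩
  -- only the component of `L q` in `G` matters; it controls `Γ q`, so `ℓ` factors through it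
  set PL : Q →ₗ[ℝ] G := P.toLinearMap ∘ₗ L
  have hlow : ∀ q, c * ‖Γ q‖ ≤ ‖PL q‖ := by
    intro q
    have h1 : c * ‖Γ q‖ ^ 2 ≤ ‖Γ q‖ * ‖PL q‖ := by
      refine (hcoer q).trans ?_
      have := hPin ⟨Γ q, hΓG q⟩ (L q)
      rw [show ⟪Γ q, L q⟫ = ⟪(⟨Γ q, hΓG q⟩ : G), PL q⟫ from this]
      exact real_inner_le_norm _ _
    rcases (norm_nonneg (Γ q)).eq_or_lt with h0 | h0
    · rw [← h0]; simp
    · nlinarith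
  have hℓ' : ∀ q, |ℓ q| ≤ C / c * ‖PL q‖ := by
    intro q
    refine (hℓ q).trans ?_
    rw [div_mul_eq_mul_div, le_div_iff₀ hc]
    nlinarith [hlow q]
  have hker : LinearMap.ker PL ≤ LinearMap.ker ℓ := by
    intro q hq
    have := hℓ' q
    rw [LinearMap.mem_ker.1 hq, norm_zero, mul_zero] at this
    exact LinearMap.mem_ker.2 (abs_nonpos_iff.1 this)
  set φ : LinearMap.range PL →ₗ[ℝ] ℝ :=
    (LinearMap.ker PL).liftQ ℓ hker ∘ₗ PL.quotKerEquivRange.symm.toLinearMap with hφ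
  have hφa : ∀ q, φ ⟨PL q, q, rfl⟩ = ℓ q := by
    intro q
    have : PL.quotKerEquivRange.symm ⟨PL q, q, rfl⟩ = (LinearMap.ker PL).mkQ q := by
      rw [LinearEquiv.symm_apply_eq]; rfl
    simp [hφ, this]
  have hφb : ∀ y, ‖φ y‖ ≤ C / c * ‖y‖ := by
    rintro ⟨y, q, rfl⟩
    rw [hφa q]
    exact hℓ' q
  obtain ⟨g, hg1, hg2⟩ := exists_extension_norm_eq (LinearMap.range PL)
    (φ.mkContinuous (C / c) hφb)
  set y : G := (InnerProductSpace.toDual ℝ G).symm g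
  have hy : ∀ z, ⟪y, z⟫ = g z := fun z => InnerProductSpace.toDual_symm_apply
  refine ⟨y, ?_, ?_, ?_⟩
  · have h1 : (y : X) ∈ (LinearMap.range Γ).topologicalClosure := y.2
    rwa [← SetLike.mem_coe, Submodule.topologicalClosure_coe] at h1
  · intro q
    rw [hPin, hy, ← hφa q]
    exact hg1 ⟨PL q, q, rfl⟩
  · have h1 : ‖(y : X)‖ = ‖g‖ := by
      exact LinearIsometryEquiv.norm_map (InnerProductSpace.toDual ℝ G).symm g
    rw [h1, hg2]
    exact LinearMap.mkContinuous_norm_le _ (by positivity) _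

/-! ### Measurable families of operators -/

/-- A strongly measurable family of operators applied to a measurable curve is measurable. -/
theorem aestronglyMeasurable_apply {W V : Type*} [NormedAddCommGroup W] [NormedSpace ℝ W]
    [SecondCountableTopology W] [NormedAddCommGroup V] [NormedSpace ℝ V]
    {A : ℝ → W →L[ℝ] V} (hA : ∀ w, StronglyMeasurable fun t => A t w) {ν : Measure ℝ}
    {q : ℝ → W} (hq : AEStronglyMeasurable q ν) :
    AEStronglyMeasurable (fun t => A t (q t)) ν := by
  borelize W
  have h1 : StronglyMeasurable (Function.uncurry fun (w : W) (t : ℝ) => A t w) :=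
    stronglyMeasurable_uncurry_of_continuous_of_stronglyMeasurable
      (fun t => (A t).continuous) hA
  refine ⟨fun t => A t (hq.mk q t), ?_, ?_⟩
  · exact h1.comp_measurable (hq.stronglyMeasurable_mk.measurable.prodMk measurable_id)
  · filter_upwards [hq.ae_eq_mk] with t ht
    rw [← ht]

theorem exists_countable_hilbertBasis (W : Type*) [NormedAddCommGroup W] [InnerProductSpace ℝ W]
    [CompleteSpace W] [SecondCountableTopology W] :
    ∃ (s : Set W) (_ : HilbertBasis s ℝ W), s.Countable := by
  obtain ⟨s, b, hb⟩ := exists_hilbertBasis ℝ W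
  refine ⟨s, b, ?_⟩
  -- orthonormal vectors have distance `√2`, and a separable space has no uncountable discrete set
  have hdisj : s.PairwiseDisjoint fun w => Metric.ball w (1 / 2) := by
    intro x hx y hy hxy
    refine Metric.ball_disjoint_ball ?_
    have h1 := b.orthonormal.1 ⟨x, hx⟩
    have h2 := b.orthonormal.1 ⟨y, hy⟩
    have h3 := b.orthonormal.2 (i := ⟨x, hx⟩) (j := ⟨y, hy⟩) (by simpa using hxy)
    rw [hb] at h1 h2 h3
    simp only at h1 h2 h3
    have h4 := norm_sub_sq_real x y
    rw [h1, h2, h3] at h4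
    rw [dist_eq_norm]
    nlinarith [norm_nonneg (x - y)]
  exact hdisj.countable_of_isOpen (fun _ _ => Metric.isOpen_ball)
    fun w _ => ⟨w, Metric.mem_ball_self (by norm_num)⟩

/-- **Pettis' theorem** for a separable Hilbert space: weak measurability implies strong
measurability. -/
theorem stronglyMeasurable_of_forall_inner {W : Type*} [NormedAddCommGroup W]
    [InnerProductSpace ℝ W] [CompleteSpace W] [SecondCountableTopology W]
    {α : Type*} [MeasurableSpace α] {f : α → W}
    (hf : ∀ w, StronglyMeasurable fun t => ⟪f t, w⟫) : StronglyMeasurable f := by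
  obtain ⟨s, b, hs⟩ := exists_countable_hilbertBasis W
  have := hs.to_subtype
  refine stronglyMeasurable_of_tendsto (atTop : Filter (Finset s))
    (f := fun F t => ∑ i ∈ F, b.repr (f t) i • b i) (fun F => ?_)
    (tendsto_pi_nhds.2 fun t => b.hasSum_repr (f t))
  refine Finset.stronglyMeasurable_fun_sum F fun i _ => ?_
  simp_rw [b.repr_apply_apply, real_inner_comm]
  exact (hf _).smul_const _

/-- The version of Pettis' theorem up to null sets. -/
theorem aestronglyMeasurable_of_forall_inner {W : Type*} [NormedAddCommGroup W]
    [InnerProductSpace ℝ W] [CompleteSpace W] [SecondCountableTopology W]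
    {α : Type*} [MeasurableSpace α] {ν : Measure α}
    {f : α → W} (hf : ∀ w, AEStronglyMeasurable (fun t => ⟪f t, w⟫) ν) :
    AEStronglyMeasurable f ν := by
  obtain ⟨s, b, hs⟩ := exists_countable_hilbertBasis W
  have := hs.to_subtype
  refine aestronglyMeasurable_of_tendsto_ae (atTop : Filter (Finset s))
    (f := fun F t => ∑ i ∈ F, b.repr (f t) i • b i) (fun F => ?_)
    (Eventually.of_forall fun t => b.hasSum_repr (f t))
  refine Finset.aestronglyMeasurable_fun_sum F fun i _ => ?_
  simp_rw [b.repr_apply_apply, real_inner_comm]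
  exact (hf _).smul_const _





/-! ### Existence for the implicit evolution equation -/

/-- The linear map into `L²(ν; E)` induced by a linear family of square integrable functions. -/
noncomputable def toLpLinear {Q E : Type*} [AddCommGroup Q] [Module ℝ Q] [NormedAddCommGroup E]
    [NormedSpace ℝ E] {ν : Measure ℝ} (Φ : Q →ₗ[ℝ] (ℝ → E)) (hΦ : ∀ q, MemLp (Φ q) 2 ν) :
    Q →ₗ[ℝ] Lp E 2 ν where
  toFun q := (hΦ q).toLp
  map_add' p q := by
    rw [← MemLp.toLp_add]
    exact MemLp.toLp_congr _ _ (by rw [map_add])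
  map_smul' c q := by
    rw [RingHom.id_apply, ← MemLp.toLp_const_smul]
    exact MemLp.toLp_congr _ _ (by rw [map_smul])

theorem memLp_of_continuous {E : Type*} [NormedAddCommGroup E] {f : ℝ → E}
    (hf : Continuous f) (a b : ℝ) : MemLp f 2 (volume.restrict (Ioc a b)) := by
  obtain ⟨C, hC⟩ := isCompact_Icc.exists_bound_of_continuousOn (s := Icc a b) hf.continuousOn
  refine MemLp.of_bound hf.aestronglyMeasurable C ?_
  filter_upwards [ae_restrict_mem measurableSet_Ioc] with t ht
  exact hC t (Ioc_subset_Icc_self ht)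

section primitive
variable {W : Type*} [NormedAddCommGroup W] [InnerProductSpace ℝ W] [CompleteSpace W]

theorem hasDerivAt_primitive {q : ℝ → W} (hq : Continuous q) (T t : ℝ) :
    HasDerivAt (fun t => ∫ s in T..t, q s) (q t) t :=
  intervalIntegral.integral_hasDerivAt_right (hq.intervalIntegrable _ _)
    (hq.stronglyMeasurableAtFilter _ _) hq.continuousAt

theorem continuous_primitive_of_continuous {q : ℝ → W} (hq : Continuous q) (T : ℝ) :
    Continuous (fun t => ∫ s in T..t, q s) :=
  continuous_iff_continuousAt.2 fun t => (hasDerivAt_primitive hq T t).continuousAt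

/-- Integration by parts for `φ(t) = ∫_T^t q`, `φ' = q`, against an exponential weight. The term with
`‖φ‖²` gives the space-time form control of its `L²` norm. -/
theorem integral_exp_mul_inner_primitive {q : ℝ → W} (hq : Continuous q) (l τ T : ℝ) :
    ∫ t in τ..T, Real.exp (l * (t - τ)) * ⟪∫ s in T..t, q s, q t⟫
      = -(1 / 2) * ‖∫ s in T..τ, q s‖ ^ 2
        - l / 2 * ∫ t in τ..T, Real.exp (l * (t - τ)) * ‖∫ s in T..t, q s‖ ^ 2 := by
  set φ := fun t => ∫ s in T..t, q s with hφ
  have hφc : Continuous φ := continuous_primitive_of_continuous hq T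
  have hd : ∀ t, HasDerivAt (fun t => Real.exp (l * (t - τ)) * ‖φ t‖ ^ 2)
      (l * (Real.exp (l * (t - τ)) * ‖φ t‖ ^ 2)
        + 2 * (Real.exp (l * (t - τ)) * ⟪φ t, q t⟫)) t := by
    intro t
    have h1 : HasDerivAt (fun t => Real.exp (l * (t - τ))) (Real.exp (l * (t - τ)) * l) t := by
      have := (((hasDerivAt_id t).sub_const τ).const_mul l).exp
      simpa using this
    have h2 := (hasDerivAt_primitive hq T t).norm_sq
    refine (h1.mul h2).congr_deriv ?_
    simp only [hφ]
    ring
  have hI := intervalIntegral.integral_eq_sub_of_hasDerivAt (a := τ) (b := T)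
    (fun t _ => hd t) (by apply Continuous.intervalIntegrable; fun_prop)
  rw [intervalIntegral.integral_add (by apply Continuous.intervalIntegrable; fun_prop)
    (by apply Continuous.intervalIntegrable; fun_prop),
    intervalIntegral.integral_const_mul, intervalIntegral.integral_const_mul] at hI
  have hT : φ T = 0 := by simp [hφ]
  simp only [hT, norm_zero, sub_self, mul_zero, Real.exp_zero, one_mul] at hI
  have e1 : ‖φ τ‖ = ‖∫ s in T..τ, q s‖ := rfl
  rw [← e1]
  simp only [hφ] at hI ⊢
  linarith

/-- The same integration by parts with one factor constant; it bounds the source functional by the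
primitive of `q`, not by `q` itself. -/
theorem integral_exp_mul_inner_const {q : ℝ → W} (hq : Continuous q) (h : W) (l τ T : ℝ) :
    ∫ t in τ..T, Real.exp (l * (t - τ)) * ⟪h, q t⟫
      = -⟪h, ∫ s in T..τ, q s⟫
        - l * ∫ t in τ..T, Real.exp (l * (t - τ)) * ⟪h, ∫ s in T..t, q s⟫ := by
  set φ := fun t => ∫ s in T..t, q s with hφ
  have hφc : Continuous φ := continuous_primitive_of_continuous hq T
  have hd : ∀ t, HasDerivAt (fun t => Real.exp (l * (t - τ)) * ⟪h, φ t⟫)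
      (l * (Real.exp (l * (t - τ)) * ⟪h, φ t⟫)
        + Real.exp (l * (t - τ)) * ⟪h, q t⟫) t := by
    intro t
    have h1 : HasDerivAt (fun t => Real.exp (l * (t - τ))) (Real.exp (l * (t - τ)) * l) t := by
      have := (((hasDerivAt_id t).sub_const τ).const_mul l).exp
      simpa using this
    have h2 := (hasDerivAt_const t h).inner ℝ (hasDerivAt_primitive hq T t)
    refine (h1.mul h2).congr_deriv ?_
    simp only [hφ, inner_zero_left]
    ring
  have hI := intervalIntegral.integral_eq_sub_of_hasDerivAt (a := τ) (b := T)
    (fun t _ => hd t) (by apply Continuous.intervalIntegrable; fun_prop)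
  rw [intervalIntegral.integral_add (by apply Continuous.intervalIntegrable; fun_prop)
    (by apply Continuous.intervalIntegrable; fun_prop),
    intervalIntegral.integral_const_mul] at hI
  have hT : φ T = 0 := by simp [hφ]
  simp only [hT, inner_zero_right, sub_self, mul_zero, Real.exp_zero, one_mul] at hI
  have e1 : ⟪h, φ τ⟫ = ⟪h, ∫ s in T..τ, q s⟫ := rfl
  rw [← e1]
  simp only [hφ] at hI ⊢
  linarith

end primitive

/-- The linear map sending `q` to its primitive vanishing at `T`. -/
noncomputable def primitiveLinear (W : Type*) [NormedAddCommGroup W] [NormedSpace ℝ W] (T : ℝ) :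
    C(ℝ, W) →ₗ[ℝ] (ℝ → W) where
  toFun q t := ∫ s in T..t, q s
  map_add' p q := by
    ext t
    exact intervalIntegral.integral_add (p.continuous.intervalIntegrable _ _)
      (q.continuous.intervalIntegrable _ _)
  map_smul' c q := by
    ext t
    exact intervalIntegral.integral_smul c _

/-- The linear map `q ↦ (t ↦ w t • A t (q t))` on continuous functions. -/
noncomputable def familyLinear {W V : Type*} [NormedAddCommGroup W] [NormedSpace ℝ W]
    [NormedAddCommGroup V] [NormedSpace ℝ V] (w : ℝ → ℝ) (A : ℝ → W →L[ℝ] V) :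
    C(ℝ, W) →ₗ[ℝ] (ℝ → V) where
  toFun q t := w t • A t (q t)
  map_add' p q := by ext t; simp
  map_smul' c q := by
    ext t
    simp only [ContinuousMap.smul_apply, map_smul, Pi.smul_apply, RingHom.id_apply]
    rw [smul_comm]

theorem memLp_familyLinear {W V : Type*} [NormedAddCommGroup W] [NormedSpace ℝ W]
    [SecondCountableTopology W]
    [NormedAddCommGroup V] [NormedSpace ℝ V] {w : ℝ → ℝ} (hw : Continuous w)
    {A : ℝ → W →L[ℝ] V} (hA : ∀ w, StronglyMeasurable fun t => A t w) {C : ℝ}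
    (hC : ∀ t q, ‖A t q‖ ≤ C * ‖q‖) (a b : ℝ) (q : C(ℝ, W)) :
    MemLp (familyLinear w A q) 2 (volume.restrict (Ioc a b)) := by
  have h1 : MemLp (fun t => w t • q t) 2 (volume.restrict (Ioc a b)) :=
    memLp_of_continuous (by fun_prop) a b
  refine MemLp.of_le_mul (c := C) h1 ?_ (Eventually.of_forall fun t => ?_)
  · exact hw.aestronglyMeasurable.smul
      (aestronglyMeasurable_apply hA q.continuous.aestronglyMeasurable)
  · simp only [familyLinear, LinearMap.coe_mk, AddHom.coe_mk, norm_smul]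
    nlinarith [mul_le_mul_of_nonneg_left (hC t (q t)) (norm_nonneg (w t))]

theorem integral_norm_le_sqrt_mul_norm {E : Type*} [NormedAddCommGroup E] [InnerProductSpace ℝ E]
    {τ T T' : ℝ} (hτ : τ ≤ T) (hT' : T - τ ≤ T')
    (f : Lp E 2 (volume.restrict (Ioc τ T))) :
    ∫ t in Ioc τ T, ‖f t‖ ≤ √T' * ‖f‖ := by
  have h1 : ‖f‖ ^ 2 = ∫ t in Ioc τ T, ‖f t‖ ^ 2 := by
    rw [← real_inner_self_eq_norm_sq, L2.inner_def]
    simp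
  have h2 := integral_mul_le_Lp_mul_Lq_of_nonneg (μ := volume.restrict (Ioc τ T))
    (Real.HolderConjugate.two_two) (f := fun _ => (1 : ℝ)) (g := fun t => ‖f t‖)
    (Eventually.of_forall fun _ => zero_le_one) (Eventually.of_forall fun _ => norm_nonneg _)
    (memLp_const 1) (by simpa using (Lp.memLp f).norm)
  simp only [one_mul, Real.rpow_two] at h2
  rw [← h1] at h2
  refine h2.trans ?_
  have h3 : ∫ _ in Ioc τ T, (1 : ℝ) ^ 2 = T - τ := by simp [hτ]
  rw [h3, ← Real.sqrt_eq_rpow, ← Real.sqrt_eq_rpow, Real.sqrt_sq (norm_nonneg _)]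
  gcongr





/-- Exponential rate of the time weight that makes the space-time form coercive. -/
noncomputable def weightRate (m₀ CD : ℝ) : ℝ := 4 * (CD ^ 2 / (2 * m₀) + 1)

/-- A bound for the data-to-solution map on time intervals of length at most `T'`. -/
noncomputable def stabilityConst (m₀ CD T' : ℝ) : ℝ :=
  (1 / 2 * (1 + weightRate m₀ CD * Real.exp (weightRate m₀ CD * T') * √T')
    + Real.exp (weightRate m₀ CD * T') * CD * √T') / min (1 / 4) (m₀ / 2)

section existence
variable {W H : Type*} [NormedAddCommGroup W] [InnerProductSpace ℝ W]
  [SecondCountableTopology W] [NormedAddCommGroup H] [InnerProductSpace ℝ H]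

theorem norm_toLpLinear_sq {Q E : Type*} [AddCommGroup Q] [Module ℝ Q] [NormedAddCommGroup E]
    [InnerProductSpace ℝ E] {ν : Measure ℝ} (Φ : Q →ₗ[ℝ] (ℝ → E)) (hΦ : ∀ q, MemLp (Φ q) 2 ν)
    (q : Q) : ‖toLpLinear Φ hΦ q‖ ^ 2 = ∫ t, ‖Φ q t‖ ^ 2 ∂ν := by
  rw [← real_inner_self_eq_norm_sq, L2.inner_def]
  refine integral_congr_ae ?_
  filter_upwards [(hΦ q).coeFn_toLp] with t ht
  simp only [toLpLinear, LinearMap.coe_mk, AddHom.coe_mk, ht, real_inner_self_eq_norm_sq]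

theorem inner_toLpLinear {Q E : Type*} [AddCommGroup Q] [Module ℝ Q] [NormedAddCommGroup E]
    [InnerProductSpace ℝ E] {ν : Measure ℝ} (Φ : Q →ₗ[ℝ] (ℝ → E)) (hΦ : ∀ q, MemLp (Φ q) 2 ν)
    (f : Lp E 2 ν) (q : Q) : ⟪f, toLpLinear Φ hΦ q⟫ = ∫ t, ⟪f t, Φ q t⟫ ∂ν := by
  rw [L2.inner_def]
  refine integral_congr_ae ?_
  filter_upwards [(hΦ q).coeFn_toLp] with t ht
  simp only [toLpLinear, LinearMap.coe_mk, AddHom.coe_mk, ht]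

theorem integrable_inner_of_memLp {E : Type*} [NormedAddCommGroup E] [InnerProductSpace ℝ E]
    {α : Type*} [MeasurableSpace α]
    {ν : Measure α} {f g : α → E} (hf : MemLp f 2 ν) (hg : MemLp g 2 ν) :
    Integrable (fun t => ⟪f t, g t⟫) ν := by
  have h := L2.integrable_inner (𝕜 := ℝ) hf.toLp hg.toLp
  refine h.congr ?_
  filter_upwards [hf.coeFn_toLp, hg.coeFn_toLp] with t h1 h2
  rw [h1, h2]

theorem intervalIntegrable_inner_family {V : Type*} [NormedAddCommGroup V]
    [InnerProductSpace ℝ V] {A : ℝ → W →L[ℝ] V}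
    (hA : ∀ w, StronglyMeasurable fun t => A t w) {C : ℝ} (hC : ∀ t q, ‖A t q‖ ≤ C * ‖q‖)
    {φ : ℝ → V} (hφ : Continuous φ) {w : ℝ → ℝ} (hw : Continuous w)
    {q : ℝ → W} (hq : Continuous q) (a b : ℝ) :
    IntervalIntegrable (fun t => w t * ⟪φ t, A t (q t)⟫) volume a b := by
  have hb : IntervalIntegrable (fun t => |w t| * (‖φ t‖ * (C * ‖q t‖))) volume a b :=
    Continuous.intervalIntegrable (by fun_prop) _ _
  refine hb.mono_fun (hw.aestronglyMeasurable.mul (hφ.aestronglyMeasurable.inner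
    (aestronglyMeasurable_apply hA hq.aestronglyMeasurable))) (Eventually.of_forall fun t => ?_)
  change ‖w t * ⟪φ t, A t (q t)⟫‖ ≤ ‖|w t| * (‖φ t‖ * (C * ‖q t‖))‖
  rw [norm_mul, Real.norm_eq_abs (w t)]
  refine (mul_le_mul_of_nonneg_left (norm_inner_le_norm _ _) (abs_nonneg _)).trans
    (le_trans ?_ (le_abs_self _))
  gcongr
  exact hC t _

/-- Coercivity of the weighted space-time form on continuous test functions. The weight is chosen
so that the term `l / 4 ‖φ‖²`, `φ(t) = ∫_T^t q`, absorbs the lower order part `D`. -/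
theorem coercive_spacetime [CompleteSpace W] (K : W →L[ℝ] H) (P : ℝ → W →L[ℝ] H)
    (D : ℝ → W →L[ℝ] W)
    (hP : ∀ w, StronglyMeasurable fun t => P t w) (hD : ∀ w, StronglyMeasurable fun t => D t w)
    {m₀ CP CD : ℝ} (hm₀ : 0 < m₀)
    (hPc : ∀ t q, m₀ * ‖K q‖ ^ 2 ≤ ⟪K q, P t q⟫) (hPb : ∀ t q, ‖P t q‖ ≤ CP * ‖q‖)
    (hDb : ∀ t q, ‖D t q‖ ≤ CD * ‖K q‖) (hCD : 0 ≤ CD)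
    {τ T : ℝ} (hτ : τ ≤ T) {q : ℝ → W} (hq : Continuous q) :
    min (1 / 4) (m₀ / 2) * (‖∫ s in T..τ, q s‖ ^ 2
        + ∫ t in τ..T, (‖∫ s in T..t, q s‖ ^ 2 + ‖K (q t)‖ ^ 2))
      ≤ (∫ t in τ..T, ⟪∫ s in T..t, q s,
            -((Real.exp (weightRate m₀ CD * (t - τ))) • ((1 / 2 : ℝ) • q t + D t (q t)))⟫)
        + ∫ t in τ..T, ⟪K (q t), Real.exp (weightRate m₀ CD * (t - τ)) • P t (q t)⟫ := by
  have hE := integral_exp_mul_inner_primitive hq (weightRate m₀ CD) τ T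
  have hφc := continuous_primitive_of_continuous hq T
  set φ := fun t => ∫ s in T..t, q s with hφ
  set l := weightRate m₀ CD with hl
  have hl0 : 0 ≤ l := by rw [hl, weightRate]; positivity
  set w : ℝ → ℝ := fun t => Real.exp (l * (t - τ)) with hw
  have hwc : Continuous w := by fun_prop
  set c := min (1 / 4) (m₀ / 2) with hc
  have hDb' : ∀ t q, ‖D t q‖ ≤ (CD * ‖K‖) * ‖q‖ := fun t q =>
    (hDb t q).trans (by rw [mul_assoc]; gcongr; exact K.le_opNorm q)
  have i1 := intervalIntegrable_inner_family hD hDb' hφc hwc hq τ T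
  have i2 : IntervalIntegrable (fun t => w t * ⟪K (q t), P t (q t)⟫) volume τ T :=
    intervalIntegrable_inner_family hP hPb (K.continuous.comp hq) hwc hq τ T
  have i3 : IntervalIntegrable (fun t => w t * ⟪φ t, q t⟫) volume τ T :=
    Continuous.intervalIntegrable (by fun_prop) _ _
  have i4 : IntervalIntegrable (fun t => w t * ‖φ t‖ ^ 2) volume τ T :=
    Continuous.intervalIntegrable (by fun_prop) _ _
  have i5 : IntervalIntegrable (fun t => w t * ‖K (q t)‖ ^ 2) volume τ T :=
    Continuous.intervalIntegrable (by fun_prop) _ _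
  have i6 : IntervalIntegrable (fun t => ‖φ t‖ ^ 2 + ‖K (q t)‖ ^ 2) volume τ T :=
    Continuous.intervalIntegrable (by fun_prop) _ _
  have e1 : ∀ t, ⟪φ t, -(w t • ((1 / 2 : ℝ) • q t + D t (q t)))⟫
      = -(1 / 2) * (w t * ⟪φ t, q t⟫) - w t * ⟪φ t, D t (q t)⟫ := by
    intro t
    rw [inner_neg_right, inner_smul_right, inner_add_right, inner_smul_right]
    ring
  have e2 : ∀ t, ⟪K (q t), w t • P t (q t)⟫ = w t * ⟪K (q t), P t (q t)⟫ := fun t => by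
    rw [inner_smul_right]
  have I1 : (∫ t in τ..T, ⟪φ t, -(w t • ((1 / 2 : ℝ) • q t + D t (q t)))⟫)
      = -(1 / 2) * (∫ t in τ..T, w t * ⟪φ t, q t⟫) - ∫ t in τ..T, w t * ⟪φ t, D t (q t)⟫ := by
    simp_rw [e1]
    rw [intervalIntegral.integral_sub (i3.const_mul _) i1, intervalIntegral.integral_const_mul]
  have I2 : (∫ t in τ..T, ⟪K (q t), w t • P t (q t)⟫)
      = ∫ t in τ..T, w t * ⟪K (q t), P t (q t)⟫ := by simp_rw [e2]
  have I3 : (∫ t in τ..T, w t * ⟪φ t, D t (q t)⟫) - ∫ t in τ..T, w t * ⟪K (q t), P t (q t)⟫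
      ≤ CD ^ 2 / (2 * m₀) * (∫ t in τ..T, w t * ‖φ t‖ ^ 2)
        - m₀ / 2 * ∫ t in τ..T, w t * ‖K (q t)‖ ^ 2 := by
    rw [← intervalIntegral.integral_sub i1 i2, ← intervalIntegral.integral_const_mul,
      ← intervalIntegral.integral_const_mul,
      ← intervalIntegral.integral_sub (i4.const_mul _) (i5.const_mul _)]
    refine intervalIntegral.integral_mono_on hτ (i1.sub i2)
      ((i4.const_mul _).sub (i5.const_mul _)) fun t _ => ?_
    have hw0 : 0 < w t := Real.exp_pos _
    have h1 : ⟪φ t, D t (q t)⟫ ≤ ‖φ t‖ * (CD * ‖K (q t)‖) :=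
      (real_inner_le_norm _ _).trans (by gcongr; exact hDb t _)
    have h2 := hPc t (q t)
    have h3 : ‖φ t‖ * (CD * ‖K (q t)‖)
        ≤ CD ^ 2 / (2 * m₀) * ‖φ t‖ ^ 2 + m₀ / 2 * ‖K (q t)‖ ^ 2 := by
      have h4 : CD ^ 2 / (2 * m₀) * ‖φ t‖ ^ 2 + m₀ / 2 * ‖K (q t)‖ ^ 2
          - ‖φ t‖ * (CD * ‖K (q t)‖) = (CD * ‖φ t‖ - m₀ * ‖K (q t)‖) ^ 2 / (2 * m₀) := by
        field_simp
        ring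
      have h5 : 0 ≤ (CD * ‖φ t‖ - m₀ * ‖K (q t)‖) ^ 2 / (2 * m₀) := by positivity
      linarith
    have h6 : w t * (⟪φ t, D t (q t)⟫ - ⟪K (q t), P t (q t)⟫)
        ≤ w t * (CD ^ 2 / (2 * m₀) * ‖φ t‖ ^ 2 - m₀ / 2 * ‖K (q t)‖ ^ 2) :=
      mul_le_mul_of_nonneg_left (by linarith) hw0.le
    linarith
  have I4 : c * (∫ t in τ..T, (‖φ t‖ ^ 2 + ‖K (q t)‖ ^ 2))
      ≤ (∫ t in τ..T, w t * ‖φ t‖ ^ 2) + m₀ / 2 * ∫ t in τ..T, w t * ‖K (q t)‖ ^ 2 := by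
    rw [← intervalIntegral.integral_const_mul, ← intervalIntegral.integral_const_mul,
      ← intervalIntegral.integral_add i4 (i5.const_mul _)]
    refine intervalIntegral.integral_mono_on hτ (i6.const_mul _) (i4.add (i5.const_mul _))
      fun t ht => ?_
    have hw1 : 1 ≤ w t := Real.one_le_exp (mul_nonneg hl0 (by linarith [ht.1]))
    have hc1 : c ≤ 1 := (min_le_left _ _).trans (by norm_num)
    have hc2 : c ≤ m₀ / 2 := min_le_right _ _
    have a1 : c * ‖φ t‖ ^ 2 ≤ w t * ‖φ t‖ ^ 2 := by gcongr; linarith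
    have a2 : c * ‖K (q t)‖ ^ 2 ≤ (m₀ / 2 * w t) * ‖K (q t)‖ ^ 2 := by
      gcongr; nlinarith
    linarith
  have I5 : c * ‖φ τ‖ ^ 2 ≤ 1 / 4 * ‖φ τ‖ ^ 2 := by gcongr; exact min_le_left _ _
  have e3 : ‖∫ s in T..τ, q s‖ = ‖φ τ‖ := rfl
  rw [I1, I2, hE, e3]
  have hl4 : l / 4 = CD ^ 2 / (2 * m₀) + 1 := by rw [hl, weightRate]; ring
  have e4 : (∫ t in τ..T, Real.exp (l * (t - τ)) * ‖∫ s in T..t, q s‖ ^ 2)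
      = ∫ t in τ..T, w t * ‖φ t‖ ^ 2 := rfl
  rw [e4]
  generalize (∫ t in τ..T, w t * ‖φ t‖ ^ 2) = Z at *
  have : l / 4 * Z = (CD ^ 2 / (2 * m₀) + 1) * Z := by rw [hl4]
  linarith

/-- Boundedness of the source functional in terms of the norm of the test function. -/
theorem abs_source_le [CompleteSpace W] (K : W →L[ℝ] H) (D : ℝ → W →L[ℝ] W)
    (hD : ∀ w, StronglyMeasurable fun t => D t w) {CD : ℝ}
    (hDb : ∀ t q, ‖D t q‖ ≤ CD * ‖K q‖) (hCD : 0 ≤ CD) {l : ℝ} (hl : 0 ≤ l)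
    {τ T T' : ℝ} (hτ : τ ≤ T) (hT' : T - τ ≤ T') (h : W) {q : ℝ → W} (hq : Continuous q) :
    |∫ t in τ..T, Real.exp (l * (t - τ)) * ((1 / 2) * ⟪h, q t⟫ + ⟪h, D t (q t)⟫)|
      ≤ 1 / 2 * ‖h‖ * (‖∫ s in T..τ, q s‖
          + l * Real.exp (l * T') * ∫ t in τ..T, ‖∫ s in T..t, q s‖)
        + Real.exp (l * T') * ‖h‖ * CD * ∫ t in τ..T, ‖K (q t)‖ := by
  have hE := integral_exp_mul_inner_const hq h l τ T
  have hφc := continuous_primitive_of_continuous hq T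
  set φ := fun t => ∫ s in T..t, q s with hφ
  set w : ℝ → ℝ := fun t => Real.exp (l * (t - τ)) with hw
  have hwc : Continuous w := by fun_prop
  have hDb' : ∀ t q, ‖D t q‖ ≤ (CD * ‖K‖) * ‖q‖ := fun t q =>
    (hDb t q).trans (by rw [mul_assoc]; gcongr; exact K.le_opNorm q)
  have i1 := intervalIntegrable_inner_family hD hDb' (φ := fun _ => h) continuous_const hwc hq τ T
  have i2 : IntervalIntegrable (fun t => w t * ⟪h, q t⟫) volume τ T :=
    Continuous.intervalIntegrable (by fun_prop) _ _
  have hwb : ∀ t ∈ Icc τ T, w t ≤ Real.exp (l * T') := fun t ht =>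
    Real.exp_le_exp.2 (mul_le_mul_of_nonneg_left (by linarith [ht.2]) hl)
  have e0 : (∫ t in τ..T, w t * ((1 / 2) * ⟪h, q t⟫ + ⟪h, D t (q t)⟫))
      = 1 / 2 * (∫ t in τ..T, w t * ⟪h, q t⟫) + ∫ t in τ..T, w t * ⟪h, D t (q t)⟫ := by
    rw [← intervalIntegral.integral_const_mul, ← intervalIntegral.integral_add (i2.const_mul _) i1]
    congr 1
    ext t
    ring
  have b1 : |∫ t in τ..T, w t * ⟪h, φ t⟫| ≤ Real.exp (l * T') * ‖h‖ * ∫ t in τ..T, ‖φ t‖ := by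
    refine (intervalIntegral.abs_integral_le_integral_abs hτ).trans ?_
    rw [← intervalIntegral.integral_const_mul]
    refine intervalIntegral.integral_mono_on hτ
      (Continuous.intervalIntegrable (by fun_prop) _ _)
      (Continuous.intervalIntegrable (by fun_prop) _ _) fun t ht => ?_
    rw [abs_mul, abs_of_pos (Real.exp_pos _), mul_assoc]
    exact mul_le_mul (hwb t ht) (abs_real_inner_le_norm _ _) (abs_nonneg _) (Real.exp_pos _).le
  have b2 : |∫ t in τ..T, w t * ⟪h, D t (q t)⟫|
      ≤ Real.exp (l * T') * ‖h‖ * CD * ∫ t in τ..T, ‖K (q t)‖ := by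
    refine (intervalIntegral.abs_integral_le_integral_abs hτ).trans ?_
    rw [← intervalIntegral.integral_const_mul]
    refine intervalIntegral.integral_mono_on hτ i1.abs
      (Continuous.intervalIntegrable (by fun_prop) _ _) fun t ht => ?_
    rw [abs_mul, abs_of_pos (Real.exp_pos _), mul_assoc, mul_assoc]
    refine mul_le_mul (hwb t ht) ((abs_real_inner_le_norm _ _).trans ?_) (abs_nonneg _)
      (Real.exp_pos _).le
    gcongr
    exact hDb t _
  have b3 : |⟪h, φ τ⟫| ≤ ‖h‖ * ‖φ τ‖ := abs_real_inner_le_norm _ _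
  change |∫ t in τ..T, w t * ((1 / 2) * ⟪h, q t⟫ + ⟪h, D t (q t)⟫)| ≤ 1 / 2 * ‖h‖ * (‖φ τ‖
          + l * Real.exp (l * T') * ∫ t in τ..T, ‖φ t‖) + _
  have hE' : ∫ t in τ..T, w t * ⟪h, q t⟫ = -⟪h, φ τ⟫ - l * ∫ t in τ..T, w t * ⟪h, φ t⟫ := hE
  rw [e0, hE']
  have b4 := mul_le_mul_of_nonneg_left b1 hl
  rw [← abs_of_nonneg hl, ← abs_mul, abs_of_nonneg hl] at b4
  rw [abs_le] at *
  constructor <;> linarith [b2.1, b2.2, b3.1, b3.2, b4.1, b4.2]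

/-- **Existence of a regular solution** of `⟪(K f)', P q⟫ = ½ ⟪h + f, q⟫ + ⟪h + f, D q⟫`, `f(T) = 0`.
Here `p` is the time derivative of `K f`, and `f₀` is the value of `f` at `τ`. The principal part
`½ ⟪f, q⟫` does not depend on time, so that its pairing with `q = f'` is the derivative of
`¼ ‖f‖²`; this bounds `f` in `W` at the fixed time `τ`, although `P` and `D` are only measurable
in time. -/
theorem exists_implicit_solution [CompleteSpace W] [CompleteSpace H] (K : W →L[ℝ] H)
    (P : ℝ → W →L[ℝ] H) (D : ℝ → W →L[ℝ] W)
    (hP : ∀ w, StronglyMeasurable fun t => P t w) (hD : ∀ w, StronglyMeasurable fun t => D t w)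
    {m₀ CP CD : ℝ} (hm₀ : 0 < m₀)
    (hPc : ∀ t q, m₀ * ‖K q‖ ^ 2 ≤ ⟪K q, P t q⟫) (hPb : ∀ t q, ‖P t q‖ ≤ CP * ‖q‖)
    (hDb : ∀ t q, ‖D t q‖ ≤ CD * ‖K q‖) (hCD : 0 ≤ CD)
    {τ T T' : ℝ} (hτ : τ ≤ T) (hT' : T - τ ≤ T') (h : W) :
    ∃ (f : ℝ → W) (p : ℝ → H) (f₀ : W), MemLp f 2 (volume.restrict (Ioc τ T)) ∧
      MemLp p 2 (volume.restrict (Ioc τ T)) ∧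
      (∀ᵐ t ∂(volume.restrict (Ioc τ T)), ∀ q,
        ⟪p t, P t q⟫ = (1 / 2) * ⟪h + f t, q⟫ + ⟪h + f t, D t q⟫) ∧
      (∀ᵐ t ∂(volume.restrict (Ioc τ T)), K (f t) = ∫ s in T..t, p s) ∧
      K f₀ = ∫ s in T..τ, p s ∧ ‖f₀‖ ≤ stabilityConst m₀ CD T' * ‖h‖ := by
  set ν := volume.restrict (Ioc τ T) with hν
  set l := weightRate m₀ CD with hl
  set w : ℝ → ℝ := fun t => Real.exp (l * (t - τ)) with hw
  have hwc : Continuous w := by fun_prop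
  have hl0 : 0 ≤ l := by rw [hl, weightRate]; positivity
  have hprim : ∀ q : C(ℝ, W), MemLp (primitiveLinear W T q) 2 ν := fun q =>
    memLp_of_continuous (continuous_primitive_of_continuous q.continuous T) τ T
  have hK1 : ∀ q : C(ℝ, W), MemLp (familyLinear (fun _ => 1) (fun _ => K) q) 2 ν := fun q =>
    memLp_familyLinear continuous_const (fun _ => stronglyMeasurable_const)
      (fun _ q => K.le_opNorm q) τ T q
  have hL1 : ∀ q : C(ℝ, W), MemLp (familyLinear (fun t => -w t)
      (fun t => (1 / 2 : ℝ) • ContinuousLinearMap.id ℝ W + D t) q) 2 ν := fun q =>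
    memLp_familyLinear (C := 1 / 2 + CD * ‖K‖) hwc.neg
      (fun v => (stronglyMeasurable_const (b := (1 / 2 : ℝ) • v)).add (hD v))
      (fun t q => by
        have h1 : ‖D t q‖ ≤ CD * (‖K‖ * ‖q‖) := (hDb t q).trans (by gcongr; exact K.le_opNorm q)
        calc ‖((1 / 2 : ℝ) • ContinuousLinearMap.id ℝ W + D t) q‖
            = ‖(1 / 2 : ℝ) • q + D t q‖ := rfl
          _ ≤ ‖(1 / 2 : ℝ) • q‖ + ‖D t q‖ := norm_add_le _ _
          _ ≤ (1 / 2 + CD * ‖K‖) * ‖q‖ := by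
            rw [norm_smul]; norm_num; linarith) τ T q
  have hL2 : ∀ q : C(ℝ, W), MemLp (familyLinear w P q) 2 ν := fun q =>
    memLp_familyLinear hwc hP hPb τ T q
  -- test functions `q` enter through `Γ q = (φ, K q, φ(τ))` with `φ(t) = ∫_T^t q`; a limit point of
  -- the range of `Γ` has the form `(f, (K f)', f(τ))`
  let Γ1 := toLpLinear _ hprim
  let Γ2 := toLpLinear _ hK1
  let Γ3 : C(ℝ, W) →ₗ[ℝ] W := LinearMap.proj τ ∘ₗ primitiveLinear W T
  let L1 := toLpLinear _ hL1
  let L2 := toLpLinear _ hL2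
  let X := WithLp 2 (Lp W 2 ν × WithLp 2 (Lp H 2 ν × W))
  let mk : (Lp W 2 ν × Lp H 2 ν × W) →ₗ[ℝ] X :=
    (WithLp.linearEquiv 2 ℝ (Lp W 2 ν × WithLp 2 (Lp H 2 ν × W))).symm.toLinearMap ∘ₗ
      (LinearMap.prodMap LinearMap.id (WithLp.linearEquiv 2 ℝ (Lp H 2 ν × W)).symm.toLinearMap)
  let Γ : C(ℝ, W) →ₗ[ℝ] X := mk ∘ₗ (Γ1.prod (Γ2.prod Γ3))
  let L : C(ℝ, W) →ₗ[ℝ] X := mk ∘ₗ (L1.prod (L2.prod 0))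
  have hΓn : ∀ q, ‖Γ q‖ ^ 2 = ‖Γ1 q‖ ^ 2 + (‖Γ2 q‖ ^ 2 + ‖Γ3 q‖ ^ 2) := by
    intro q
    rw [WithLp.prod_norm_sq_eq_of_L2]
    congr 1
    exact WithLp.prod_norm_sq_eq_of_L2 _
  have hin : ∀ (x : X) q, ⟪x, L q⟫ = ⟪x.fst, L1 q⟫ + ⟪x.snd.fst, L2 q⟫ := by
    intro x q
    rw [WithLp.prod_inner_apply]
    congr 1
    refine (WithLp.prod_inner_apply _ _).trans ?_
    have : ⟪x.snd.snd, (0 : W)⟫ = 0 := inner_zero_right _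
    exact (congrArg₂ (· + ·) rfl this).trans (add_zero _)
  have hc0 : 0 < min (1 / 4) (m₀ / 2) := lt_min (by norm_num) (by positivity)
  have hT'0 : 0 ≤ T' := by linarith
  have hval : ∀ (q : C(ℝ, W)) t, familyLinear (fun t => -w t)
      (fun t => (1 / 2 : ℝ) • ContinuousLinearMap.id ℝ W + D t) q t
      = -(w t • ((1 / 2 : ℝ) • q t + D t (q t))) := fun q t => neg_smul _ _
  have hcoer : ∀ q, min (1 / 4) (m₀ / 2) * ‖Γ q‖ ^ 2 ≤ ⟪Γ q, L q⟫ := by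
    intro q
    have h1 := coercive_spacetime K P D hP hD hm₀ hPc hPb hDb hCD hτ q.continuous
    have n1 : ‖Γ1 q‖ ^ 2 = ∫ t, ‖∫ s in T..t, q s‖ ^ 2 ∂ν := norm_toLpLinear_sq _ hprim q
    have n2 : ‖Γ2 q‖ ^ 2 = ∫ t, ‖K (q t)‖ ^ 2 ∂ν := by
      refine (norm_toLpLinear_sq _ hK1 q).trans ?_
      simp [familyLinear]
    have n3 : ⟪Γ1 q, L1 q⟫
        = ∫ t, ⟪∫ s in T..t, q s, -(w t • ((1 / 2 : ℝ) • q t + D t (q t)))⟫ ∂ν := by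
      refine (inner_toLpLinear _ hL1 _ q).trans (integral_congr_ae ?_)
      filter_upwards [(hprim q).coeFn_toLp] with t ht
      rw [hval]
      exact congrArg (⟪·, _⟫) ht
    have n4 : ⟪Γ2 q, L2 q⟫ = ∫ t, ⟪K (q t), w t • P t (q t)⟫ ∂ν := by
      refine (inner_toLpLinear _ hL2 _ q).trans (integral_congr_ae ?_)
      filter_upwards [(hK1 q).coeFn_toLp] with t ht
      have : (Γ2 q : ℝ → H) t = K (q t) := ht.trans (one_smul ℝ _)
      rw [this]
      rfl
    have n5 : ⟪Γ q, L q⟫ = ⟪Γ1 q, L1 q⟫ + ⟪Γ2 q, L2 q⟫ := hin (Γ q) q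
    rw [n5, n3, n4, hΓn, n1, n2]
    rw [intervalIntegral.integral_of_le hτ, intervalIntegral.integral_of_le hτ,
      intervalIntegral.integral_of_le hτ, integral_add, ← hν] at h1
    · refine le_trans (le_of_eq ?_) h1
      have n6 : ‖Γ3 q‖ = ‖∫ s in T..τ, q s‖ := rfl
      rw [n6]
      ring
    · exact ((hprim q).norm.integrable_sq)
    · exact ((memLp_of_continuous (K.continuous.comp q.continuous) τ T).norm.integrable_sq)
  let hcst : Lp W 2 ν := (memLp_of_continuous (continuous_const (y := h)) τ T).toLp
  let ℓ : C(ℝ, W) →ₗ[ℝ] ℝ := -((innerSL ℝ hcst).toLinearMap ∘ₗ L1)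
  have hℓ : ∀ q : C(ℝ, W), ℓ q = ∫ t, w t * ((1 / 2) * ⟪h, q t⟫ + ⟪h, D t (q t)⟫) ∂ν := by
    intro q
    have h1 : ℓ q = -⟪hcst, L1 q⟫ := rfl
    rw [h1, inner_toLpLinear, ← integral_neg]
    refine integral_congr_ae ?_
    filter_upwards [(memLp_of_continuous (continuous_const (y := h)) τ T).coeFn_toLp] with t ht
    rw [hval]
    have : (hcst : ℝ → W) t = h := ht
    rw [this, inner_neg_right, inner_smul_right, inner_add_right, inner_smul_right, neg_neg]
  set E := Real.exp (l * T') with hE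
  set C := 1 / 2 * (1 + l * E * √T') + E * CD * √T' with hCdef
  have hC0 : 0 ≤ C := by positivity
  have hℓb : ∀ q, |ℓ q| ≤ (C * ‖h‖) * ‖Γ q‖ := by
    intro q
    have h1 := abs_source_le K D hD hDb hCD hl0 hτ hT' h q.continuous
    rw [intervalIntegral.integral_of_le hτ, ← hν] at h1
    rw [hℓ q]
    refine h1.trans ?_
    have g : ∀ a, 0 ≤ a → a ^ 2 ≤ ‖Γ q‖ ^ 2 → a ≤ ‖Γ q‖ := fun a ha h2 =>
      (pow_le_pow_iff_left₀ ha (norm_nonneg _) two_ne_zero).1 h2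
    have g1 : ‖Γ1 q‖ ≤ ‖Γ q‖ := g _ (norm_nonneg _) (by
      rw [hΓn]; nlinarith [norm_nonneg (Γ2 q), norm_nonneg (Γ3 q)])
    have g2 : ‖Γ2 q‖ ≤ ‖Γ q‖ := g _ (norm_nonneg _) (by
      rw [hΓn]; nlinarith [norm_nonneg (Γ1 q), norm_nonneg (Γ3 q)])
    have g3 : ‖Γ3 q‖ ≤ ‖Γ q‖ := g _ (norm_nonneg _) (by
      rw [hΓn]; nlinarith [norm_nonneg (Γ1 q), norm_nonneg (Γ2 q)])
    have k1 : ∫ t in τ..T, ‖∫ s in T..t, q s‖ ≤ √T' * ‖Γ q‖ := by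
      rw [intervalIntegral.integral_of_le hτ]
      refine le_trans (le_of_eq ?_) ((integral_norm_le_sqrt_mul_norm hτ hT' (Γ1 q)).trans
        (by gcongr))
      refine integral_congr_ae ?_
      filter_upwards [(hprim q).coeFn_toLp] with t ht
      exact congrArg norm ht.symm
    have k2 : ∫ t in τ..T, ‖K (q t)‖ ≤ √T' * ‖Γ q‖ := by
      rw [intervalIntegral.integral_of_le hτ]
      refine le_trans (le_of_eq ?_) ((integral_norm_le_sqrt_mul_norm hτ hT' (Γ2 q)).trans
        (by gcongr))
      refine integral_congr_ae ?_
      filter_upwards [(hK1 q).coeFn_toLp] with t ht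
      exact congrArg norm (ht.trans (one_smul ℝ _)).symm
    have k3 : ‖∫ s in T..τ, q s‖ ≤ ‖Γ q‖ := g3
    calc _ ≤ 1 / 2 * ‖h‖ * (‖Γ q‖ + l * E * (√T' * ‖Γ q‖)) + E * ‖h‖ * CD * (√T' * ‖Γ q‖) := by
          gcongr
      _ = (C * ‖h‖) * ‖Γ q‖ := by rw [hCdef]; ring
  obtain ⟨x, hx, hxL, hxn⟩ := exists_lions_solution Γ L ℓ hc0 hcoer hℓb (by positivity)
  obtain ⟨y, hy, hyx⟩ := mem_closure_iff_seq_limit.1 hx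
  choose Q hQ using hy
  have t1 : Tendsto (fun n => Γ1 (Q n)) atTop (𝓝 x.fst) := by
    have : Tendsto (fun n => (WithLp.fstL 2 ℝ _ _) (y n)) atTop
      (𝓝 ((WithLp.fstL 2 ℝ (Lp W 2 ν) (WithLp 2 (Lp H 2 ν × W))) x)) :=
      ((ContinuousLinearMap.continuous _).tendsto x).comp hyx
    refine this.congr fun n => ?_
    rw [← hQ n]
    rfl
  have t23 : Tendsto (fun n => (y n).snd) atTop (𝓝 x.snd) :=
    ((WithLp.sndL 2 ℝ (Lp W 2 ν) (WithLp 2 (Lp H 2 ν × W))).continuous.tendsto x).comp hyx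
  have t2 : Tendsto (fun n => Γ2 (Q n)) atTop (𝓝 x.snd.fst) := by
    have : Tendsto (fun n => (WithLp.fstL 2 ℝ _ _) (y n).snd) atTop
      (𝓝 ((WithLp.fstL 2 ℝ (Lp H 2 ν) W) x.snd)) :=
      ((ContinuousLinearMap.continuous _).tendsto x.snd).comp t23
    refine this.congr fun n => ?_
    rw [← hQ n]
    rfl
  have t3 : Tendsto (fun n => Γ3 (Q n)) atTop (𝓝 x.snd.snd) := by
    have : Tendsto (fun n => (WithLp.sndL 2 ℝ _ _) (y n).snd) atTop
      (𝓝 ((WithLp.sndL 2 ℝ (Lp H 2 ν) W) x.snd)) :=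
      ((ContinuousLinearMap.continuous _).tendsto x.snd).comp t23
    refine this.congr fun n => ?_
    rw [← hQ n]
    rfl
  -- `K φ(t) = ∫_T^t K q` survives in the limit: integrals over time intervals pass to the limit, tested with a fixed vector
  have hlim : ∀ t ∈ Icc τ T, ∀ v : W, ∀ φ : ℕ → ℕ, StrictMono φ →
      Tendsto (fun n => ∫ s in T..t, Q (φ n) s) atTop (𝓝 v) → K v = ∫ s in T..t, x.snd.fst s := by
    intro t ht v φ hφ hv
    refine ext_inner_left ℝ fun z => ?_
    have hsub : Ioc t T ⊆ Ioc τ T := Ioc_subset_Ioc_left ht.1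
    have e1 : ∀ u : ℝ → H, ∫ s in T..t, u s = -∫ s in Ioc t T, u s ∂ν := by
      intro u
      rw [intervalIntegral.integral_of_ge ht.2, hν, Measure.restrict_restrict measurableSet_Ioc,
        inter_eq_self_of_subset_left hsub]
    have hfin : ν (Ioc t T) ≠ ⊤ := measure_ne_top _ _
    have l1 : Tendsto (fun n => ⟪indicatorConstLp 2 measurableSet_Ioc hfin z, Γ2 (Q (φ n))⟫) atTop
        (𝓝 ⟪indicatorConstLp 2 measurableSet_Ioc hfin z, x.snd.fst⟫) :=
      (tendsto_const_nhds.inner t2).comp hφ.tendsto_atTop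
    have l2 : Tendsto (fun n => -⟪z, K (∫ s in T..t, Q (φ n) s)⟫) atTop (𝓝 (-⟪z, K v⟫)) :=
      (tendsto_const_nhds.inner ((K.continuous.tendsto v).comp hv)).neg
    have l3 : ∀ n, ⟪indicatorConstLp 2 measurableSet_Ioc hfin z, Γ2 (Q (φ n))⟫
        = -⟪z, K (∫ s in T..t, Q (φ n) s)⟫ := by
      intro n
      rw [MeasureTheory.L2.inner_indicatorConstLp_eq_inner_setIntegral ℝ,
        ← K.intervalIntegral_comp_comm ((Q (φ n)).continuous.intervalIntegrable _ _), e1,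
        inner_neg_right, neg_neg]
      congr 1
      refine integral_congr_ae (ae_restrict_of_ae ?_)
      filter_upwards [(hK1 (Q (φ n))).coeFn_toLp] with s hs
      exact hs.trans (one_smul ℝ _)
    have l4 := tendsto_nhds_unique (l1.congr l3) l2
    rw [MeasureTheory.L2.inner_indicatorConstLp_eq_inner_setIntegral ℝ] at l4
    rw [e1, inner_neg_right, l4, neg_neg]
  refine ⟨x.fst, x.snd.fst, x.snd.snd, Lp.memLp _, Lp.memLp _, ?_, ?_, ?_, ?_⟩
  · -- localization in time: test with `ψ • g` for smooth `ψ` and `g` in a countable dense set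
    obtain ⟨S, hSc, hSd⟩ := TopologicalSpace.exists_countable_dense W
    have hg : ∀ g : W, ∀ᵐ t ∂ν, w t * (⟪x.snd.fst t, P t g⟫
        - ((1 / 2) * ⟪h + x.fst t, g⟫ + ⟪h + x.fst t, D t g⟫)) = 0 := by
      intro g
      have mP : MemLp (fun t => P t g) 2 ν :=
        MemLp.of_bound (hP g).aestronglyMeasurable _ (Eventually.of_forall fun t => hPb t g)
      have mD : MemLp (fun t => D t g) 2 ν :=
        MemLp.of_bound (hD g).aestronglyMeasurable _ (Eventually.of_forall fun t => hDb t g)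
      have mf : MemLp (fun t => h + x.fst t) 2 ν := (memLp_const h).add (Lp.memLp _)
      have mg : MemLp (fun _ : ℝ => g) 2 ν := memLp_const g
      have j1 := integrable_inner_of_memLp (Lp.memLp x.snd.fst) mP
      have j2 := integrable_inner_of_memLp mf mg
      have j3 := integrable_inner_of_memLp mf mD
      have jw : ∀ {u : ℝ → ℝ}, Integrable u ν → ∀ v : ℝ → ℝ, Continuous v →
          Integrable (fun t => v t * u t) ν := by
        intro u hu v hv
        obtain ⟨B, hB⟩ := isCompact_Icc.exists_bound_of_continuousOn (s := Icc τ T) hv.continuousOn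
        refine hu.bdd_mul hv.aestronglyMeasurable (c := B) ?_
        filter_upwards [ae_restrict_mem measurableSet_Ioc] with t ht
        exact hB t (Ioc_subset_Icc_self ht)
      refine ae_eq_zero_of_integral_contDiff_smul_eq_zero
        (jw (j1.sub ((j2.const_mul (1 / 2)).add j3)) w hwc).locallyIntegrable ?_
      intro ψ hψ _
      let q : C(ℝ, W) := ⟨fun t => ψ t • g, hψ.continuous.smul continuous_const⟩
      have hq := hxL q
      rw [hin, hℓ, inner_toLpLinear, inner_toLpLinear] at hq
      have v1 : ∀ t, w t * ((1 / 2) * ⟪h, q t⟫ + ⟪h, D t (q t)⟫)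
          = (ψ t * w t) * ((1 / 2) * ⟪h, g⟫ + ⟪h, D t g⟫) := by
        intro t
        simp only [q, ContinuousMap.coe_mk, map_smul, inner_smul_right]
        ring
      have v2 : ∀ t, ⟪x.fst t, familyLinear (fun t => -w t)
          (fun t => (1 / 2 : ℝ) • ContinuousLinearMap.id ℝ W + D t) q t⟫
          = -((ψ t * w t) * ((1 / 2) * ⟪x.fst t, g⟫ + ⟪x.fst t, D t g⟫)) := by
        intro t
        rw [hval]
        simp only [q, ContinuousMap.coe_mk, map_smul, inner_smul_right, inner_neg_right,
          inner_add_right]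
        ring
      have v3 : ∀ t, ⟪x.snd.fst t, familyLinear w P q t⟫ = (ψ t * w t) * ⟪x.snd.fst t, P t g⟫ := by
        intro t
        simp only [q, familyLinear, LinearMap.coe_mk, AddHom.coe_mk, ContinuousMap.coe_mk,
          map_smul, inner_smul_right]
        ring
      simp_rw [v1, v2, v3] at hq
      have j4 := integrable_inner_of_memLp (Lp.memLp x.fst) mg
      have j5 := integrable_inner_of_memLp (Lp.memLp x.fst) mD
      have j6 := integrable_inner_of_memLp (memLp_const (μ := ν) (p := 2) h) mD
      have hψw : Continuous (fun t => ψ t * w t) := hψ.continuous.mul hwc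
      have u1 := jw ((j4.const_mul (1 / 2)).add j5) _ hψw
      have u2 := jw j1 _ hψw
      have u3 := jw ((integrable_const ((1 / 2) * ⟪h, g⟫)).add j6) _ hψw
      have e1 : ∀ t, ψ t • (w t * (⟪x.snd.fst t, P t g⟫
            - ((1 / 2) * ⟪h + x.fst t, g⟫ + ⟪h + x.fst t, D t g⟫)))
          = -((ψ t * w t) * ((1 / 2) * ⟪x.fst t, g⟫ + ⟪x.fst t, D t g⟫))
            + (ψ t * w t) * ⟪x.snd.fst t, P t g⟫
            - (ψ t * w t) * ((1 / 2) * ⟪h, g⟫ + ⟪h, D t g⟫) := by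
        intro t
        rw [smul_eq_mul, inner_add_left, inner_add_left]
        ring
      simp only [Pi.add_apply] at u1 u3
      refine (integral_congr_ae (Eventually.of_forall e1)).trans ?_
      have u1n : Integrable (fun t => -((ψ t * w t)
          * ((1 / 2) * ⟪x.fst t, g⟫ + ⟪x.fst t, D t g⟫))) ν := u1.neg
      have u12 : Integrable (fun t => -((ψ t * w t)
          * ((1 / 2) * ⟪x.fst t, g⟫ + ⟪x.fst t, D t g⟫))
          + (ψ t * w t) * ⟪x.snd.fst t, P t g⟫) ν := u1n.add u2
      rw [integral_sub u12 u3, integral_add u1n u2]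
      exact sub_eq_zero.2 hq
    have hall : ∀ᵐ t ∂ν, ∀ g ∈ S, w t * (⟪x.snd.fst t, P t g⟫
        - ((1 / 2) * ⟪h + x.fst t, g⟫ + ⟪h + x.fst t, D t g⟫)) = 0 :=
      (ae_ball_iff hSc).2 fun g _ => hg g
    filter_upwards [hall] with t ht q
    have hcl : IsClosed {q : W | ⟪x.snd.fst t, P t q⟫
        = (1 / 2) * ⟪h + x.fst t, q⟫ + ⟪h + x.fst t, D t q⟫} :=
      isClosed_eq (by fun_prop) (by fun_prop)
    have hsub : S ⊆ {q : W | ⟪x.snd.fst t, P t q⟫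
        = (1 / 2) * ⟪h + x.fst t, q⟫ + ⟪h + x.fst t, D t q⟫} := by
      intro g hgS
      exact sub_eq_zero.1 ((mul_eq_zero.1 (ht g hgS)).resolve_left (Real.exp_pos _).ne')
    exact hcl.closure_subset_iff.2 hsub (hSd q)
  · obtain ⟨φ, hφ, hae⟩ := (tendstoInMeasure_of_tendsto_Lp t1).exists_seq_tendsto_ae
    have hco : ∀ᵐ t ∂ν, ∀ n, Γ1 (Q (φ n)) t = ∫ s in T..t, Q (φ n) s :=
      ae_all_iff.2 fun n => (hprim (Q (φ n))).coeFn_toLp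
    filter_upwards [hae, hco, ae_restrict_mem measurableSet_Ioc] with t h1 h2 h3
    refine hlim t (Ioc_subset_Icc_self h3) _ φ hφ ?_
    exact h1.congr h2
  · exact hlim τ ⟨le_rfl, hτ⟩ _ id strictMono_id t3
  · have h1 : ‖x.snd.snd‖ ≤ ‖x‖ := by
      have a1 := WithLp.prod_norm_sq_eq_of_L2 x
      have a2 := WithLp.prod_norm_sq_eq_of_L2 x.snd
      refine (pow_le_pow_iff_left₀ (norm_nonneg _) (norm_nonneg _) two_ne_zero).1 ?_
      nlinarith [sq_nonneg ‖x.fst‖, sq_nonneg ‖x.snd.fst‖]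
    refine h1.trans (hxn.trans (le_of_eq ?_))
    rw [stabilityConst, ← hl, ← hE, ← hCdef]
    ring

end existence




/-! ### Uniqueness for the implicit evolution equation -/

section uniqueness
variable {W H : Type*} [NormedAddCommGroup W] [InnerProductSpace ℝ W]
  [NormedAddCommGroup H] [InnerProductSpace ℝ H]

theorem measurePreserving_const_add (θ : ℝ) :
    MeasurePreserving (⇑(⟨fun s => θ + s, by fun_prop⟩ : C(ℝ, ℝ))) volume volume :=
  measurePreserving_add_left volume θ

/-- The correlation of two square integrable functions is continuous in the shift. -/
theorem continuous_integral_inner_translate {g F : ℝ → W} (hg : MemLp g 2 volume)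
    (hF : MemLp F 2 volume) : Continuous fun θ : ℝ => ∫ s, ⟪g (θ + s), F s⟫ := by
  have hc : Continuous fun θ : ℝ => (⟨fun s => θ + s, by fun_prop⟩ : C(ℝ, ℝ)) :=
    ContinuousMap.continuous_of_continuous_uncurry _ (by
      simp only [Function.uncurry_def, ContinuousMap.coe_mk]; fun_prop)
  have h1 : Continuous fun θ : ℝ => Lp.compMeasurePreserving (μ := volume)
      (⇑(⟨fun s => θ + s, by fun_prop⟩ : C(ℝ, ℝ))) (measurePreserving_const_add θ) hg.toLp :=
    Continuous.compMeasurePreservingLp continuous_const hc measurePreserving_const_add (by simp)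
  refine (h1.inner (continuous_const (y := hF.toLp))).congr fun θ => ?_
  rw [L2.inner_def]
  refine integral_congr_ae ?_
  have h2 := (measurePreserving_const_add θ).quasiMeasurePreserving.ae_eq_comp hg.coeFn_toLp
  filter_upwards [Lp.coeFn_compMeasurePreserving hg.toLp (measurePreserving_const_add θ), h2,
    hF.coeFn_toLp] with s a1 a2 a3
  rw [a1, a2, a3]
  rfl

/-- Averages of correlations: Fubini's theorem for `∫_s^{s+δ} g`. -/
theorem integral_inner_integral_translate [CompleteSpace W] {g F : ℝ → W} (hg : MemLp g 2 volume)
    (hF : MemLp F 2 volume) {δ : ℝ} (hδ : 0 ≤ δ) :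
    Integrable (fun s => ⟪∫ y in s..s + δ, g y, F s⟫) ∧
    ∫ s, ⟪∫ y in s..s + δ, g y, F s⟫ = ∫ θ in (0 : ℝ)..δ, ∫ s, ⟪g (θ + s), F s⟫ := by
  have hint : Integrable (fun z : ℝ × ℝ => ⟪g (z.1 + z.2), F z.2⟫)
      ((volume.restrict (Ioc 0 δ)).prod volume) := by
    have a1 : MemLp (fun z : ℝ × ℝ => g z.2) 2 ((volume.restrict (Ioc 0 δ)).prod volume) :=
      hg.comp_snd _
    have a2 : MemLp (fun z : ℝ × ℝ => F z.2) 2 ((volume.restrict (Ioc 0 δ)).prod volume) :=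
      hF.comp_snd _
    exact integrable_inner_of_memLp
      (a1.comp_measurePreserving (measurePreserving_prod_add _ _)) a2
  have hpt : ∀ s, ∫ θ in Ioc 0 δ, ⟪g (θ + s), F s⟫ = ⟪∫ y in s..s + δ, g y, F s⟫ := by
    intro s
    have hgi : IntervalIntegrable g volume s (s + δ) :=
      ⟨(hg.restrict _).integrable (by norm_num), (hg.restrict _).integrable (by norm_num)⟩
    have e1 : ∫ y in s..s + δ, g y = ∫ θ in Ioc 0 δ, g (θ + s) := by
      rw [← intervalIntegral.integral_of_le hδ, intervalIntegral.integral_comp_add_right]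
      simp [add_comm]
    have hi : IntegrableOn (fun θ => g (θ + s)) (Ioc 0 δ) := by
      have := hgi.comp_add_right s
      simp only [sub_self, add_sub_cancel_left] at this
      exact (intervalIntegrable_iff_integrableOn_Ioc_of_le hδ).1 this
    rw [e1, real_inner_comm, ← integral_inner hi]
    simp_rw [real_inner_comm]
  rw [intervalIntegral.integral_of_le hδ, integral_integral_swap hint]
  simp_rw [hpt]
  exact ⟨hint.integral_prod_right.congr (Eventually.of_forall hpt), trivial⟩

/-- **Uniqueness**: a square integrable `f` with `K† K f(t) = -∫_t^T B f` for almost every `t`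
vanishes. As `f` is not differentiable in time, the energy identity for `e^{2 l t} ‖K f‖²` is
replaced by an inequality for its translates by `δ`, which is differentiated at `δ = 0`. -/
theorem implicit_solution_unique [CompleteSpace W] [SecondCountableTopology W]
    (K : W →L[ℝ] H) (B : ℝ → W →L[ℝ] W)
    (hB : ∀ w, StronglyMeasurable fun t => B t w) {CB c l : ℝ} (hBb : ∀ t q, ‖B t q‖ ≤ CB * ‖q‖)
    (hc : 0 < c) (hl : 0 ≤ l) (hcoer : ∀ t q, c * ‖q‖ ^ 2 ≤ ⟪B t q, q⟫ + l * ‖K q‖ ^ 2)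
    {τ T : ℝ} {f : ℝ → W} (hf : MemLp f 2 (volume.restrict (Ioc τ T)))
    (heq : ∀ᵐ t ∂(volume.restrict (Ioc τ T)), ∀ v,
      ⟪K (f t), K v⟫ = -⟪∫ s in t..T, B s (f s), v⟫) :
    f =ᵐ[volume.restrict (Ioc τ T)] 0 := by
  set u : ℝ → W := (Ioc τ T).indicator f with hu
  have hum : MemLp u 2 volume := (memLp_indicator_iff_restrict measurableSet_Ioc).2 hf
  have hu0 : ∀ t, t ∉ Ioc τ T → u t = 0 := fun t ht => indicator_of_notMem ht _
  have hu1 : ∀ t, t ∈ Ioc τ T → u t = f t := fun t ht => indicator_of_mem ht _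
  set g : ℝ → W := fun t => B t (u t) with hg
  have hgm : MemLp g 2 volume :=
    hum.of_le_mul (aestronglyMeasurable_apply hB hum.1) (Eventually.of_forall fun t => hBb t (u t))
  have hg0 : ∀ t, t ∉ Ioc τ T → g t = 0 := fun t ht => by simp [hg, hu0 t ht]
  set w : ℝ → ℝ := fun t => Real.exp (2 * l * t) with hw
  have hw0 : ∀ t, 0 < w t := fun t => Real.exp_pos _
  have hwc : Continuous w := by fun_prop
  have hwle : ∀ t ∈ Ioc τ T, w t ≤ w T := fun t ht =>
    Real.exp_le_exp.2 (mul_le_mul_of_nonneg_left ht.2 (by positivity))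
  set F : ℝ → W := fun t => w t • u t with hF
  have hFm : MemLp F 2 volume := by
    refine hum.of_le_mul (c := w T) (hwc.aestronglyMeasurable.smul hum.1)
      (Eventually.of_forall fun t => ?_)
    by_cases ht : t ∈ Ioc τ T
    · rw [hF, norm_smul, Real.norm_of_nonneg (hw0 t).le]
      exact mul_le_mul_of_nonneg_right (hwle t ht) (norm_nonneg _)
    · simp [hF, hu0 t ht]
  have hgint : Integrable g volume := by
    have : g = (Ioc τ T).indicator g := by
      ext t
      by_cases ht : t ∈ Ioc τ T
      · rw [indicator_of_mem ht]
      · rw [indicator_of_notMem ht, hg0 t ht]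
    rw [this, integrable_indicator_iff measurableSet_Ioc]
    exact (hgm.restrict _).integrable (by norm_num)
  -- the weighted energy
  have heint : Integrable (fun s => w s * ‖K (u s)‖ ^ 2) := by
    have h1 := integrable_inner_of_memLp (K.comp_memLp' hFm) (K.comp_memLp' hum)
    refine h1.congr (Eventually.of_forall fun s => ?_)
    simp [hF, inner_smul_left]
  set E := ∫ s, w s * ‖K (u s)‖ ^ 2 with hE
  set ζ : ℝ → ℝ := fun θ => ∫ s, ⟪g (θ + s), F s⟫ with hζ
  have hζc : Continuous ζ := continuous_integral_inner_translate hgm hFm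
  -- the equation for the extended function
  have heq' : ∀ᵐ t, τ < t → ∀ v, ⟪K (u t), K v⟫ = -⟪∫ s in Ioi t, g s, v⟫ := by
    rw [ae_restrict_iff' measurableSet_Ioc] at heq
    filter_upwards [heq] with t ht hτt v
    by_cases htT : t ≤ T
    · rw [hu1 t ⟨hτt, htT⟩, ht ⟨hτt, htT⟩ v, intervalIntegral.integral_of_le htT]
      congr 2
      rw [← Ioc_union_Ioi_eq_Ioi htT, setIntegral_union (Ioc_disjoint_Ioi le_rfl) measurableSet_Ioi
        hgint.integrableOn hgint.integrableOn,
        setIntegral_eq_zero_of_forall_eq_zero (t := Ioi T)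
          (fun s hs => hg0 s fun h => absurd h.2 (not_le.2 hs)), add_zero]
      refine setIntegral_congr_fun measurableSet_Ioc fun s hs => ?_
      simp only [hg]
      rw [hu1 s ⟨hτt.trans hs.1, hs.2⟩]
    · rw [hu0 t fun h => htT h.2, setIntegral_eq_zero_of_forall_eq_zero]
      · simp
      · intro s hs
        exact hg0 s fun h => htT (le_of_lt (lt_of_lt_of_le hs h.2))
  -- comparison of the energies at `s` and `s + δ`, integrated in `s`
  have hineq : ∀ δ, 0 ≤ δ → (1 - Real.exp (-(2 * l * δ))) * E + 2 * ∫ θ in (0 : ℝ)..δ, ζ θ ≤ 0 := by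
    intro δ hδ
    have heq2 : ∀ᵐ t, τ < t + δ → ∀ v, ⟪K (u (t + δ)), K v⟫ = -⟪∫ s in Ioi (t + δ), g s, v⟫ :=
      (measurePreserving_add_right volume δ).quasiMeasurePreserving.ae heq'
    have hshift : Integrable (fun s => w s * ‖K (u (s + δ))‖ ^ 2) := by
      have := (heint.comp_add_right δ).const_mul (Real.exp (-(2 * l * δ)))
      refine this.congr (Eventually.of_forall fun s => ?_)
      simp only [hw]
      rw [← mul_assoc, ← Real.exp_add]
      ring_nf
    have hshiftE : ∫ s, w s * ‖K (u (s + δ))‖ ^ 2 = Real.exp (-(2 * l * δ)) * E := by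
      rw [hE, ← integral_add_right_eq_self (fun s => w s * ‖K (u s)‖ ^ 2) δ,
        ← integral_const_mul]
      refine integral_congr_ae (Eventually.of_forall fun s => ?_)
      simp only [hw]
      rw [← mul_assoc, ← Real.exp_add]
      ring_nf
    obtain ⟨hcint, hcorr⟩ := integral_inner_integral_translate hgm hFm hδ
    have hpt : ∀ᵐ s, w s * ‖K (u s)‖ ^ 2 - w s * ‖K (u (s + δ))‖ ^ 2
        ≤ -2 * ⟪∫ y in s..s + δ, g y, F s⟫ := by
      filter_upwards [heq', heq2] with s h1 h2
      by_cases hs : τ < s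
      · have a1 := h1 hs (u s)
        have a2 := h2 (by linarith) (u s)
        have a3 : ∫ y in Ioi s, g y = (∫ y in s..s + δ, g y) + ∫ y in Ioi (s + δ), g y := by
          rw [intervalIntegral.integral_of_le (by linarith),
            ← Ioc_union_Ioi_eq_Ioi (by linarith : s ≤ s + δ),
            setIntegral_union (Ioc_disjoint_Ioi le_rfl) measurableSet_Ioi
              hgint.integrableOn hgint.integrableOn]
        rw [a3, inner_add_left] at a1
        have a4 : ⟪∫ y in s..s + δ, g y, F s⟫ = w s * ⟪∫ y in s..s + δ, g y, u s⟫ := by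
          rw [hF, inner_smul_right]
        have a5 := norm_sub_sq_real (K (u (s + δ))) (K (u s))
        rw [real_inner_self_eq_norm_sq] at a1
        rw [a4]
        have a6 : ‖K (u s)‖ ^ 2 - ‖K (u (s + δ))‖ ^ 2 ≤ -2 * ⟪∫ y in s..s + δ, g y, u s⟫ := by
          nlinarith [sq_nonneg ‖K (u (s + δ)) - K (u s)‖]
        nlinarith [mul_le_mul_of_nonneg_left a6 (hw0 s).le]
      · have a1 : u s = 0 := hu0 s fun h => hs h.1
        have a2 : F s = 0 := by simp [hF, a1]
        rw [a1, a2, map_zero, norm_zero, inner_zero_right]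
        have := mul_nonneg (hw0 s).le (sq_nonneg ‖K (u (s + δ))‖)
        simp
        linarith
    have hI := integral_mono_ae (heint.sub hshift) (hcint.const_mul (-2)) hpt
    simp only [Pi.sub_apply] at hI
    rw [integral_sub heint hshift, hshiftE, integral_const_mul, hcorr] at hI
    linarith
  have hder : HasDerivAt (fun δ => (1 - Real.exp (-(2 * l * δ))) * E + 2 * ∫ θ in (0 : ℝ)..δ, ζ θ)
      (2 * l * E + 2 * ζ 0) 0 := by
    have h1 : HasDerivAt (fun δ : ℝ => Real.exp (-(2 * l * δ))) (-(2 * l)) 0 := by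
      have := (((hasDerivAt_id (0 : ℝ)).const_mul (2 * l)).neg).exp
      simpa using this
    have h2 := hasDerivAt_primitive hζc 0 0
    refine (((h1.const_sub 1).mul_const E).add (h2.const_mul 2)).congr_deriv (by ring)
  have hle : 2 * l * E + 2 * ζ 0 ≤ 0 := by
    have h1 := hder.tendsto_slope_zero_right
    refine le_of_tendsto h1 ?_
    filter_upwards [self_mem_nhdsWithin] with δ hδ
    have h2 := hineq δ (le_of_lt hδ)
    simp only [zero_add, mul_zero, neg_zero, Real.exp_zero, sub_self, zero_mul,
      intervalIntegral.integral_same, sub_zero, smul_eq_mul]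
    exact mul_nonpos_of_nonneg_of_nonpos (inv_nonneg.2 (le_of_lt hδ)) (by linarith)
  -- coercivity closes the argument
  have hζ0 : ζ 0 = ∫ s, w s * ⟪B s (u s), u s⟫ := by
    simp only [hζ, zero_add, hF, inner_smul_right, hg]
  have i1 : Integrable fun s => w s * ⟪B s (u s), u s⟫ := by
    refine (integrable_inner_of_memLp hgm hFm).congr (Eventually.of_forall fun s => ?_)
    simp only [hF, inner_smul_right, hg]
  have i2 : Integrable fun s => w s * ‖u s‖ ^ 2 := by
    refine (integrable_inner_of_memLp hum hFm).congr (Eventually.of_forall fun s => ?_)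
    simp [hF, inner_smul_right]
  have hfin : c * ∫ s, w s * ‖u s‖ ^ 2 ≤ ζ 0 + l * E := by
    rw [hζ0, hE, ← integral_const_mul, ← integral_const_mul, ← integral_add i1 (heint.const_mul l)]
    refine integral_mono (i2.const_mul c) (i1.add (heint.const_mul l)) fun s => ?_
    have := mul_le_mul_of_nonneg_left (hcoer s (u s)) (hw0 s).le
    simp only
    linarith
  have hz : ∫ s, w s * ‖u s‖ ^ 2 = 0 := by
    have h0 : 0 ≤ ∫ s, w s * ‖u s‖ ^ 2 :=
      integral_nonneg fun s => mul_nonneg (hw0 s).le (sq_nonneg _)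
    nlinarith
  rw [integral_eq_zero_iff_of_nonneg (fun s => mul_nonneg (hw0 s).le (sq_nonneg _)) i2] at hz
  refine (ae_restrict_iff' measurableSet_Ioc).2 ?_
  filter_upwards [hz] with s hs hs'
  have h1 : w s * ‖u s‖ ^ 2 = 0 := hs
  rw [← hu1 s hs']
  have h2 := (mul_eq_zero.1 h1).resolve_left (hw0 s).ne'
  simpa using h2

end uniqueness




/-! ### The abstract evolution problem -/

/-- The data of an implicit evolution equation `(K† K u)' = B u` in a Hilbert space `W`, embedded in
`H` by `K`. The form of `B` is coercive up to a multiple of `‖K u‖²`, and it simplifies when tested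
with `N q`: by `form_eq`, what remains is the principal part `½ ⟪u, N q⟫`, independent of time,
and a part `D` of lower order. For the Black–Scholes form, `N` is multiplication by `σ²`, and `P` is
`K` followed by multiplication by `σ⁻²`. Measurability in time is needed for `P`, `D` and `B` only;
the parameters bound these operators uniformly in time. -/
structure ImplicitSystem (W H : Type*) [NormedAddCommGroup W] [InnerProductSpace ℝ W]
    [NormedAddCommGroup H] [InnerProductSpace ℝ H] (m₀ CP CD CB c l : ℝ) where
  K : W →L[ℝ] H
  P : ℝ → W →L[ℝ] H
  D : ℝ → W →L[ℝ] W
  N : ℝ → W →L[ℝ] W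
  B : ℝ → W →L[ℝ] W
  K_injective : Function.Injective K
  stronglyMeasurable_P : ∀ w, StronglyMeasurable fun t => P t w
  stronglyMeasurable_D : ∀ w, StronglyMeasurable fun t => D t w
  stronglyMeasurable_B : ∀ w, StronglyMeasurable fun t => B t w
  P_coercive : ∀ t q, m₀ * ‖K q‖ ^ 2 ≤ ⟪K q, P t q⟫
  P_bound : ∀ t q, ‖P t q‖ ≤ CP * ‖q‖
  D_bound : ∀ t q, ‖D t q‖ ≤ CD * ‖K q‖
  B_bound : ∀ t q, ‖B t q‖ ≤ CB * ‖q‖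
  B_coercive : ∀ t q, c * ‖q‖ ^ 2 ≤ ⟪B t q, q⟫ + l * ‖K q‖ ^ 2
  P_N : ∀ t q, P t (N t q) = K q
  form_eq : ∀ t f q, (1 / 2) * ⟪f, N t q⟫ + ⟪f, D t (N t q)⟫ = ⟪B t f, q⟫
  m₀_pos : 0 < m₀
  CD_nonneg : 0 ≤ CD
  c_pos : 0 < c
  l_nonneg : 0 ≤ l

namespace ImplicitSystem

variable {W H : Type*} [NormedAddCommGroup W] [InnerProductSpace ℝ W]
  [NormedAddCommGroup H] [InnerProductSpace ℝ H] {m₀ CP CD CB c l : ℝ}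

/-- The implicit equation `(K† K u)' = B u`, `u(T) = h`, integrated over `[t, T]` and tested with
all vectors. -/
def SolvesAt (S : ImplicitSystem W H m₀ CP CD CB c l) (T : ℝ) (h : W) (u : ℝ → W) (t : ℝ)
    (x : W) : Prop :=
  ∀ v, ⟪S.K x, S.K v⟫ = ⟪S.K h, S.K v⟫ - ⟪∫ s in t..T, S.B s (u s), v⟫

variable (S : ImplicitSystem W H m₀ CP CD CB c l)

theorem eq_of_forall_inner {x y : W} (hxy : ∀ v, ⟪S.K x, S.K v⟫ = ⟪S.K y, S.K v⟫) : x = y := by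
  have h1 : ⟪S.K (x - y), S.K (x - y)⟫ = 0 := by
    rw [map_sub, inner_sub_left, ← map_sub, hxy, sub_self]
  exact sub_eq_zero.1 (S.K_injective (by rw [inner_self_eq_zero.1 h1, map_zero]))

variable {S} in
theorem SolvesAt.eq {T : ℝ} {h : W} {u : ℝ → W} {t : ℝ} {x y : W}
    (hx : S.SolvesAt T h u t x) (hy : S.SolvesAt T h u t y) : x = y :=
  S.eq_of_forall_inner fun v => by rw [hx v, hy v]

theorem memLp_B [SecondCountableTopology W] {u : ℝ → W} {a b : ℝ}
    (hu : MemLp u 2 (volume.restrict (Ioc a b))) :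
    MemLp (fun t => S.B t (u t)) 2 (volume.restrict (Ioc a b)) :=
  hu.of_le_mul (aestronglyMeasurable_apply S.stronglyMeasurable_B hu.1)
    (Eventually.of_forall fun t => S.B_bound t (u t))

theorem intervalIntegrable_B [SecondCountableTopology W] {u : ℝ → W} {a b t : ℝ} (ht : t ∈ Icc a b)
    (hu : MemLp u 2 (volume.restrict (Ioc a b))) :
    IntervalIntegrable (fun t => S.B t (u t)) volume t b := by
  refine (intervalIntegrable_iff_integrableOn_Ioc_of_le ht.2).2 ?_
  have h1 : IntegrableOn (fun t => S.B t (u t)) (Ioc a b) :=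
    (S.memLp_B hu).integrable (by norm_num)
  exact h1.mono_set (Ioc_subset_Ioc_left ht.1)

theorem integral_B_congr {u u' : ℝ → W} {a b t : ℝ} (ht : t ∈ Icc a b)
    (huu : u =ᵐ[volume.restrict (Ioc a b)] u') :
    ∫ s in t..b, S.B s (u s) = ∫ s in t..b, S.B s (u' s) := by
  rw [intervalIntegral.integral_of_le ht.2, intervalIntegral.integral_of_le ht.2]
  refine integral_congr_ae ?_
  have h1 := ae_restrict_of_ae_restrict_of_subset (Ioc_subset_Ioc_left ht.1) huu
  filter_upwards [h1] with s hs
  rw [hs]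

variable [CompleteSpace W] [SecondCountableTopology W]

theorem ae_unique {τ T : ℝ} {h : W} {u u' : ℝ → W}
    (hu : MemLp u 2 (volume.restrict (Ioc τ T))) (hu' : MemLp u' 2 (volume.restrict (Ioc τ T)))
    (h1 : ∀ᵐ t ∂(volume.restrict (Ioc τ T)), S.SolvesAt T h u t (u t))
    (h2 : ∀ᵐ t ∂(volume.restrict (Ioc τ T)), S.SolvesAt T h u' t (u' t)) :
    u =ᵐ[volume.restrict (Ioc τ T)] u' := by
  have h3 := implicit_solution_unique S.K S.B S.stronglyMeasurable_B S.B_bound S.c_pos S.l_nonneg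
    S.B_coercive (hu.sub hu') (by
      filter_upwards [h1, h2, ae_restrict_mem measurableSet_Ioc] with t a1 a2 a3 v
      have ht : t ∈ Icc τ T := Ioc_subset_Icc_self a3
      simp only [Pi.sub_apply, map_sub]
      rw [intervalIntegral.integral_sub (S.intervalIntegrable_B ht hu)
        (S.intervalIntegrable_B ht hu'), inner_sub_left, inner_sub_left, a1 v, a2 v]
      ring)
  filter_upwards [h3] with t ht
  exact sub_eq_zero.1 ht

/-- The regular solution on `[τ, T]`; its value at `τ` is an element of `W`. -/
theorem exists_solution_on [CompleteSpace H] {τ T T' : ℝ} (hτ : τ ≤ T) (hT' : T - τ ≤ T') (h : W) :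
    ∃ (u : ℝ → W) (x : W), MemLp u 2 (volume.restrict (Ioc τ T)) ∧
      (∀ᵐ t ∂(volume.restrict (Ioc τ T)), S.SolvesAt T h u t (u t)) ∧ S.SolvesAt T h u τ x ∧
      ‖x‖ ≤ (1 + stabilityConst m₀ CD T') * ‖h‖ := by
  obtain ⟨f, p, f₀, hf, hp, he, hK, hK0, hb⟩ := exists_implicit_solution S.K S.P S.D
    S.stronglyMeasurable_P S.stronglyMeasurable_D S.m₀_pos S.P_coercive S.P_bound S.D_bound
    S.CD_nonneg hτ hT' h
  have hu : MemLp (fun t => h + f t) 2 (volume.restrict (Ioc τ T)) := (memLp_const h).add hf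
  -- testing the regular equation with `N v` gives the equation for `B`
  have key : ∀ t ∈ Icc τ T, ∀ x, S.K x = ∫ s in T..t, p s →
      S.SolvesAt T h (fun t => h + f t) t (h + x) := by
    intro t ht x hx v
    have hsub : Ioc t T ⊆ Ioc τ T := Ioc_subset_Ioc_left ht.1
    have hpi : IntegrableOn p (Ioc t T) :=
      (show IntegrableOn p (Ioc τ T) volume from hp.integrable (by norm_num)).mono_set hsub
    have hBi : IntegrableOn (fun s => S.B s (h + f s)) (Ioc t T) :=
      (show IntegrableOn (fun s => S.B s (h + f s)) (Ioc τ T) volume from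
        (S.memLp_B hu).integrable (by norm_num)).mono_set hsub
    rw [map_add, inner_add_left, hx, intervalIntegral.integral_of_ge ht.2, inner_neg_left,
      intervalIntegral.integral_of_le ht.2, ← sub_eq_add_neg]
    congr 1
    rw [real_inner_comm, ← integral_inner hpi, real_inner_comm, ← integral_inner hBi]
    refine integral_congr_ae ?_
    filter_upwards [ae_restrict_of_ae_restrict_of_subset hsub he] with s hs
    rw [real_inner_comm, ← S.P_N s v, hs, S.form_eq, real_inner_comm]
  refine ⟨fun t => h + f t, h + f₀, hu, ?_, key τ ⟨le_rfl, hτ⟩ f₀ hK0, ?_⟩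
  · filter_upwards [hK, ae_restrict_mem measurableSet_Ioc] with t h1 h2
    exact key t (Ioc_subset_Icc_self h2) (f t) h1
  · refine (norm_add_le _ _).trans ?_
    linarith

/-- The implicit evolution problem has a solution with values in `W` at every time. -/
theorem exists_solution [CompleteSpace H] {T : ℝ} (hT : 0 ≤ T) (h : W) :
    ∃ u : ℝ → W, MemLp u 2 (volume.restrict (Ioc 0 T)) ∧
      (∀ t ∈ Icc 0 T, S.SolvesAt T h u t (u t)) ∧ u T = h ∧
      ∀ t ∈ Icc 0 T, ‖u t‖ ≤ (1 + stabilityConst m₀ CD T) * ‖h‖ := by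
  have hex : ∀ τ : Icc (0 : ℝ) T, _ := fun τ =>
    S.exists_solution_on (τ := τ) (T := T) (T' := T) τ.2.2 (by linarith [τ.2.1]) h
  choose u x hu1 hu2 hx hxb using hex
  set u₀ := u ⟨0, le_rfl, hT⟩ with hu₀
  have hx0 : ∀ τ : Icc (0 : ℝ) T, S.SolvesAt T h u₀ τ (x τ) := by
    intro τ v
    have hsub : Ioc (τ : ℝ) T ⊆ Ioc 0 T := Ioc_subset_Ioc_left τ.2.1
    have h1 : u τ =ᵐ[volume.restrict (Ioc (τ : ℝ) T)] u₀ :=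
      S.ae_unique (hu1 τ) ((hu1 ⟨0, le_rfl, hT⟩).mono_measure (Measure.restrict_mono hsub le_rfl))
        (hu2 τ) (ae_restrict_of_ae_restrict_of_subset hsub (hu2 ⟨0, le_rfl, hT⟩))
    rw [hx τ v, S.integral_B_congr ⟨le_rfl, τ.2.2⟩ h1]
  -- by uniqueness the solutions on `[τ, T]` agree, so their values at `τ` form one solution
  let F : ℝ → W := fun t => if ht : t ∈ Icc 0 T then x ⟨t, ht⟩ else 0
  have hF : ∀ t (ht : t ∈ Icc 0 T), F t = x ⟨t, ht⟩ := fun t ht => dif_pos ht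
  have hFu : F =ᵐ[volume.restrict (Ioc 0 T)] u₀ := by
    filter_upwards [hu2 ⟨0, le_rfl, hT⟩, ae_restrict_mem measurableSet_Ioc] with t h1 h2
    rw [hF t (Ioc_subset_Icc_self h2)]
    exact (hx0 ⟨t, Ioc_subset_Icc_self h2⟩).eq h1
  have hFs : ∀ t ∈ Icc 0 T, S.SolvesAt T h F t (F t) := by
    intro t ht v
    rw [S.integral_B_congr ht hFu, hF t ht]
    exact hx0 ⟨t, ht⟩ v
  refine ⟨F, (hu1 ⟨0, le_rfl, hT⟩).ae_eq hFu.symm, hFs, ?_, fun t ht => ?_⟩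
  · refine S.eq_of_forall_inner fun v => ?_
    have := hFs T ⟨hT, le_rfl⟩ v
    simpa using this
  · rw [hF t ht]
    exact hxb _

theorem solution_unique {T : ℝ} {h : W} {u u' : ℝ → W}
    (hu : MemLp u 2 (volume.restrict (Ioc 0 T))) (hu' : MemLp u' 2 (volume.restrict (Ioc 0 T)))
    (h1 : ∀ t ∈ Icc 0 T, S.SolvesAt T h u t (u t))
    (h2 : ∀ t ∈ Icc 0 T, S.SolvesAt T h u' t (u' t)) : ∀ t ∈ Icc 0 T, u t = u' t := by
  have h3 : u =ᵐ[volume.restrict (Ioc 0 T)] u' := by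
    refine S.ae_unique (h := h) hu hu' ?_ ?_ <;>
    filter_upwards [ae_restrict_mem measurableSet_Ioc] with t ht
    · exact h1 t (Ioc_subset_Icc_self ht)
    · exact h2 t (Ioc_subset_Icc_self ht)
  intro t ht
  refine S.eq_of_forall_inner fun v => ?_
  rw [h1 t ht v, h2 t ht v, S.integral_B_congr ht h3]

end ImplicitSystem

/-! ### Stability under weak convergence -/

/-- A bounded family in a Hilbert space converges weakly along every ultrafilter. -/
theorem exists_weak_limit {ι E : Type*} [NormedAddCommGroup E] [InnerProductSpace ℝ E]
    [CompleteSpace E] (U : Ultrafilter ι) {x : ι → E} {C : ℝ} (hx : ∀ᶠ i in U, ‖x i‖ ≤ C) :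
    ∃ y : E, ∀ Λ : E →L[ℝ] ℝ, Tendsto (fun i => Λ (x i)) U (𝓝 (Λ y)) := by
  have hlim : ∀ v : E, ∃ a ∈ Icc (-(C * ‖v‖)) (C * ‖v‖), Tendsto (fun i => ⟪x i, v⟫) U (𝓝 a) := by
    intro v
    have h1 : ((U.map fun i => ⟪x i, v⟫ : Ultrafilter ℝ) : Filter ℝ)
        ≤ 𝓟 (Icc (-(C * ‖v‖)) (C * ‖v‖)) := by
      rw [le_principal_iff]
      refine Ultrafilter.mem_map.2 ?_
      filter_upwards [hx] with i hi
      have : |⟪x i, v⟫| ≤ C * ‖v‖ := (abs_real_inner_le_norm _ _).trans (by gcongr)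
      exact abs_le.1 this
    exact isCompact_Icc.ultrafilter_le_nhds _ h1
  choose L hLb hL using hlim
  let Lm : E →ₗ[ℝ] ℝ :=
    { toFun := L
      map_add' := fun v w => tendsto_nhds_unique (hL (v + w))
        (((hL v).add (hL w)).congr fun i => (inner_add_right _ _ _).symm)
      map_smul' := fun a v => tendsto_nhds_unique (hL (a • v))
        (((hL v).const_mul a).congr fun i => (real_inner_smul_right _ _ _).symm) }
  let Lc : E →L[ℝ] ℝ := Lm.mkContinuous C fun v => abs_le.2 (hLb v)
  refine ⟨(InnerProductSpace.toDual ℝ E).symm Lc, fun Λ => ?_⟩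
  have h1 := hL ((InnerProductSpace.toDual ℝ E).symm Λ)
  have h2 : ∀ z, Λ z = ⟪z, (InnerProductSpace.toDual ℝ E).symm Λ⟫ := fun z => by
    rw [real_inner_comm, InnerProductSpace.toDual_symm_apply]
  simp_rw [h2]
  rw [InnerProductSpace.toDual_symm_apply]
  exact h1

/-- Weak convergence of a bounded family paired with norm convergence. -/
theorem tendsto_inner_of_weak_of_strong {ι E : Type*} [NormedAddCommGroup E]
    [InnerProductSpace ℝ E] {U : Filter ι} {x : ι → E} {y : E} {C : ℝ}
    (hb : ∀ᶠ i in U, ‖x i‖ ≤ C) (hx : ∀ v, Tendsto (fun i => ⟪x i, v⟫) U (𝓝 ⟪y, v⟫))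
    {z : ι → E} {w : E} (hz : Tendsto z U (𝓝 w)) :
    Tendsto (fun i => ⟪x i, z i⟫) U (𝓝 ⟪y, w⟫) := by
  have h1 : Tendsto (fun i => ⟪x i, z i - w⟫) U (𝓝 0) := by
    have h2 : Tendsto (fun i => C * ‖z i - w‖) U (𝓝 0) := by
      have := (tendsto_iff_norm_sub_tendsto_zero.1 hz).const_mul C
      simpa using this
    refine squeeze_zero_norm' ?_ h2
    filter_upwards [hb] with i hi
    exact (norm_inner_le_norm _ _).trans (by gcongr)
  have h3 := h1.add (hx w)
  rw [zero_add] at h3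
  refine h3.congr fun i => ?_
  rw [inner_sub_right]
  ring

theorem tendsto_inner_of_tendsto_dual {ι E : Type*} [NormedAddCommGroup E]
    [InnerProductSpace ℝ E] {U : Filter ι} {x : ι → E} {y : E}
    (h : ∀ Λ : E →L[ℝ] ℝ, Tendsto (fun i => Λ (x i)) U (𝓝 (Λ y))) (w : E) :
    Tendsto (fun i => ⟪x i, w⟫) U (𝓝 ⟪y, w⟫) := by
  have := h (innerSL ℝ w)
  simpa only [innerSL_apply_apply, real_inner_comm] using this

/-- The operator `K† K`. -/
noncomputable def gram {W H : Type*} [NormedAddCommGroup W] [InnerProductSpace ℝ W]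
    [CompleteSpace W] [NormedAddCommGroup H] [InnerProductSpace ℝ H] [CompleteSpace H]
    (K : W →L[ℝ] H) : W →L[ℝ] W :=
  K.adjoint ∘L K

theorem inner_gram {W H : Type*} [NormedAddCommGroup W] [InnerProductSpace ℝ W]
    [CompleteSpace W] [NormedAddCommGroup H] [InnerProductSpace ℝ H] [CompleteSpace H]
    (K : W →L[ℝ] H) (x y : W) : ⟪x, gram K y⟫ = ⟪K x, K y⟫ := by
  rw [gram, ContinuousLinearMap.comp_apply, ContinuousLinearMap.adjoint_inner_right]

theorem norm_gram_apply_le {W H : Type*} [NormedAddCommGroup W] [InnerProductSpace ℝ W]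
    [CompleteSpace W] [NormedAddCommGroup H] [InnerProductSpace ℝ H] [CompleteSpace H]
    (K : W →L[ℝ] H) {C : ℝ} (hC : ‖K‖ ≤ C) (w : W) : ‖gram K w‖ ≤ C ^ 2 * ‖w‖ := by
  rw [gram, ContinuousLinearMap.comp_apply]
  calc ‖K.adjoint (K w)‖ ≤ ‖K.adjoint‖ * (‖K‖ * ‖w‖) :=
        (ContinuousLinearMap.le_opNorm _ _).trans
          (mul_le_mul_of_nonneg_left (K.le_opNorm w) (norm_nonneg _))
    _ ≤ C * (C * ‖w‖) := by
        rw [LinearIsometryEquiv.norm_map]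
        gcongr
        exact (norm_nonneg _).trans hC
    _ = C ^ 2 * ‖w‖ := by ring

/-- Strong convergence of the operators `K† K` along an ultrafilter, from convergence of the
quadratic forms along weakly convergent families. -/
theorem tendsto_adjoint_comp_self {ι W H₀ : Type*} {H : ι → Type*} [NormedAddCommGroup W]
    [InnerProductSpace ℝ W] [CompleteSpace W]
    [∀ i, NormedAddCommGroup (H i)] [∀ i, InnerProductSpace ℝ (H i)] [∀ i, CompleteSpace (H i)]
    [NormedAddCommGroup H₀] [InnerProductSpace ℝ H₀] [CompleteSpace H₀]
    (U : Ultrafilter ι) (K : ∀ i, W →L[ℝ] H i) (K₀ : W →L[ℝ] H₀)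
    {CK : ℝ} (hK : ∀ i w, ‖K i w‖ ≤ CK * ‖w‖) {G : Set W} (hG : Dense G)
    (hconv : ∀ g ∈ G, ∀ (x : ι → W) (y : W) (C : ℝ), (∀ i, ‖x i‖ ≤ C) →
      (∀ v, Tendsto (fun i => ⟪x i, v⟫) U (𝓝 ⟪y, v⟫)) →
      Tendsto (fun i => ⟪K i (x i), K i g⟫) U (𝓝 ⟪K₀ y, K₀ g⟫)) (g : W) :
    Tendsto (fun i => gram (K i) g) U (𝓝 (gram K₀ g)) := by
  set R : ∀ i, W →L[ℝ] W := fun i => gram (K i)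
  set R₀ : W →L[ℝ] W := gram K₀
  have hR : ∀ i x y, ⟪x, R i y⟫ = ⟪K i x, K i y⟫ := fun i => inner_gram (K i)
  have hR₀ : ∀ x y, ⟪x, R₀ y⟫ = ⟪K₀ x, K₀ y⟫ := inner_gram K₀
  have hRb : ∀ i w, ‖R i w‖ ≤ |CK| ^ 2 * ‖w‖ := fun i => norm_gram_apply_le (K i)
    (ContinuousLinearMap.opNorm_le_bound _ (abs_nonneg _) fun w =>
      (hK i w).trans (by gcongr; exact le_abs_self _))
  -- for `g ∈ G` apply the hypothesis to the bounded family `R i g - R₀ g` itself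
  have hRG : ∀ g ∈ G, Tendsto (fun i => R i g) U (𝓝 (R₀ g)) := by
    intro g hg
    have hkb : ∀ i, ‖R i g - R₀ g‖ ≤ |CK| ^ 2 * ‖g‖ + ‖R₀ g‖ := fun i =>
      (norm_sub_le _ _).trans (by gcongr; exact hRb i g)
    obtain ⟨k, hk⟩ := exists_weak_limit U (Eventually.of_forall hkb)
    have hk' := tendsto_inner_of_tendsto_dual hk
    have h1 := (hconv g hg _ k _ hkb hk').sub (hk' (R₀ g))
    rw [hR₀ k g |>.symm, sub_self] at h1
    rw [tendsto_iff_norm_sub_tendsto_zero]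
    have h2 : Tendsto (fun i => ‖R i g - R₀ g‖ ^ 2) U (𝓝 0) := by
      refine h1.congr fun i => ?_
      rw [← hR, ← inner_sub_right, real_inner_self_eq_norm_sq]
    have h3 := h2.sqrt
    simpa [Real.sqrt_sq] using h3
  rw [Metric.tendsto_nhds]
  intro ε hε
  set M := |CK| ^ 2 + ‖R₀‖ + 1 with hM
  have hM0 : 0 < M := by positivity
  obtain ⟨g', hg'G, hg'⟩ := hG.exists_dist_lt g (show 0 < ε / (2 * M) by positivity)
  filter_upwards [Metric.tendsto_nhds.1 (hRG g' hg'G) (ε / 2) (by positivity)] with i hi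
  rw [dist_eq_norm] at hi hg' ⊢
  have e1 : R i g - R₀ g = R i (g - g') + (R i g' - R₀ g') - R₀ (g - g') := by
    rw [map_sub, map_sub]; abel
  have b1 := hRb i (g - g')
  have b2 := R₀.le_opNorm (g - g')
  have b3 : M * ‖g - g'‖ < ε / 2 := by
    rw [lt_div_iff₀ (by positivity)] at hg'
    linarith
  calc ‖R i g - R₀ g‖ ≤ ‖R i (g - g')‖ + ‖R i g' - R₀ g'‖ + ‖R₀ (g - g')‖ := by
        rw [e1]
        exact (norm_sub_le _ _).trans (by gcongr; exact norm_add_le _ _)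
    _ ≤ |CK| ^ 2 * ‖g - g'‖ + ‖R i g' - R₀ g'‖ + ‖R₀‖ * ‖g - g'‖ := by gcongr
    _ < ε := by nlinarith [norm_nonneg (g - g')]

namespace ImplicitSystem

variable {W H : Type*} [NormedAddCommGroup W] [InnerProductSpace ℝ W]
  [NormedAddCommGroup H] [InnerProductSpace ℝ H] {m₀ CP CD CB c l : ℝ}
  (S : ImplicitSystem W H m₀ CP CD CB c l)

theorem abs_inner_integral_B_le {T : ℝ} {t : ℝ} (ht : t ∈ Icc 0 T) (g : W)
    (z : Lp W 2 (volume.restrict (Ioc 0 T))) :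
    |⟪∫ s in t..T, S.B s (z s), g⟫| ≤ (|CB| * √T * ‖g‖) * ‖z‖ := by
  have hT : 0 ≤ T := ht.1.trans ht.2
  have h1 : ‖∫ s in t..T, S.B s (z s)‖ ≤ ∫ s in Ioc 0 T, |CB| * ‖z s‖ := by
    rw [intervalIntegral.integral_of_le ht.2]
    have hzi : IntegrableOn (fun s => |CB| * ‖z s‖) (Ioc 0 T) volume :=
      ((Lp.memLp z).norm.integrable (by norm_num)).const_mul _
    refine (norm_integral_le_integral_norm _).trans ?_
    refine le_trans ?_ (setIntegral_mono_set hzi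
      (Eventually.of_forall fun s => by positivity)
      (Ioc_subset_Ioc_left ht.1).eventuallyLE)
    refine integral_mono_of_nonneg (Eventually.of_forall fun s => norm_nonneg _)
      (hzi.mono_set (Ioc_subset_Ioc_left ht.1)) (Eventually.of_forall fun s => ?_)
    exact (S.B_bound s _).trans (mul_le_mul_of_nonneg_right (le_abs_self _) (norm_nonneg _))
  rw [integral_const_mul] at h1
  have h2 := integral_norm_le_sqrt_mul_norm (T' := T) hT (by linarith) z
  calc |⟪∫ s in t..T, S.B s (z s), g⟫| ≤ ‖∫ s in t..T, S.B s (z s)‖ * ‖g‖ :=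
        abs_real_inner_le_norm _ _
    _ ≤ (|CB| * (√T * ‖z‖)) * ‖g‖ := by gcongr; exact h1.trans (by gcongr)
    _ = _ := by ring

/-- For fixed `t` and `g`, the functional `z ↦ ⟪∫_t^T B z, g⟫` is continuous on `L²(0, T; W)`, so that it
passes to weak limits. -/
theorem exists_functional_at [SecondCountableTopology W] {T t : ℝ} (ht : t ∈ Icc 0 T) (g : W) :
    ∃ Λ : Lp W 2 (volume.restrict (Ioc 0 T)) →L[ℝ] ℝ,
      ∀ z, Λ z = ⟪∫ s in t..T, S.B s (z s), g⟫ := by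
  have hBii : ∀ z : Lp W 2 (volume.restrict (Ioc 0 T)),
      IntervalIntegrable (fun t => S.B t (z t)) volume t T := fun z =>
    S.intervalIntegrable_B ht (Lp.memLp z)
  have hadd : ∀ z z' : Lp W 2 (volume.restrict (Ioc 0 T)),
      ⟪∫ s in t..T, S.B s ((z + z' : Lp W 2 (volume.restrict (Ioc 0 T))) s), g⟫
        = ⟪∫ s in t..T, S.B s (z s), g⟫ + ⟪∫ s in t..T, S.B s (z' s), g⟫ := by
    intro z z'
    rw [S.integral_B_congr ht (Lp.coeFn_add z z'), ← inner_add_left,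
      ← intervalIntegral.integral_add (hBii z) (hBii z')]
    simp only [Pi.add_apply, map_add]
  have hsmul : ∀ (a : ℝ) (z : Lp W 2 (volume.restrict (Ioc 0 T))),
      ⟪∫ s in t..T, S.B s ((a • z : Lp W 2 (volume.restrict (Ioc 0 T))) s), g⟫
        = a * ⟪∫ s in t..T, S.B s (z s), g⟫ := by
    intro a z
    rw [S.integral_B_congr ht (Lp.coeFn_smul a z), ← real_inner_smul_left,
      ← intervalIntegral.integral_smul]
    simp only [Pi.smul_apply, map_smul]
  exact ⟨LinearMap.mkContinuous
      { toFun := fun z => ⟪∫ s in t..T, S.B s (z s), g⟫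
        map_add' := hadd
        map_smul' := hsmul } (|CB| * √T * ‖g‖) (S.abs_inner_integral_B_le ht g), fun z => rfl⟩

theorem integrable_inner_integral_B [SecondCountableTopology W] {T : ℝ} (hT : 0 ≤ T) (g : W)
    (z : Lp W 2 (volume.restrict (Ioc 0 T))) :
    Integrable (fun t => ⟪∫ s in t..T, S.B s (z s), g⟫) (volume.restrict (Ioc 0 T)) := by
  have h1 : IntegrableOn (fun s => S.B s (z s)) (uIcc 0 T) volume := by
    rw [uIcc_of_le hT, integrableOn_Icc_iff_integrableOn_Ioc]
    exact (S.memLp_B (Lp.memLp z)).integrable (by norm_num)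
  have h2 : ContinuousOn (fun t => ⟪∫ s in t..T, S.B s (z s), g⟫) (Icc 0 T) := by
    have := intervalIntegral.continuousOn_primitive_interval_left h1
    rw [uIcc_of_le hT] at this
    exact this.inner continuousOn_const
  exact (h2.integrableOn_compact isCompact_Icc).mono_set Ioc_subset_Icc_self

variable [SecondCountableTopology W]

/-- The functional `z ↦ ⟪∫_t^T B z, g⟫`, integrated over `t` in a set, is continuous as well. -/
theorem exists_functional_setIntegral {T : ℝ} (hT : 0 ≤ T) (A : Set ℝ) (g : W) :
    ∃ Λ : Lp W 2 (volume.restrict (Ioc 0 T)) →L[ℝ] ℝ,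
      ∀ z, Λ z = ∫ t in A, ⟪∫ s in t..T, S.B s (z s), g⟫ ∂(volume.restrict (Ioc 0 T)) := by
  set ν := volume.restrict (Ioc 0 T) with hν
  have hmem : ∀ᵐ t ∂(ν.restrict A), t ∈ Icc 0 T := ae_restrict_of_ae (by
    filter_upwards [ae_restrict_mem measurableSet_Ioc] with t ht
    exact Ioc_subset_Icc_self ht)
  have hint : ∀ z : Lp W 2 ν, Integrable (fun t => ⟪∫ s in t..T, S.B s (z s), g⟫) (ν.restrict A) :=
    fun z => (S.integrable_inner_integral_B hT g z).restrict
  let L : Lp W 2 ν →ₗ[ℝ] ℝ :=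
    { toFun := fun z => ∫ t in A, ⟪∫ s in t..T, S.B s (z s), g⟫ ∂ν
      map_add' := fun z z' => by
        rw [← integral_add (hint z) (hint z')]
        refine integral_congr_ae ?_
        filter_upwards [hmem] with t ht
        obtain ⟨Λ, hΛ⟩ := S.exists_functional_at ht g
        rw [← hΛ, ← hΛ, ← hΛ, map_add]
      map_smul' := fun a z => by
        rw [RingHom.id_apply, smul_eq_mul, ← integral_const_mul]
        refine integral_congr_ae ?_
        filter_upwards [hmem] with t ht
        obtain ⟨Λ, hΛ⟩ := S.exists_functional_at ht g
        rw [← hΛ, ← hΛ, map_smul, smul_eq_mul] }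
  refine ⟨L.mkContinuous ((|CB| * √T * ‖g‖) * (ν.restrict A).real univ) fun z => ?_, fun z => rfl⟩
  have h1 := norm_integral_le_of_norm_le_const (μ := ν.restrict A)
    (f := fun t => ⟪∫ s in t..T, S.B s (z s), g⟫) (C := (|CB| * √T * ‖g‖) * ‖z‖) (by
      filter_upwards [hmem] with t ht
      exact S.abs_inner_integral_B_le ht g z)
  exact h1.trans (le_of_eq (by ring))

variable [CompleteSpace W]

/-- A weak limit in space-time of solutions is an almost everywhere solution of the limit
problem. -/
theorem ae_solvesAt_of_weak_limit {ι : Type*} [CompleteSpace H] (U : Filter ι) [U.NeBot] {T : ℝ}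
    (hT : 0 ≤ T)
    {h : W} {R : ι → W →L[ℝ] W} (hR : ∀ g, Tendsto (fun i => R i g) U
      (𝓝 (gram S.K g)))
    {y : ι → Lp W 2 (volume.restrict (Ioc 0 T))} {C : ℝ} (hyb : ∀ i, ‖y i‖ ≤ C)
    {f : Lp W 2 (volume.restrict (Ioc 0 T))}
    (hf : ∀ Λ : Lp W 2 (volume.restrict (Ioc 0 T)) →L[ℝ] ℝ,
      Tendsto (fun i => Λ (y i)) U (𝓝 (Λ f)))
    (heq : ∀ i, ∀ᵐ t ∂(volume.restrict (Ioc 0 T)), ∀ g, ⟪y i t, R i g⟫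
      = ⟪h, R i g⟫ - ⟪∫ s in t..T, S.B s (y i s), g⟫) :
    ∀ᵐ t ∂(volume.restrict (Ioc 0 T)), S.SolvesAt T h f t (f t) := by
  set R₀ : W →L[ℝ] W := gram S.K with hR₀d
  have hR₀ : ∀ x y, ⟪x, R₀ y⟫ = ⟪S.K x, S.K y⟫ := inner_gram S.K
  have hg : ∀ g : W, ∀ᵐ t ∂(volume.restrict (Ioc 0 T)),
      ⟪f t, R₀ g⟫ - (⟪h, R₀ g⟫ - ⟪∫ s in t..T, S.B s (f s), g⟫) = 0 := by
    intro g
    have i1 : ∀ (z : Lp W 2 (volume.restrict (Ioc 0 T))) (w : W),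
        Integrable (fun t => ⟪z t, w⟫) (volume.restrict (Ioc 0 T)) := fun z w =>
      integrable_inner_of_memLp (Lp.memLp z) (memLp_const w)
    have i2 : ∀ (z : Lp W 2 (volume.restrict (Ioc 0 T))) (w : W),
        Integrable (fun t => ⟪h, w⟫ - ⟪∫ s in t..T, S.B s (z s), g⟫)
          (volume.restrict (Ioc 0 T)) := fun z w =>
      (integrable_const _).sub (S.integrable_inner_integral_B hT g z)
    refine Integrable.ae_eq_zero_of_forall_setIntegral_eq_zero ((i1 f _).sub (i2 f _)) ?_
    intro A hA _
    obtain ⟨Λ, hΛ⟩ := S.exists_functional_setIntegral hT A g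
    have hfin : (volume.restrict (Ioc 0 T)) A ≠ ⊤ := measure_ne_top _ _
    have hind : Tendsto (fun i => indicatorConstLp 2 hA hfin (R i g)) U
        (𝓝 (indicatorConstLp 2 hA hfin (R₀ g))) := by
      rw [tendsto_iff_norm_sub_tendsto_zero]
      have h0 : Tendsto (fun i => ‖R i g - R₀ g‖
          * (volume.restrict (Ioc 0 T)).real A ^ (1 / (2 : ℝ≥0∞).toReal)) U (𝓝 0) := by
        have := (tendsto_iff_norm_sub_tendsto_zero.1 (hR g)).mul_const
          ((volume.restrict (Ioc 0 T)).real A ^ (1 / (2 : ℝ≥0∞).toReal))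
        simpa using this
      refine squeeze_zero (fun _ => norm_nonneg _) (fun i => ?_) h0
      rw [indicatorConstLp_sub]
      exact norm_indicatorConstLp_le
    have l1 := tendsto_inner_of_weak_of_strong (Eventually.of_forall hyb)
      (tendsto_inner_of_tendsto_dual hf) hind
    have l2 : Tendsto (fun i => (volume.restrict (Ioc 0 T)).real A * ⟪h, R i g⟫ - Λ (y i)) U
        (𝓝 ((volume.restrict (Ioc 0 T)).real A * ⟪h, R₀ g⟫ - Λ f)) :=
      ((tendsto_const_nhds.inner (hR g)).const_mul _).sub (hf Λ)
    have e1 : ∀ (z : Lp W 2 (volume.restrict (Ioc 0 T))) (w : W),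
        ⟪z, indicatorConstLp 2 hA hfin w⟫ = ∫ t in A, ⟪z t, w⟫ ∂(volume.restrict (Ioc 0 T)) := by
      intro z w
      rw [real_inner_comm, L2.inner_indicatorConstLp_eq_setIntegral_inner]
      simp_rw [real_inner_comm]
    have e2 : ∀ (z : Lp W 2 (volume.restrict (Ioc 0 T))) (w : W),
        (volume.restrict (Ioc 0 T)).real A * ⟪h, w⟫ - Λ z
        = ∫ t in A, (⟪h, w⟫ - ⟪∫ s in t..T, S.B s (z s), g⟫) ∂(volume.restrict (Ioc 0 T)) := by
      intro z w
      rw [integral_sub (integrable_const _) (S.integrable_inner_integral_B hT g z).restrict,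
        setIntegral_const, hΛ, smul_eq_mul]
    have l3 := tendsto_nhds_unique l1 (l2.congr fun i => by
      rw [e1, e2]
      refine integral_congr_ae (ae_restrict_of_ae ?_)
      filter_upwards [heq i] with t ht
      exact (ht g).symm)
    rw [e1, e2] at l3
    rw [integral_sub (i1 f _).restrict (i2 f _).restrict, l3, sub_self]
  obtain ⟨D, hDc, hD⟩ := TopologicalSpace.exists_countable_dense W
  filter_upwards [(ae_ball_iff hDc).2 fun g _ => hg g] with t ht g
  have hcl : IsClosed {g : W | ⟪f t, R₀ g⟫ - (⟪h, R₀ g⟫ - ⟪∫ s in t..T, S.B s (f s), g⟫) = 0} :=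
    isClosed_eq (by fun_prop) continuous_const
  rw [← hR₀, ← hR₀]
  exact sub_eq_zero.1 (hcl.closure_subset_iff.2 ht (hD g))

/-- Convergence of the operators `K† K` implies weak convergence of the initial values of the
solutions. -/
theorem tendsto_inner_initial_value {ι : Type*} {H' : ι → Type*} [CompleteSpace H]
    [∀ i, NormedAddCommGroup (H' i)] [∀ i, InnerProductSpace ℝ (H' i)] [∀ i, CompleteSpace (H' i)]
    (U : Ultrafilter ι) (S' : ∀ i, ImplicitSystem W (H' i) m₀ CP CD CB c l)
    (hB : ∀ i, (S' i).B = S.B)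
    (hR : ∀ g, Tendsto (fun i => gram (S' i).K g) U
      (𝓝 (gram S.K g)))
    {T : ℝ} (hT : 0 ≤ T) {h : W} {u : ι → ℝ → W} {C : ℝ}
    (hu : ∀ i, MemLp (u i) 2 (volume.restrict (Ioc 0 T)))
    (hus : ∀ i, ∀ t ∈ Icc 0 T, (S' i).SolvesAt T h (u i) t (u i t))
    (hub : ∀ i, ∀ t ∈ Icc 0 T, ‖u i t‖ ≤ C)
    {u₀ : ℝ → W} (hu₀ : MemLp u₀ 2 (volume.restrict (Ioc 0 T)))
    (hus₀ : ∀ t ∈ Icc 0 T, S.SolvesAt T h u₀ t (u₀ t)) (v : W) :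
    Tendsto (fun i => ⟪u i 0, v⟫) U (𝓝 ⟪u₀ 0, v⟫) := by
  set ν := volume.restrict (Ioc 0 T) with hν
  have hRi : ∀ i x y, ⟪x, gram (S' i).K y⟫ = ⟪(S' i).K x, (S' i).K y⟫ :=
    fun i => inner_gram (S' i).K
  have hR₀ : ∀ x y, ⟪x, gram S.K y⟫ = ⟪S.K x, S.K y⟫ := inner_gram S.K
  let y : ι → Lp W 2 ν := fun i => (hu i).toLp
  have hy : ∀ i, y i =ᵐ[ν] u i := fun i => (hu i).coeFn_toLp
  have hyb : ∀ i, ‖y i‖ ≤ ν.real univ ^ ((2 : ℝ≥0∞).toReal⁻¹) * |C| := fun i =>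
    Lp.norm_le_of_ae_bound (abs_nonneg C) (by
      filter_upwards [hy i, ae_restrict_mem measurableSet_Ioc] with t h1 h2
      rw [h1]
      exact (hub i t (Ioc_subset_Icc_self h2)).trans (le_abs_self C))
  obtain ⟨f, hf⟩ := exists_weak_limit U (Eventually.of_forall hyb)
  have hub0 : ∀ i, ‖u i 0‖ ≤ C := fun i => hub i 0 ⟨le_rfl, hT⟩
  obtain ⟨f₀, hf₀⟩ := exists_weak_limit U (Eventually.of_forall hub0)
  have heq : ∀ i, ∀ t ∈ Icc 0 T, ∀ g, ⟪u i t, gram (S' i).K g⟫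
      = ⟪h, gram (S' i).K g⟫ - ⟪∫ s in t..T, S.B s (y i s), g⟫ := by
    intro i t ht g
    rw [hRi, hRi, hus i t ht g, S.integral_B_congr ht (hy i), hB i]
  have hae := S.ae_solvesAt_of_weak_limit (U : Filter ι) hT (h := h) hR hyb hf (fun i => by
    filter_upwards [hy i, ae_restrict_mem measurableSet_Ioc] with t h1 h2 g
    rw [h1]
    exact heq i t (Ioc_subset_Icc_self h2) g)
  -- the weak limit of the initial values solves the limit equation at `t = 0`
  have h0 : S.SolvesAt T h f 0 f₀ := by
    intro g
    rw [← hR₀, ← hR₀]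
    have l1 := tendsto_inner_of_weak_of_strong (Eventually.of_forall hub0)
      (tendsto_inner_of_tendsto_dual hf₀) (hR g)
    obtain ⟨Λ, hΛ⟩ := S.exists_functional_at (t := 0) (T := T) ⟨le_rfl, hT⟩ g
    have l2 := (tendsto_const_nhds (x := h)).inner (hR g) |>.sub (hf Λ)
    rw [← hΛ]
    refine tendsto_nhds_unique l1 (l2.congr fun i => ?_)
    rw [heq i 0 ⟨le_rfl, hT⟩, hΛ]
  have hfu : f =ᵐ[ν] u₀ := S.ae_unique (Lp.memLp f) hu₀ hae (by
    filter_upwards [ae_restrict_mem measurableSet_Ioc] with t ht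
    exact hus₀ t (Ioc_subset_Icc_self ht))
  have hfin : f₀ = u₀ 0 := by
    refine S.eq_of_forall_inner fun g => ?_
    rw [h0 g, hus₀ 0 ⟨le_rfl, hT⟩ g, S.integral_B_congr ⟨le_rfl, hT⟩ hfu]
  rw [← hfin]
  exact tendsto_inner_of_tendsto_dual hf₀ v

end ImplicitSystem





/-! ### Primitives with respect to `dx / x` -/

/-- The function `u` on `]0, M]` with `x ∂ₓu = f` and `u(M) = 0`. -/
noncomputable def logPrimitive (M : ℝ) (f : ℝ → ℝ) (x : ℝ) : ℝ := ∫ y in M..x, f y / y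

theorem leb_restrict_Ioo (M : ℝ) : leb M = volume.restrict (Ioo 0 M) :=
  (restrict_Ioo_eq_restrict_Ico).symm

theorem leb_restrict_Ioc (M : ℝ) : leb M = volume.restrict (Ioc 0 M) := by
  rw [leb_restrict_Ioo, restrict_Ioo_eq_restrict_Ioc]

instance (M : ℝ) : IsFiniteMeasure (leb M) := by
  rw [leb]; infer_instance

section

variable {M : ℝ}

theorem ae_leb_iff {p : ℝ → Prop} : (∀ᵐ x ∂(leb M), p x) ↔ ∀ᵐ x, x ∈ Ioo 0 M → p x := by
  rw [leb_restrict_Ioo, ae_restrict_iff' measurableSet_Ioo]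

theorem ae_leb_mem : ∀ᵐ x ∂(leb M), x ∈ Ioo 0 M :=
  ae_leb_iff.2 (Eventually.of_forall fun _ h => h)

theorem uIoc_subset_Ioc_zero {a b : ℝ} (ha : a ∈ Ioc 0 M) (hb : b ∈ Ioc 0 M) :
    uIoc a b ⊆ Ioc 0 M := by
  intro x hx
  rw [mem_uIoc] at hx
  rcases hx with hx | hx
  · exact ⟨ha.1.trans hx.1, hx.2.trans hb.2⟩
  · exact ⟨hb.1.trans hx.1, hx.2.trans ha.2⟩

theorem intervalIntegrable_of_integrable_leb {f : ℝ → ℝ} (hf : Integrable f (leb M)) {a b : ℝ}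
    (ha : a ∈ Ioc 0 M) (hb : b ∈ Ioc 0 M) : IntervalIntegrable f volume a b := by
  rw [leb_restrict_Ioc] at hf
  exact intervalIntegrable_iff.2
    (IntegrableOn.mono_set (show IntegrableOn f (Ioc 0 M) volume from hf)
      (uIoc_subset_Ioc_zero ha hb))

theorem pos_of_mem_uIcc {a b x : ℝ} (ha : 0 < a) (hb : 0 < b) (hx : x ∈ uIcc a b) : 0 < x :=
  lt_of_lt_of_le (lt_inf_iff.2 ⟨ha, hb⟩) hx.1

theorem intervalIntegrable_div_id {f : ℝ → ℝ} (hf : Integrable f (leb M)) {a b : ℝ}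
    (ha : a ∈ Ioc 0 M) (hb : b ∈ Ioc 0 M) :
    IntervalIntegrable (fun y => f y / y) volume a b := by
  simp only [div_eq_mul_inv]
  refine (intervalIntegrable_of_integrable_leb hf ha hb).mul_continuousOn
    (continuousOn_inv₀.mono fun x hx => ?_)
  exact (pos_of_mem_uIcc ha.1 hb.1 hx).ne'

theorem logPrimitive_sub {f : ℝ → ℝ} (hf : Integrable f (leb M)) {a b : ℝ}
    (ha : a ∈ Ioc 0 M) (hb : b ∈ Ioc 0 M) :
    logPrimitive M f b - logPrimitive M f a = ∫ y in a..b, f y / y := by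
  have hM : M ∈ Ioc 0 M := ⟨ha.1.trans_le ha.2, le_rfl⟩
  exact intervalIntegral.integral_interval_sub_left (intervalIntegrable_div_id hf hM hb)
    (intervalIntegrable_div_id hf hM ha)

theorem logPrimitive_self (f : ℝ → ℝ) : logPrimitive M f M = 0 :=
  intervalIntegral.integral_same

theorem logPrimitive_congr {f g : ℝ → ℝ} (hfg : f =ᵐ[leb M] g) {x : ℝ} (hx : x ∈ Ioc 0 M) :
    logPrimitive M f x = logPrimitive M g x := by
  refine intervalIntegral.integral_congr_ae ?_
  have h1 := ae_leb_iff.1 hfg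
  have h2 : ∀ᵐ y : ℝ, y ≠ M := by simp [ae_iff]
  filter_upwards [h1, h2] with y h1 h2 hy
  rw [uIoc_of_ge hx.2] at hy
  rw [h1 ⟨hx.1.trans hy.1, lt_of_le_of_ne hy.2 h2⟩]

theorem integral_abs_le_sqrt_mul_norm (f : Lp ℝ 2 (leb M)) {a b : ℝ} (ha : 0 < a) (hab : a ≤ b)
    (hb : b ≤ M) : ∫ y in Ioc a b, |f y| ≤ √(b - a) * ‖f‖ := by
  have hle : volume.restrict (Ioc a b) ≤ leb M := by
    rw [leb_restrict_Ioc]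
    exact Measure.restrict_mono_set volume fun x hx => ⟨ha.trans hx.1, hx.2.trans hb⟩
  have hf : MemLp f 2 (volume.restrict (Ioc a b)) := (Lp.memLp f).mono_measure hle
  have h1 : ‖f‖ ^ 2 = ∫ t, |f t| ^ 2 ∂(leb M) := by
    rw [← real_inner_self_eq_norm_sq, L2.inner_def]
    simp
  have h2 := integral_mul_le_Lp_mul_Lq_of_nonneg (μ := volume.restrict (Ioc a b))
    (Real.HolderConjugate.two_two) (f := fun _ => (1 : ℝ)) (g := fun t => |f t|)
    (Eventually.of_forall fun _ => zero_le_one) (Eventually.of_forall fun _ => abs_nonneg _)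
    (memLp_const 1) (by simpa using hf.norm)
  simp only [one_mul, Real.rpow_two] at h2
  have h3 : ∫ _ in Ioc a b, (1 : ℝ) ^ 2 = b - a := by simp [hab]
  rw [h3, ← Real.sqrt_eq_rpow, ← Real.sqrt_eq_rpow] at h2
  refine h2.trans (mul_le_mul_of_nonneg_left ?_ (Real.sqrt_nonneg _))
  rw [← Real.sqrt_sq (norm_nonneg f), h1]
  refine Real.sqrt_le_sqrt
    (integral_mono_measure hle (Eventually.of_forall fun _ => by positivity) ?_)
  simpa using (Lp.memLp f).integrable_sq

/-- Primitives of square integrable functions are Hölder continuous away from `0`. -/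
theorem abs_logPrimitive_sub_le (f : Lp ℝ 2 (leb M)) {a b : ℝ} (ha : 0 < a) (hab : a ≤ b)
    (hb : b ≤ M) :
    |logPrimitive M f b - logPrimitive M f a| ≤ a⁻¹ * √(b - a) * ‖f‖ := by
  have hf : Integrable f (leb M) := (Lp.memLp f).integrable (by norm_num)
  have ha' : a ∈ Ioc 0 M := ⟨ha, hab.trans hb⟩
  have hb' : b ∈ Ioc 0 M := ⟨ha.trans_le hab, hb⟩
  rw [logPrimitive_sub hf ha' hb', mul_assoc]
  refine le_trans ?_ (mul_le_mul_of_nonneg_left (integral_abs_le_sqrt_mul_norm f ha hab hb)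
    (inv_nonneg.2 ha.le))
  rw [intervalIntegral.integral_of_le hab, ← integral_const_mul]
  refine (abs_integral_le_integral_abs).trans (setIntegral_mono_on ?_ ?_ measurableSet_Ioc ?_)
  · exact ((intervalIntegrable_iff_integrableOn_Ioc_of_le hab).1
      (intervalIntegrable_div_id hf ha' hb')).abs
  · exact ((intervalIntegrable_iff_integrableOn_Ioc_of_le hab).1
      (intervalIntegrable_of_integrable_leb hf ha' hb')).abs.const_mul _
  · intro y hy
    rw [abs_div, abs_of_pos (ha.trans hy.1), div_eq_inv_mul]
    exact mul_le_mul_of_nonneg_right (inv_anti₀ ha hy.1.le) (abs_nonneg _)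

theorem abs_logPrimitive_le (f : Lp ℝ 2 (leb M)) {x : ℝ} (hx : x ∈ Ioc 0 M) :
    |logPrimitive M f x| ≤ x⁻¹ * √(M - x) * ‖f‖ := by
  have h := abs_logPrimitive_sub_le f hx.1 hx.2 le_rfl
  rwa [logPrimitive_self, zero_sub, abs_neg] at h

theorem continuousOn_logPrimitive {f : ℝ → ℝ} (hf : Integrable f (leb M)) :
    ContinuousOn (logPrimitive M f) (Ioc 0 M) := by
  intro x hx
  have h1 : ContinuousOn (logPrimitive M f) (Icc (x / 2) M) := by
    have hi := intervalIntegrable_div_id hf (a := x / 2) (b := M)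
      ⟨by linarith [hx.1], by linarith [hx.1, hx.2]⟩ ⟨hx.1.trans_le hx.2, le_rfl⟩
    have := intervalIntegral.continuousOn_primitive_interval' (b₁ := x / 2) (b₂ := M) (a := M) hi
      right_mem_uIcc
    rwa [uIcc_of_le (by linarith [hx.1, hx.2])] at this
  refine (h1 x ⟨by linarith [hx.1], hx.2⟩).mono_of_mem_nhdsWithin ?_
  filter_upwards [self_mem_nhdsWithin, mem_nhdsWithin_of_mem_nhds
    (Ioi_mem_nhds (show x / 2 < x by linarith [hx.1]))] with y hy hy'
  exact ⟨hy'.le, hy.2⟩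

theorem tendsto_logPrimitive {f : ℝ → ℝ} (hM : 0 < M) (hf : Integrable f (leb M)) :
    Tendsto (logPrimitive M f) (𝓝[<] M) (𝓝 0) := by
  have h := continuousOn_logPrimitive hf M ⟨hM, le_rfl⟩
  rw [ContinuousWithinAt, logPrimitive_self] at h
  refine h.mono_left (le_trans (b := 𝓝[Ioo 0 M] M) ?_ (nhdsWithin_mono _ Ioo_subset_Ioc_self))
  rw [nhdsWithin_Ioo_eq_nhdsLT hM]

theorem absolutelyContinuousOnInterval_logPrimitive {f : ℝ → ℝ} (hf : Integrable f (leb M))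
    {a b : ℝ} (ha : 0 < a) (hab : a ≤ b) (hb : b ≤ M) :
    AbsolutelyContinuousOnInterval (logPrimitive M f) a b := by
  have h := (intervalIntegrable_div_id hf (a := a) (b := M) ⟨ha, hab.trans hb⟩
    ⟨ha.trans_le (hab.trans hb), le_rfl⟩).absolutelyContinuousOnInterval_intervalIntegral
      (c := M) right_mem_uIcc
  refine AbsolutelyContinuousOnInterval.mono h ?_
  rw [uIcc_of_le hab, uIcc_of_le (hab.trans hb)]
  exact Icc_subset_Icc_right hb

theorem ae_hasDerivAt_logPrimitive {f : ℝ → ℝ} (hf : Integrable f (leb M)) :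
    ∀ᵐ x, x ∈ Ioo 0 M → HasDerivAt (logPrimitive M f) (f x / x) x := by
  -- `f y / y` is integrable on compact subintervals of `]0, M]`, which exhaust the interval
  have h1 : ∀ n : ℕ, ∀ᵐ x, x ∈ Ioo 0 M → (M / (n + 2) < x) →
      HasDerivAt (logPrimitive M f) (f x / x) x := by
    intro n
    by_cases hM : 0 < M
    · have hn : M / (n + 2) ≤ M := div_le_self hM.le (by linarith [(Nat.cast_nonneg n : (0:ℝ) ≤ n)])
      have hi := intervalIntegrable_div_id hf (a := M / (n + 2)) (b := M)
        ⟨by positivity, hn⟩ ⟨hM, le_rfl⟩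
      filter_upwards [hi.ae_hasDerivAt_integral] with x hx h0 h1
      refine hx ?_ M right_mem_uIcc
      rw [uIcc_of_le hn]
      exact ⟨h1.le, h0.2.le⟩
    · exact Eventually.of_forall fun x hx => absurd (hx.1.trans hx.2) hM
  filter_upwards [ae_all_iff.2 h1] with x hx h0
  obtain ⟨n, hn⟩ := exists_nat_gt (M / x)
  refine hx n h0 ?_
  rw [div_lt_iff₀ (by positivity)]
  rw [div_lt_iff₀ h0.1] at hn
  nlinarith [h0.1]

/-- The product rule for a primitive and a differentiable factor with locally bounded
derivative. -/
theorem integral_product_rule {f s s' : ℝ → ℝ} (hf : Integrable f (leb M)) {a b C : ℝ}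
    (ha : 0 < a) (hab : a ≤ b) (hb : b < M) (hs : ∀ x ∈ Icc a b, HasDerivAt s (s' x) x)
    (hC : ∀ x ∈ Icc a b, |s' x| ≤ C) :
    ∫ x in a..b, (s' x * logPrimitive M f x + s x * (f x / x))
      = s b * logPrimitive M f b - s a * logPrimitive M f a := by
  have hC0 : 0 ≤ C := (abs_nonneg _).trans (hC a ⟨le_rfl, hab⟩)
  have hL : AbsolutelyContinuousOnInterval s a b := by
    refine LipschitzOnWith.absolutelyContinuousOnInterval (K := ⟨C, hC0⟩) ?_
    rw [uIcc_of_le hab]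
    refine (convex_Icc a b).lipschitzOnWith_of_nnnorm_hasDerivWithin_le
      (fun x hx => (hs x hx).hasDerivWithinAt) fun x hx => ?_
    exact hC x hx
  rw [← hL.integral_deriv_mul_eq_sub
    (absolutelyContinuousOnInterval_logPrimitive hf ha hab hb.le)]
  refine intervalIntegral.integral_congr_ae ?_
  filter_upwards [ae_hasDerivAt_logPrimitive hf] with x hx h0
  rw [uIoc_of_le hab] at h0
  rw [(hs x (Ioc_subset_Icc_self h0)).deriv, (hx ⟨ha.trans h0.1, h0.2.trans_lt hb⟩).deriv]

end





/-! ### Test functions and weak derivatives -/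

/-- Smooth functions with compact support in the open interval `]0, M[`. -/
structure IsInnerTest (M : ℝ) (φ : ℝ → ℝ) : Prop where
  contDiff : ContDiff ℝ ∞ φ
  hasCompactSupport : HasCompactSupport φ
  tsupport_subset : tsupport φ ⊆ Ioo 0 M

section

variable {M : ℝ}

theorem IsInnerTest.isTest {φ : ℝ → ℝ} (h : IsInnerTest M φ) : IsTest M φ :=
  ⟨h.contDiff, h.hasCompactSupport, h.tsupport_subset.trans Ioo_subset_Iio_self⟩

theorem exists_Icc_of_isCompact_subset_Ioo (hM : 0 < M) {s : Set ℝ} (hs : IsCompact s)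
    (hsub : s ⊆ Ioo 0 M) : ∃ a b, 0 < a ∧ a ≤ b ∧ b < M ∧ s ⊆ Icc a b := by
  rcases s.eq_empty_or_nonempty with rfl | hne
  · exact ⟨M / 2, M / 2, by linarith, le_rfl, by linarith, empty_subset _⟩
  · obtain ⟨a, ha⟩ := hs.exists_isLeast hne
    obtain ⟨b, hb⟩ := hs.exists_isGreatest hne
    exact ⟨a, b, (hsub ha.1).1, ha.2 hb.1, (hsub hb.1).2, fun x hx => ⟨ha.2 hx, hb.2 hx⟩⟩

theorem IsInnerTest.exists_Icc (hM : 0 < M) {φ : ℝ → ℝ} (h : IsInnerTest M φ) :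
    ∃ a b, 0 < a ∧ a ≤ b ∧ b < M ∧ tsupport φ ⊆ Icc a b :=
  exists_Icc_of_isCompact_subset_Ioo hM h.hasCompactSupport h.tsupport_subset

theorem IsInnerTest.isInnerTest_deriv {φ : ℝ → ℝ} (h : IsInnerTest M φ) : IsInnerTest M (deriv φ) :=
  ⟨(contDiff_infty_iff_deriv.1 h.contDiff).2, h.hasCompactSupport.deriv,
    (tsupport_deriv_subset).trans h.tsupport_subset⟩

theorem IsInnerTest.sub_const_mul {φ ψ : ℝ → ℝ} (hφ : IsInnerTest M φ) (hψ : IsInnerTest M ψ)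
    (c : ℝ) : IsInnerTest M fun x => φ x - c * ψ x := by
  have hs : tsupport (fun x => φ x - c * ψ x) ⊆ tsupport φ ∪ tsupport ψ := by
    refine (tsupport_sub φ fun x => c * ψ x).trans (union_subset_union_right _ ?_)
    exact tsupport_mul_subset_right
  exact ⟨hφ.contDiff.sub (contDiff_const.mul hψ.contDiff),
    hφ.hasCompactSupport.sub (hψ.hasCompactSupport.mul_left),
    hs.trans (union_subset hφ.tsupport_subset hψ.tsupport_subset)⟩

theorem setIntegral_mul_of_tsupport_subset {D φ : ℝ → ℝ} {s : Set ℝ} (h : tsupport φ ⊆ s) :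
    ∫ x in s, D x * φ x = ∫ x, D x * φ x :=
  setIntegral_eq_integral_of_forall_compl_eq_zero fun x hx => by
    rw [image_eq_zero_of_notMem_tsupport fun hx' => hx (h hx'), mul_zero]

theorem integrable_mul_of_tsupport_subset {D φ : ℝ → ℝ} {s : Set ℝ}
    (hD : LocallyIntegrableOn D s) (hc : Continuous φ) (hφ : HasCompactSupport φ)
    (h : tsupport φ ⊆ s) : Integrable fun x => D x * φ x := by
  have h1 : IntegrableOn (fun x => D x * φ x) (tsupport φ) :=
    (hD.integrableOn_compact_subset h hφ).mul_continuousOn hc.continuousOn hφ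
  refine (integrableOn_iff_integrable_of_support_subset ?_).1 h1
  exact (Function.support_mul_subset_right _ _).trans (subset_tsupport _)

theorem exists_isInnerTest_integral_eq_one (hM : 0 < M) :
    ∃ η : ℝ → ℝ, IsInnerTest M η ∧ ∫ x, η x = 1 := by
  let b : ContDiffBump (M / 2) := ⟨M / 8, M / 4, by linarith, by linarith⟩
  refine ⟨b.normed volume, ⟨b.contDiff_normed, b.hasCompactSupport_normed, ?_⟩,
    b.integral_normed⟩
  rw [b.tsupport_normed_eq, Real.closedBall_eq_Icc]
  intro x hx
  constructor
  · have : M / 2 - M / 4 ≤ x := hx.1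
    linarith
  · have : x ≤ M / 2 + M / 4 := hx.2
    linarith

/-- A test function with vanishing integral is the derivative of a test function. -/
theorem IsInnerTest.exists_deriv_eq (hM : 0 < M) {θ : ℝ → ℝ} (hθ : IsInnerTest M θ)
    (h0 : ∫ x, θ x = 0) : ∃ φ, IsInnerTest M φ ∧ deriv φ = θ := by
  obtain ⟨a, b, ha, hab, hb, hs⟩ := hθ.exists_Icc hM
  have hc : Continuous θ := hθ.contDiff.continuous
  -- the enlarged interval has no endpoint in the support
  set a' := a / 2 with ha'
  set b' := (b + M) / 2 with hb'
  have hz : ∀ x, x ∉ Ioo a' b' → θ x = 0 := fun x hx =>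
    image_eq_zero_of_notMem_tsupport fun h =>
      hx ⟨by linarith [(hs h).1], by linarith [(hs h).2]⟩
  have hd : ∀ x, HasDerivAt (fun x => ∫ y in a'..x, θ y) (θ x) x := fun x =>
    (hc.integral_hasStrictDerivAt a' x).hasDerivAt
  have hd' : deriv (fun x => ∫ y in a'..x, θ y) = θ := funext fun x => (hd x).deriv
  have hsupp : Function.support (fun x => ∫ y in a'..x, θ y) ⊆ Icc a' b' := by
    intro x hx
    by_contra hx'
    refine hx ?_
    rcases lt_or_ge x a' with h | h
    · refine intervalIntegral.integral_zero_ae (Eventually.of_forall fun y hy => hz y ?_)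
      rw [uIoc_of_ge h.le] at hy
      exact fun h' => absurd h'.1 (not_lt.2 hy.2)
    · have hbx : b' < x := by
        by_contra h'
        exact hx' ⟨h, not_lt.1 h'⟩
      simp only
      rw [intervalIntegral.integral_of_le h,
        setIntegral_eq_integral_of_forall_compl_eq_zero (fun y hy => hz y fun h' =>
          hy (mem_Ioc.2 ⟨h'.1, (h'.2.trans hbx).le⟩)), h0]
  have hts : tsupport (fun x => ∫ y in a'..x, θ y) ⊆ Icc a' b' := closure_minimal hsupp isClosed_Icc
  refine ⟨fun x => ∫ y in a'..x, θ y, ⟨?_, ?_, ?_⟩, hd'⟩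
  · refine contDiff_infty_iff_deriv.2 ⟨fun x => (hd x).differentiableAt, ?_⟩
    rw [hd']
    exact hθ.contDiff
  · exact isCompact_Icc.of_isClosed_subset (isClosed_tsupport _) hts
  · exact hts.trans fun x hx => ⟨by linarith [hx.1], by linarith [hx.2]⟩

/-- **Du Bois-Reymond's lemma** on an interval. -/
theorem exists_ae_eq_const_of_integral_mul_deriv_eq_zero (hM : 0 < M) {D : ℝ → ℝ}
    (hD : LocallyIntegrableOn D (Ioo 0 M))
    (h : ∀ φ, IsInnerTest M φ → ∫ x in Ioo 0 M, D x * deriv φ x = 0) :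
    ∃ c, ∀ᵐ x, x ∈ Ioo 0 M → D x = c := by
  obtain ⟨η, hη, hη1⟩ := exists_isInnerTest_integral_eq_one hM
  have hint : ∀ φ, IsInnerTest M φ → Integrable fun x => D x * φ x := fun φ hφ =>
    integrable_mul_of_tsupport_subset hD hφ.contDiff.continuous hφ.hasCompactSupport
      hφ.tsupport_subset
  have hint' : ∀ φ, IsInnerTest M φ → Integrable φ := fun φ hφ =>
    hφ.contDiff.continuous.integrable_of_hasCompactSupport hφ.hasCompactSupport
  refine ⟨∫ x, D x * η x, ?_⟩
  -- `g - (∫ g) η` has vanishing integral, so it is a derivative and `D` annihilates it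
  have h1 := isOpen_Ioo.ae_eq_zero_of_integral_contDiff_smul_eq_zero (μ := volume) (U := Ioo 0 M)
    (f := fun x => D x - ∫ x, D x * η x)
    (hD.sub ((locallyIntegrable_const _).locallyIntegrableOn _)) (fun g hg1 hg2 hg3 => by
      have hg : IsInnerTest M g := ⟨hg1, hg2, hg3⟩
      have hθ := hg.sub_const_mul hη (∫ x, g x)
      obtain ⟨φ, hφ, hφ'⟩ := hθ.exists_deriv_eq hM (by
        rw [integral_sub (hint' g hg) ((hint' η hη).const_mul _), integral_const_mul, hη1, mul_one,
          sub_self])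
      have h2 := h φ hφ
      rw [setIntegral_mul_of_tsupport_subset hφ.isInnerTest_deriv.tsupport_subset, hφ'] at h2
      have h3 : ∀ x, D x * (g x - (∫ x, g x) * η x) = D x * g x - (∫ x, g x) * (D x * η x) :=
        fun x => by ring
      simp_rw [h3] at h2
      rw [integral_sub (hint g hg) ((hint η hη).const_mul _), integral_const_mul] at h2
      have h4 : ∀ x, g x • (D x - ∫ x, D x * η x) = D x * g x - (∫ x, D x * η x) * g x :=
        fun x => by rw [smul_eq_mul]; ring
      simp_rw [h4]
      rw [integral_sub (hint g hg) ((hint' g hg).const_mul _), integral_const_mul]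
      linarith)
  filter_upwards [h1] with x hx h0
  exact sub_eq_zero.1 (hx h0)

theorem locallyIntegrableOn_of_integrable_leb {f : ℝ → ℝ} (hf : Integrable f (leb M)) :
    LocallyIntegrableOn f (Ioo 0 M) := by
  rw [leb_restrict_Ioo] at hf
  exact IntegrableOn.locallyIntegrableOn hf

theorem locallyIntegrableOn_div_id {f : ℝ → ℝ} (hf : Integrable f (leb M)) :
    LocallyIntegrableOn (fun x => f x / x) (Ioo 0 M) := by
  simp only [div_eq_mul_inv]
  refine (locallyIntegrableOn_of_integrable_leb hf).mul_continuousOn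
    (continuousOn_inv₀.mono fun x hx => ?_) isOpen_Ioo.isLocallyClosed
  exact hx.1.ne'

theorem IsInnerTest.exists_abs_deriv_le {φ : ℝ → ℝ} (hφ : IsInnerTest M φ) :
    ∃ C, ∀ x, |deriv φ x| ≤ C :=
  hφ.isInnerTest_deriv.hasCompactSupport.exists_bound_of_continuous
    hφ.isInnerTest_deriv.contDiff.continuous

/-- The weak derivative of `logPrimitive M f` is `f / x`. -/
theorem integral_logPrimitive_mul_deriv (hM : 0 < M) {f φ : ℝ → ℝ} (hf : Integrable f (leb M))
    (hφ : IsInnerTest M φ) :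
    ∫ x in Ioo 0 M, logPrimitive M f x * deriv φ x = - ∫ x in Ioo 0 M, f x / x * φ x := by
  obtain ⟨a, b, ha, hab, hb, hs⟩ := hφ.exists_Icc hM
  obtain ⟨C, hC⟩ := hφ.exists_abs_deriv_le
  -- enlarging the interval makes the boundary terms vanish
  set a' := a / 2 with ha'
  set b' := (b + M) / 2 with hb'
  have hsub : tsupport φ ⊆ Ioc a' b' := hs.trans fun x hx =>
    ⟨by linarith [hx.1], by linarith [hx.2]⟩
  have hp := integral_product_rule hf (s := φ) (s' := deriv φ) (a := a') (b := b') (C := C)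
    (by linarith) (by linarith) (by linarith)
    (fun x _ => (hφ.contDiff.differentiable (by simp) x).hasDerivAt) (fun x _ => hC x)
  have hza : φ a' = 0 := image_eq_zero_of_notMem_tsupport fun h => by linarith [(hs h).1]
  have hzb : φ b' = 0 := image_eq_zero_of_notMem_tsupport fun h => by linarith [(hs h).2]
  have hl : LocallyIntegrableOn (logPrimitive M f) (Ioo 0 M) :=
    ((continuousOn_logPrimitive hf).mono Ioo_subset_Ioc_self).locallyIntegrableOn measurableSet_Ioo
  have i1 := integrable_mul_of_tsupport_subset hl hφ.isInnerTest_deriv.contDiff.continuous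
    hφ.isInnerTest_deriv.hasCompactSupport hφ.isInnerTest_deriv.tsupport_subset
  have i2 := integrable_mul_of_tsupport_subset (locallyIntegrableOn_div_id hf)
    hφ.contDiff.continuous hφ.hasCompactSupport hφ.tsupport_subset
  rw [hza, hzb, zero_mul, zero_mul, sub_zero, intervalIntegral.integral_of_le (by linarith)] at hp
  have e1 : ∀ x, deriv φ x * logPrimitive M f x + φ x * (f x / x)
      = logPrimitive M f x * deriv φ x + f x / x * φ x := fun x => by ring
  simp_rw [e1] at hp
  rw [integral_add i1.integrableOn i2.integrableOn,
    setIntegral_mul_of_tsupport_subset ((tsupport_deriv_subset).trans hsub),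
    setIntegral_mul_of_tsupport_subset hsub] at hp
  rw [setIntegral_mul_of_tsupport_subset hφ.isInnerTest_deriv.tsupport_subset,
    setIntegral_mul_of_tsupport_subset hφ.tsupport_subset]
  linarith

/-- Elements of `V_𝓜` are the primitives of `x ∂ₓv` with respect to `dx / x` that vanish
at `M`. -/
theorem HasVDeriv.eq_logPrimitive (hM : 0 < M) {v g : ℝ → ℝ} (h : HasVDeriv M v g) {x : ℝ}
    (hx : x ∈ Ioo 0 M) : v x = logPrimitive M (fun y => y * g y) x := by
  set f : ℝ → ℝ := fun y => y * g y with hfdef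
  have hf : Integrable f (leb M) := h.memLp_deriv.integrable (by norm_num)
  have hgf : ∀ x ∈ Ioo 0 M, f x / x = g x := fun x hx => by
    rw [hfdef]; field_simp [hx.1.ne']
  have hcl : ContinuousOn (logPrimitive M f) (Ioo 0 M) :=
    (continuousOn_logPrimitive hf).mono Ioo_subset_Ioc_self
  have hl := hcl.locallyIntegrableOn (μ := volume) measurableSet_Ioo
  have hv := h.continuousOn.locallyIntegrableOn (μ := volume) measurableSet_Ioo
  obtain ⟨c, hc⟩ := exists_ae_eq_const_of_integral_mul_deriv_eq_zero hM (hv.sub hl) (by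
    intro φ hφ
    have h1 := h.weak_deriv φ hφ.contDiff hφ.hasCompactSupport hφ.tsupport_subset
    have h2 := integral_logPrimitive_mul_deriv hM hf hφ
    have i1 := integrable_mul_of_tsupport_subset hv hφ.isInnerTest_deriv.contDiff.continuous
      hφ.isInnerTest_deriv.hasCompactSupport hφ.isInnerTest_deriv.tsupport_subset
    have i2 := integrable_mul_of_tsupport_subset hl hφ.isInnerTest_deriv.contDiff.continuous
      hφ.isInnerTest_deriv.hasCompactSupport hφ.isInnerTest_deriv.tsupport_subset
    simp only [Pi.sub_apply, sub_mul]
    rw [integral_sub i1.integrableOn i2.integrableOn, h1, h2, sub_eq_zero]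
    congr 1
    refine setIntegral_congr_fun measurableSet_Ioo fun x hx => ?_
    simp only [hgf x hx])
  have heq : EqOn (fun x => v x - logPrimitive M f x) (fun _ => c) (Ioo 0 M) := by
    refine Measure.eqOn_open_of_ae_eq (μ := volume) ?_ isOpen_Ioo (h.continuousOn.sub hcl)
      continuousOn_const
    exact (ae_restrict_iff' measurableSet_Ioo).2 hc
  have hc0 : c = 0 := by
    have h1 : Tendsto (fun x => v x - logPrimitive M f x) (𝓝[<] M) (𝓝 (0 - 0)) :=
      h.trace_zero.sub (tendsto_logPrimitive hM hf)
    have h2 : Tendsto (fun x => v x - logPrimitive M f x) (𝓝[<] M) (𝓝 c) := by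
      refine tendsto_const_nhds.congr' ?_
      filter_upwards [Ioo_mem_nhdsLT hM] with x hx
      exact (heq hx).symm
    rw [tendsto_nhds_unique h2 h1, sub_zero]
  have := heq hx
  simp only [hc0] at this
  exact sub_eq_zero.1 this

/-- Converse of `HasVDeriv.eq_logPrimitive`: primitives with respect to `dx / x` belong to `V_𝓜`,
provided that they are square integrable. -/
theorem hasVDeriv_logPrimitive (hM : 0 < M) {u f g : ℝ → ℝ} (hf : MemLp f 2 (leb M))
    (hJ : MemLp (logPrimitive M f) 2 (leb M)) (hu : ∀ x ∈ Ioo 0 M, u x = logPrimitive M f x)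
    (hg : (fun x => x * g x) =ᵐ[leb M] f) : HasVDeriv M u g := by
  have hfi : Integrable f (leb M) := hf.integrable (by norm_num)
  have hu' : logPrimitive M f =ᵐ[leb M] u := by
    filter_upwards [ae_leb_mem] with x hx
    exact (hu x hx).symm
  refine ⟨hJ.ae_eq hu', hf.ae_eq hg.symm, ?_, ?_, ?_⟩
  · intro φ h1 h2 h3
    have h := integral_logPrimitive_mul_deriv hM hfi ⟨h1, h2, h3⟩
    rw [setIntegral_congr_fun measurableSet_Ioo fun x hx => by rw [hu x hx], h]
    congr 1
    rw [← leb_restrict_Ioo]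
    refine integral_congr_ae ?_
    filter_upwards [ae_leb_mem, hg] with x hx hgx
    rw [← hgx, mul_div_cancel_left₀ _ hx.1.ne']
  · exact ((continuousOn_logPrimitive hfi).mono Ioo_subset_Ioc_self).congr hu
  · refine (tendsto_logPrimitive hM hfi).congr' ?_
    filter_upwards [Ioo_mem_nhdsLT hM] with x hx
    exact (hu x hx).symm

end





/-! ### The space `V_𝓜` as a Hilbert space, and its embeddings -/

section

variable {M : ℝ}

theorem IsTest.memLp_mul_deriv {v : ℝ → ℝ} (hv : IsTest M v) :
    MemLp (fun x => x * deriv v x) 2 (leb M) := by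
  have hc : Continuous fun x => x * deriv v x :=
    continuous_id.mul (contDiff_infty_iff_deriv.1 hv.1).2.continuous
  obtain ⟨C, hC⟩ := (hv.2.1.deriv.mul_left (f := fun x => x)).exists_bound_of_continuous hc
  exact MemLp.of_bound hc.aestronglyMeasurable C (Eventually.of_forall hC)

/-- The element `x ∂ₓv` of `L²` that represents a test function `v`. -/
noncomputable def testVector {v : ℝ → ℝ} (hv : IsTest M v) : Lp ℝ 2 (leb M) :=
  hv.memLp_mul_deriv.toLp

theorem coeFn_testVector {v : ℝ → ℝ} (hv : IsTest M v) :
    testVector hv =ᵐ[leb M] fun x => x * deriv v x := hv.memLp_mul_deriv.coeFn_toLp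

theorem logPrimitive_testVector {v : ℝ → ℝ} (hv : IsTest M v) {x : ℝ} (hx : x ∈ Ioo 0 M) :
    logPrimitive M (testVector hv) x = v x := by
  rw [logPrimitive_congr (coeFn_testVector hv) (Ioo_subset_Ioc_self hx), logPrimitive]
  have hvM : v M = 0 := image_eq_zero_of_notMem_tsupport fun h => lt_irrefl M (hv.2.2 h)
  have h1 : ∫ y in M..x, y * deriv v y / y = ∫ y in M..x, deriv v y := by
    refine intervalIntegral.integral_congr fun y hy => ?_
    have hy0 : 0 < y := pos_of_mem_uIcc (hx.1.trans hx.2) hx.1 hy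
    rw [mul_div_cancel_left₀ _ hy0.ne']
  rw [h1, intervalIntegral.integral_deriv_eq_sub
    (fun y _ => hv.1.differentiable (by simp) y)
    ((contDiff_infty_iff_deriv.1 hv.1).2.continuous.intervalIntegrable _ _), hvM, sub_zero]

theorem integrable_coeFn_leb (f : Lp ℝ 2 (leb M)) : Integrable f (leb M) :=
  (Lp.memLp f).integrable (by norm_num)

theorem logPrimitive_add (f g : Lp ℝ 2 (leb M)) {x : ℝ} (hx : x ∈ Ioc 0 M) :
    logPrimitive M (f + g : Lp ℝ 2 (leb M)) x = logPrimitive M f x + logPrimitive M g x := by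
  have hM : M ∈ Ioc 0 M := ⟨hx.1.trans_le hx.2, le_rfl⟩
  rw [logPrimitive_congr (Lp.coeFn_add f g) hx, logPrimitive, logPrimitive, logPrimitive,
    ← intervalIntegral.integral_add (intervalIntegrable_div_id (integrable_coeFn_leb f) hM hx)
      (intervalIntegrable_div_id (integrable_coeFn_leb g) hM hx)]
  simp only [Pi.add_apply, add_div]

theorem logPrimitive_smul (c : ℝ) (f : Lp ℝ 2 (leb M)) {x : ℝ} (hx : x ∈ Ioc 0 M) :
    logPrimitive M (c • f : Lp ℝ 2 (leb M)) x = c * logPrimitive M f x := by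
  rw [logPrimitive_congr (Lp.coeFn_smul c f) hx, logPrimitive, logPrimitive,
    ← intervalIntegral.integral_const_mul]
  simp only [Pi.smul_apply, smul_eq_mul, mul_div_assoc]

/-- Evaluation at a point of `]0, M]` is a bounded functional. -/
noncomputable def evalCLM {x : ℝ} (hx : x ∈ Ioc 0 M) : Lp ℝ 2 (leb M) →L[ℝ] ℝ :=
  LinearMap.mkContinuous
    { toFun := fun f => logPrimitive M f x
      map_add' := fun f g => logPrimitive_add f g hx
      map_smul' := fun c f => logPrimitive_smul c f hx }
    (x⁻¹ * √(M - x)) fun f => abs_logPrimitive_le f hx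

theorem evalCLM_apply {x : ℝ} (hx : x ∈ Ioc 0 M) (f : Lp ℝ 2 (leb M)) :
    evalCLM hx f = logPrimitive M f x := rfl

theorem IsInnerTest.zero : IsInnerTest M (fun _ => 0) :=
  ⟨contDiff_const, HasCompactSupport.zero, by
    rw [tsupport, Function.support_fun_zero, closure_empty]; exact empty_subset _⟩

theorem testVector_sub_const_mul {φ ψ : ℝ → ℝ} (hφ : IsInnerTest M φ) (hψ : IsInnerTest M ψ)
    (c : ℝ) : testVector (hφ.sub_const_mul hψ c).isTest
      = testVector hφ.isTest - c • testVector hψ.isTest := by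
  refine Lp.ext ?_
  filter_upwards [coeFn_testVector (hφ.sub_const_mul hψ c).isTest, coeFn_testVector hφ.isTest,
    coeFn_testVector hψ.isTest, Lp.coeFn_sub (testVector hφ.isTest) (c • testVector hψ.isTest),
    Lp.coeFn_smul c (testVector hψ.isTest)] with x h1 h2 h3 h4 h5
  rw [h1, h4, Pi.sub_apply, h5, Pi.smul_apply, h2, h3, smul_eq_mul,
    deriv_fun_sub (hφ.contDiff.differentiable (by simp) x)
      ((hψ.contDiff.differentiable (by simp) x).const_mul c),
    deriv_const_mul _ (hψ.contDiff.differentiable (by simp) x)]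
  ring

theorem testVector_zero : testVector (IsInnerTest.zero (M := M)).isTest = 0 := by
  refine Lp.ext ?_
  filter_upwards [coeFn_testVector (IsInnerTest.zero (M := M)).isTest,
    Lp.coeFn_zero ℝ 2 (leb M)] with x h1 h2
  rw [h1, h2]
  simp

/-- Test functions supported away from `0` are dense in `V_𝓜`. -/
theorem dense_testVector (hM : 0 < M) :
    Dense {w : Lp ℝ 2 (leb M) | ∃ φ, ∃ hφ : IsInnerTest M φ, testVector hφ.isTest = w} := by
  let Q : Submodule ℝ (Lp ℝ 2 (leb M)) :=
    { carrier := {w | ∃ φ, ∃ hφ : IsInnerTest M φ, testVector hφ.isTest = w}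
      zero_mem' := ⟨_, IsInnerTest.zero, testVector_zero⟩
      add_mem' := by
        rintro _ _ ⟨φ, hφ, rfl⟩ ⟨ψ, hψ, rfl⟩
        refine ⟨_, hφ.sub_const_mul hψ (-1), ?_⟩
        rw [testVector_sub_const_mul hφ hψ, neg_one_smul, sub_neg_eq_add]
      smul_mem' := by
        rintro c _ ⟨φ, hφ, rfl⟩
        refine ⟨_, IsInnerTest.zero.sub_const_mul hφ (-c), ?_⟩
        rw [testVector_sub_const_mul IsInnerTest.zero hφ, testVector_zero, zero_sub, neg_smul,
          neg_neg] }
  have hQ : Q.topologicalClosure = ⊤ := by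
    rw [Submodule.topologicalClosure_eq_top_iff, Submodule.eq_bot_iff]
    intro f hf
    have hfi := integrable_coeFn_leb f
    have hfl := locallyIntegrableOn_of_integrable_leb hfi
    have hl : LocallyIntegrableOn (fun x => f x * x) (Ioo 0 M) :=
      hfl.mul_continuousOn continuousOn_id isOpen_Ioo.isLocallyClosed
    -- `x f` annihilates all `φ'`, so it is constant; as `1 / x` is not integrable, it is zero
    obtain ⟨c, hc⟩ := exists_ae_eq_const_of_integral_mul_deriv_eq_zero hM hl (by
      intro φ hφ
      have h1 := (Submodule.mem_orthogonal _ _).1 hf _ ⟨φ, hφ, rfl⟩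
      rw [L2.inner_def] at h1
      rw [← leb_restrict_Ioo, ← h1]
      refine integral_congr_ae ?_
      filter_upwards [coeFn_testVector hφ.isTest] with x hx
      rw [hx]
      simp only [RCLike.inner_apply, conj_trivial]
      ring)
    have hf2 : ∀ᵐ x, x ∈ Ioo 0 M → f x = c * x⁻¹ := by
      filter_upwards [hc] with x hx h0
      rw [← hx h0, mul_inv_cancel_right₀ h0.1.ne']
    have hc0 : c = 0 := by
      by_contra hc0
      have h1 : Integrable (fun x => c * x⁻¹) (leb M) := hfi.congr (ae_leb_iff.2 hf2)
      have h2 : Integrable (fun x : ℝ => x⁻¹) (leb M) := by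
        refine (h1.const_mul c⁻¹).congr (Eventually.of_forall fun x => ?_)
        simp only
        rw [inv_mul_cancel_left₀ hc0]
      rw [leb_restrict_Ioc] at h2
      have h3 := intervalIntegrable_inv_iff.1
        ((intervalIntegrable_iff_integrableOn_Ioc_of_le hM.le).2 h2)
      rcases h3 with h3 | h3
      · exact hM.ne h3
      · exact h3 left_mem_uIcc
    refine Lp.ext ?_
    filter_upwards [ae_leb_iff.2 hf2, Lp.coeFn_zero ℝ 2 (leb M)] with x h1 h2
    rw [h1, h2, hc0, zero_mul]
    rfl
  have h := Submodule.dense_iff_topologicalClosure_eq_top.2 hQ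
  exact h

/-- An inequality `‖φ‖_{L²_ν} ≤ C ‖x φ'‖` for test functions extends to all of `V_𝓜`. -/
theorem exists_embedding (hM : 0 < M) {ν : Measure ℝ} (hν : ν (Ioo 0 M)ᶜ = 0) {C : ℝ} (hC0 : 0 ≤ C)
    (hC : ∀ φ, IsInnerTest M φ →
      eLpNorm φ 2 ν ≤ ENNReal.ofReal C * eLpNorm (fun x => x * deriv φ x) 2 (leb M)) :
    ∃ K : Lp ℝ 2 (leb M) →L[ℝ] Lp ℝ 2 ν, (∀ f, K f =ᵐ[ν] logPrimitive M f) ∧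
      ∀ f, ‖K f‖ ≤ C * ‖f‖ := by
  have hmem : ∀ᵐ x ∂ν, x ∈ Ioo 0 M := by
    rw [ae_iff]
    exact hν
  have hres : ν.restrict (Ioo 0 M) = ν := Measure.restrict_eq_self_of_ae_mem hmem
  have hmeas : ∀ f : Lp ℝ 2 (leb M), AEStronglyMeasurable (logPrimitive M f) ν := by
    intro f
    rw [← hres]
    exact ((continuousOn_logPrimitive (integrable_coeFn_leb f)).mono
      Ioo_subset_Ioc_self).aestronglyMeasurable measurableSet_Ioo
  have hle : ∀ f : Lp ℝ 2 (leb M),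
      eLpNorm (logPrimitive M f) 2 ν ≤ ENNReal.ofReal (C * ‖f‖) := by
    intro f
    obtain ⟨w, hw, hlim⟩ := mem_closure_iff_seq_limit.1 (dense_testVector hM f)
    choose φ hφ hφw using hw
    refine (Lp.eLpNorm_lim_le_liminf_eLpNorm
      (fun n => (hφ n).contDiff.continuous.aestronglyMeasurable) (logPrimitive M f)
      (hmem.mono fun x hx => ?_)).trans ?_
    · have h1 := ((evalCLM (Ioo_subset_Ioc_self hx)).continuous.tendsto f).comp hlim
      refine h1.congr fun n => ?_
      rw [Function.comp_apply, evalCLM_apply, ← hφw n, logPrimitive_testVector _ hx]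
    · have h2 : Tendsto (fun n => ENNReal.ofReal (C * ‖w n‖)) atTop
          (𝓝 (ENNReal.ofReal (C * ‖f‖))) :=
        ENNReal.tendsto_ofReal (hlim.norm.const_mul C)
      rw [← h2.liminf_eq]
      refine liminf_le_liminf (Eventually.of_forall fun n => ?_)
      refine (hC _ (hφ n)).trans_eq ?_
      rw [ENNReal.ofReal_mul hC0, ← hφw n, testVector, Lp.norm_toLp,
        ENNReal.ofReal_toReal (hφ n).isTest.memLp_mul_deriv.2.ne]
  have hLp : ∀ f : Lp ℝ 2 (leb M), MemLp (logPrimitive M f) 2 ν := fun f =>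
    ⟨hmeas f, (hle f).trans_lt ENNReal.ofReal_lt_top⟩
  have hn : ∀ f : Lp ℝ 2 (leb M), ‖(hLp f).toLp‖ ≤ C * ‖f‖ := fun f => by
    rw [Lp.norm_toLp]
    exact ENNReal.toReal_le_of_le_ofReal (by positivity) (hle f)
  refine ⟨LinearMap.mkContinuous
    { toFun := fun f => (hLp f).toLp
      map_add' := fun f g => ?_
      map_smul' := fun c f => ?_ } C hn, fun f => (hLp f).coeFn_toLp, hn⟩
  · refine Lp.ext ?_
    filter_upwards [(hLp (f + g)).coeFn_toLp, (hLp f).coeFn_toLp, (hLp g).coeFn_toLp,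
      Lp.coeFn_add (hLp f).toLp (hLp g).toLp, hmem] with x h1 h2 h3 h4 hx
    rw [h1, h4, Pi.add_apply, h2, h3, logPrimitive_add f g (Ioo_subset_Ioc_self hx)]
  · refine Lp.ext ?_
    filter_upwards [(hLp (c • f)).coeFn_toLp, (hLp f).coeFn_toLp,
      Lp.coeFn_smul c (hLp f).toLp, hmem] with x h1 h2 h3 hx
    rw [RingHom.id_apply, h1, h3, Pi.smul_apply, h2, logPrimitive_smul c f (Ioo_subset_Ioc_self hx),
      smul_eq_mul]

/-- An inequality `‖φ‖_{L²_ν'} ≤ C ‖φ‖_{L²_ν}` for test functions extends to all of `V_𝓜`. -/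
theorem norm_embedding_le (hM : 0 < M) {ν ν' : Measure ℝ} {C : ℝ} (hC0 : 0 ≤ C)
    (hν : ∀ᵐ x ∂ν, x ∈ Ioo 0 M) (hν' : ∀ᵐ x ∂ν', x ∈ Ioo 0 M)
    {K : Lp ℝ 2 (leb M) →L[ℝ] Lp ℝ 2 ν} {J : Lp ℝ 2 (leb M) →L[ℝ] Lp ℝ 2 ν'}
    (hK : ∀ f, K f =ᵐ[ν] logPrimitive M f) (hJ : ∀ f, J f =ᵐ[ν'] logPrimitive M f)
    (hC : ∀ φ, IsInnerTest M φ → eLpNorm φ 2 ν' ≤ ENNReal.ofReal C * eLpNorm φ 2 ν)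
    (f : Lp ℝ 2 (leb M)) : ‖J f‖ ≤ C * ‖K f‖ := by
  have hcl : IsClosed {f | ‖J f‖ ≤ C * ‖K f‖} := isClosed_le (by fun_prop) (by fun_prop)
  refine hcl.closure_subset_iff.2 ?_ (dense_testVector hM f)
  rintro _ ⟨φ, hφ, rfl⟩
  have e1 : K (testVector hφ.isTest) =ᵐ[ν] φ := by
    filter_upwards [hK (testVector hφ.isTest), hν] with x h1 h2
    rw [h1, logPrimitive_testVector _ h2]
  have e2 : J (testVector hφ.isTest) =ᵐ[ν'] φ := by
    filter_upwards [hJ (testVector hφ.isTest), hν'] with x h1 h2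
    rw [h1, logPrimitive_testVector _ h2]
  have h := hC φ hφ
  rw [← eLpNorm_congr_ae e1, ← eLpNorm_congr_ae e2] at h
  show ‖J _‖ ≤ C * ‖K _‖
  rw [Lp.norm_def, Lp.norm_def, ← ENNReal.toReal_ofReal hC0, ← ENNReal.toReal_mul]
  exact ENNReal.toReal_mono (ENNReal.mul_ne_top ENNReal.ofReal_ne_top (Lp.eLpNorm_ne_top _)) h

theorem injective_embedding {J : Lp ℝ 2 (leb M) →L[ℝ] Lp ℝ 2 (leb M)}
    (hM : 0 < M) (hJ : ∀ f, J f =ᵐ[leb M] logPrimitive M f) : Function.Injective J := by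
  rw [injective_iff_map_eq_zero]
  intro f hf
  have hfi := integrable_coeFn_leb f
  have h0 : ∀ᵐ x ∂(leb M), logPrimitive M f x = 0 := by
    filter_upwards [hJ f, Lp.coeFn_zero ℝ 2 (leb M)] with x h1 h2
    rw [← h1, hf, h2]
    rfl
  have h1 := isOpen_Ioo.ae_eq_zero_of_integral_contDiff_smul_eq_zero (μ := volume) (U := Ioo 0 M)
    (locallyIntegrableOn_div_id hfi) (fun g hg1 hg2 hg3 => by
      have h2 := integral_logPrimitive_mul_deriv hM hfi ⟨hg1, hg2, hg3⟩
      rw [setIntegral_mul_of_tsupport_subset hg3, ← leb_restrict_Ioo,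
        integral_eq_zero_of_ae (h0.mono fun x hx => by simp [hx])] at h2
      simp_rw [smul_eq_mul, mul_comm (g _)]
      linarith)
  refine Lp.ext ?_
  filter_upwards [ae_leb_iff.2 h1, ae_leb_mem, Lp.coeFn_zero ℝ 2 (leb M)] with x h1 h2 h3
  rw [h3]
  rcases div_eq_zero_iff.1 h1 with h | h
  · exact h
  · exact absurd h h2.1.ne'

/-- An admissible measure does not charge `0`: test it with `ρ(n x)`, `ρ` a cut-off at `0`. -/
theorem measure_singleton_zero_eq_zero (hM : 0 < M) {ν : Measure ℝ} {C : ℝ}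
    (hC : ∀ φ, IsTest M φ →
      eLpNorm φ 2 ν ≤ ENNReal.ofReal C * eLpNorm (fun x => x * deriv φ x) 2 (leb M)) :
    ν {0} = 0 := by
  let ρ : ContDiffBump (0 : ℝ) := ⟨1, 2, one_pos, one_lt_two⟩
  have hρ : ContDiff ℝ ∞ ρ := ρ.contDiff
  have hc : Continuous fun x => x * deriv ρ x :=
    continuous_id.mul (contDiff_infty_iff_deriv.1 hρ).2.continuous
  obtain ⟨B, hB⟩ :=
    (ρ.hasCompactSupport.deriv.mul_left (f := fun x => x)).exists_bound_of_continuous hc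
  have hts : ∀ n : ℕ, tsupport (fun x => ρ ((n + 1 : ℝ) * x))
      ⊆ Icc (-(2 / (n + 1 : ℝ))) (2 / (n + 1)) := by
    intro n
    refine closure_minimal (fun x hx => ?_) isClosed_Icc
    have h1 : (n + 1 : ℝ) * x ∈ Function.support ρ := hx
    rw [ρ.support_eq, mem_ball_zero_iff, Real.norm_eq_abs, abs_lt] at h1
    have hn : (0 : ℝ) < n + 1 := by positivity
    obtain ⟨h2, h3⟩ := h1
    change -2 < _ at h2
    change _ < (2 : ℝ) at h3
    constructor
    · rw [neg_le_iff_add_nonneg, ← mul_le_mul_iff_right₀ hn, mul_add, mul_div_cancel₀ _ hn.ne']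
      linarith
    · rw [le_div_iff₀ hn]
      linarith
  -- `x ∂ₓ` is invariant under dilations, so `x φ'` stays bounded while its support shrinks
  have hest : ∀ᶠ n : ℕ in atTop, ν {0} ^ (1 / (2 : ℝ≥0∞).toReal) ≤ ENNReal.ofReal C *
      (ENNReal.ofReal B * ENNReal.ofReal (4 / (n + 1 : ℝ)) ^ (1 / (2 : ℝ≥0∞).toReal)) := by
    have hev : ∀ᶠ n : ℕ in atTop, 2 / M < (n : ℝ) :=
      tendsto_natCast_atTop_atTop.eventually_gt_atTop _
    filter_upwards [hev] with n hn
    have hn0 : (0 : ℝ) < n + 1 := by positivity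
    have htest : IsTest M fun x => ρ ((n + 1 : ℝ) * x) := by
      refine ⟨hρ.comp (contDiff_const.mul contDiff_id),
        isCompact_Icc.of_isClosed_subset (isClosed_tsupport _) (hts n), (hts n).trans fun x hx => ?_⟩
      refine lt_of_le_of_lt hx.2 ?_
      rw [div_lt_iff₀ hn0]
      rw [div_lt_iff₀ hM] at hn
      nlinarith
    have h1 := hC _ htest
    refine le_trans ?_ (h1.trans (mul_le_mul_right ?_ _))
    · have h2 := eLpNorm_indicator_const (μ := ν) (c := (1 : ℝ)) (measurableSet_singleton (0 : ℝ))
        (p := 2) (by norm_num) (by norm_num)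
      rw [enorm_one, one_mul] at h2
      rw [← h2]
      refine eLpNorm_mono fun x => ?_
      by_cases hx : x ∈ ({0} : Set ℝ)
      · rw [indicator_of_mem hx, mem_singleton_iff.1 hx, mul_zero,
          ρ.one_of_mem_closedBall (Metric.mem_closedBall_self ρ.rIn_pos.le)]
      · rw [indicator_of_notMem hx, norm_zero]
        exact norm_nonneg _
    · have h2 := eLpNorm_indicator_const (μ := leb M) (c := B)
        (s := Icc (-(2 / (n + 1 : ℝ))) (2 / (n + 1))) measurableSet_Icc
        (p := 2) (by norm_num) (by norm_num)
      have hB0 : 0 ≤ B := (norm_nonneg _).trans (hB 0)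
      refine le_trans (eLpNorm_mono (g := (Icc (-(2 / (n + 1 : ℝ))) (2 / (n + 1))).indicator
        fun _ => B) fun x => ?_) (h2.le.trans ?_)
      · by_cases hx : x ∈ Icc (-(2 / (n + 1 : ℝ))) (2 / (n + 1))
        · rw [indicator_of_mem hx, Real.norm_of_nonneg hB0]
          refine le_trans (le_of_eq ?_) (hB ((n + 1 : ℝ) * x))
          rw [deriv_comp_mul_left, smul_eq_mul]
          congr 1
          simp only [Pi.mul_apply]
          ring
        · rw [indicator_of_notMem hx, image_eq_zero_of_notMem_tsupport
            (f := deriv fun x => ρ ((n + 1 : ℝ) * x))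
            fun h => hx (hts n (tsupport_deriv_subset h)), mul_zero]
      · rw [Real.enorm_eq_ofReal hB0]
        gcongr
        refine (Measure.restrict_apply_le _ _).trans_eq ?_
        rw [Real.volume_Icc]
        congr 1
        ring
  have hlim : Tendsto (fun n : ℕ => ENNReal.ofReal C *
      (ENNReal.ofReal B * ENNReal.ofReal (4 / (n + 1 : ℝ)) ^ (1 / (2 : ℝ≥0∞).toReal))) atTop
      (𝓝 (ENNReal.ofReal C * (ENNReal.ofReal B *
        ENNReal.ofReal 0 ^ (1 / (2 : ℝ≥0∞).toReal)))) := by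
    refine ENNReal.Tendsto.const_mul (ENNReal.Tendsto.const_mul
      ((ENNReal.continuous_rpow_const.tendsto _).comp (ENNReal.tendsto_ofReal ?_))
      (Or.inr ENNReal.ofReal_ne_top)) (Or.inr ENNReal.ofReal_ne_top)
    have := (tendsto_one_div_add_atTop_nhds_zero_nat (𝕜 := ℝ)).const_mul 4
    simpa [div_eq_mul_inv] using this
  have h := ge_of_tendsto hlim hest
  simp only [ENNReal.ofReal_zero] at h
  rw [ENNReal.zero_rpow_of_pos (by norm_num), mul_zero, mul_zero, nonpos_iff_eq_zero] at h
  exact (ENNReal.rpow_eq_zero_iff_of_pos (by norm_num)).1 h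

end





/-! ### Multiplication operators -/

instance : Fact ((2 : ℝ≥0∞) ≠ ⊤) := ⟨ENNReal.ofNat_ne_top⟩

/-- A time dependent multiplier: jointly measurable and bounded. -/
structure IsMultiplier (a : ℝ → ℝ → ℝ) (C : ℝ) : Prop where
  measurable : Measurable (Function.uncurry a)
  bound : ∀ t x, |a t x| ≤ C

section

variable {a b : ℝ → ℝ → ℝ} {C C' : ℝ} {ν : Measure ℝ}

theorem IsMultiplier.nonneg (ha : IsMultiplier a C) : 0 ≤ C :=
  (abs_nonneg _).trans (ha.bound 0 0)

theorem IsMultiplier.memLp (ha : IsMultiplier a C) (t : ℝ) (f : Lp ℝ 2 ν) :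
    MemLp (fun x => a t x * f x) 2 ν := by
  refine (Lp.memLp f).of_le_mul (c := C) ?_ (Eventually.of_forall fun x => ?_)
  · exact ((ha.measurable.comp measurable_prodMk_left).aestronglyMeasurable).mul
      (Lp.aestronglyMeasurable f)
  · rw [norm_mul]
    exact mul_le_mul_of_nonneg_right (ha.bound t x) (norm_nonneg _)

theorem IsMultiplier.norm_toLp_le (ha : IsMultiplier a C) (t : ℝ) (f : Lp ℝ 2 ν) :
    ‖(ha.memLp t f).toLp‖ ≤ C * ‖f‖ := by
  refine Lp.norm_le_mul_norm_of_ae_le_mul ?_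
  filter_upwards [(ha.memLp t f).coeFn_toLp] with x hx
  rw [hx, norm_mul]
  exact mul_le_mul_of_nonneg_right (ha.bound t x) (norm_nonneg _)

/-- Multiplication by `a(t, ·)` as an operator on `L²_ν`. -/
noncomputable def IsMultiplier.op (ha : IsMultiplier a C) (ν : Measure ℝ) (t : ℝ) :
    Lp ℝ 2 ν →L[ℝ] Lp ℝ 2 ν :=
  LinearMap.mkContinuous
    { toFun := fun f => (ha.memLp t f).toLp
      map_add' := fun f g => by
        refine Lp.ext ?_
        filter_upwards [(ha.memLp t (f + g)).coeFn_toLp, (ha.memLp t f).coeFn_toLp,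
          (ha.memLp t g).coeFn_toLp, Lp.coeFn_add f g,
          Lp.coeFn_add (ha.memLp t f).toLp (ha.memLp t g).toLp] with x h1 h2 h3 h4 h5
        rw [h1, h5, Pi.add_apply, h2, h3, h4, Pi.add_apply, mul_add]
      map_smul' := fun c f => by
        refine Lp.ext ?_
        filter_upwards [(ha.memLp t (c • f)).coeFn_toLp, (ha.memLp t f).coeFn_toLp,
          Lp.coeFn_smul c f, Lp.coeFn_smul c (ha.memLp t f).toLp] with x h1 h2 h3 h4
        rw [RingHom.id_apply, h1, h4, Pi.smul_apply, h2, h3, Pi.smul_apply, smul_eq_mul,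
          smul_eq_mul]
        ring } C (ha.norm_toLp_le t)

theorem IsMultiplier.coeFn_op (ha : IsMultiplier a C) (t : ℝ) (f : Lp ℝ 2 ν) :
    ha.op ν t f =ᵐ[ν] fun x => a t x * f x := (ha.memLp t f).coeFn_toLp

theorem IsMultiplier.norm_op_le (ha : IsMultiplier a C) (t : ℝ) (f : Lp ℝ 2 ν) :
    ‖ha.op ν t f‖ ≤ C * ‖f‖ := ha.norm_toLp_le t f

theorem IsMultiplier.inner_op (ha : IsMultiplier a C) (t : ℝ) (f g : Lp ℝ 2 ν) :
    ⟪ha.op ν t f, g⟫ = ∫ x, a t x * f x * g x ∂ν := by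
  rw [L2.inner_def]
  refine integral_congr_ae ?_
  filter_upwards [ha.coeFn_op t f] with x hx
  simp only [RCLike.inner_apply, conj_trivial, hx]
  ring

theorem IsMultiplier.integrable_inner_op (ha : IsMultiplier a C) (t : ℝ) (f g : Lp ℝ 2 ν) :
    Integrable (fun x => a t x * f x * g x) ν := by
  have h := L2.integrable_inner (𝕜 := ℝ) (ha.op ν t f) g
  refine h.congr ?_
  filter_upwards [ha.coeFn_op t f] with x hx
  simp only [RCLike.inner_apply, conj_trivial, hx]
  ring

theorem IsMultiplier.le_inner_op (ha : IsMultiplier a C) (t : ℝ) (f : Lp ℝ 2 ν) {c : ℝ}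
    (hc : ∀ x, c ≤ a t x) : c * ‖f‖ ^ 2 ≤ ⟪ha.op ν t f, f⟫ := by
  have h1 : ‖f‖ ^ 2 = ∫ x, f x * f x ∂ν := by
    rw [← real_inner_self_eq_norm_sq, L2.inner_def]
    simp only [RCLike.inner_apply, conj_trivial]
  have h2 : Integrable (fun x => f x * f x) ν := by
    simpa only [RCLike.inner_apply, conj_trivial] using L2.integrable_inner (𝕜 := ℝ) f f
  rw [h1, ha.inner_op, ← integral_const_mul]
  refine integral_mono (h2.const_mul c) (ha.integrable_inner_op t f f) fun x => ?_
  simp only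
  rw [mul_assoc]
  exact mul_le_mul_of_nonneg_right (hc x) (mul_self_nonneg _)

theorem IsMultiplier.stronglyMeasurable_op [IsFiniteMeasure ν] (ha : IsMultiplier a C)
    (f : Lp ℝ 2 ν) : StronglyMeasurable fun t => ha.op ν t f := by
  refine stronglyMeasurable_of_forall_inner fun g => ?_
  simp_rw [ha.inner_op]
  refine StronglyMeasurable.integral_prod_right (f := fun t x => a t x * f x * g x) ?_
  exact (ha.measurable.stronglyMeasurable.mul
    ((Lp.stronglyMeasurable f).comp_measurable measurable_snd)).mul
      ((Lp.stronglyMeasurable g).comp_measurable measurable_snd)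

theorem IsMultiplier.add (ha : IsMultiplier a C) (hb : IsMultiplier b C') :
    IsMultiplier (fun t x => a t x + b t x) (C + C') :=
  ⟨ha.measurable.add hb.measurable, fun t x =>
    (abs_add_le _ _).trans (add_le_add (ha.bound t x) (hb.bound t x))⟩

theorem IsMultiplier.sub (ha : IsMultiplier a C) (hb : IsMultiplier b C') :
    IsMultiplier (fun t x => a t x - b t x) (C + C') :=
  ⟨ha.measurable.sub hb.measurable, fun t x =>
    (abs_sub _ _).trans (add_le_add (ha.bound t x) (hb.bound t x))⟩

theorem IsMultiplier.mul (ha : IsMultiplier a C) (hb : IsMultiplier b C') :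
    IsMultiplier (fun t x => a t x * b t x) (C * C') :=
  ⟨ha.measurable.mul hb.measurable, fun t x => by
    rw [abs_mul]
    exact mul_le_mul (ha.bound t x) (hb.bound t x) (abs_nonneg _) ha.nonneg⟩

theorem IsMultiplier.const (c : ℝ) : IsMultiplier (fun _ _ => c) |c| :=
  ⟨measurable_const, fun _ _ => le_rfl⟩

end

/-! ### The measure based Black–Scholes system -/

/-- Coefficients of the Black–Scholes form, defined for all `t` and `x`: the volatility `s`, its
logarithmic derivative `d = x ∂ₓs` and the interest rate `r`. -/
structure Coefficients (M σlow σup Cσ R : ℝ) where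
  s : ℝ → ℝ → ℝ
  d : ℝ → ℝ → ℝ
  r : ℝ → ℝ
  isMultiplier_s : IsMultiplier s σup
  isMultiplier_d : IsMultiplier d Cσ
  isMultiplier_r : IsMultiplier (fun t _ => r t) R
  σlow_pos : 0 < σlow
  le_s : ∀ t x, σlow ≤ s t x
  r_nonneg : ∀ t, 0 ≤ r t
  hasDerivAt : ∀ t, ∀ x ∈ Ioo 0 M, HasDerivAt (s t) (d t x / x) x

namespace Coefficients

variable {M σlow σup Cσ R : ℝ} (Q : Coefficients M σlow σup Cσ R)

theorem s_pos (t x : ℝ) : 0 < Q.s t x := Q.σlow_pos.trans_le (Q.le_s t x)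

theorem σup_pos (Q : Coefficients M σlow σup Cσ R) : 0 < σup :=
  (Q.s_pos 0 0).trans_le ((le_abs_self _).trans (Q.isMultiplier_s.bound 0 0))

theorem isMultiplier_inv : IsMultiplier (fun t x => (Q.s t x * Q.s t x)⁻¹) (σlow * σlow)⁻¹ := by
  refine ⟨(Q.isMultiplier_s.measurable.mul Q.isMultiplier_s.measurable).inv, fun t x => ?_⟩
  have h := Q.σlow_pos
  rw [abs_of_pos (inv_pos.2 (mul_pos (Q.s_pos t x) (Q.s_pos t x)))]
  exact inv_anti₀ (mul_pos h h) (mul_le_mul (Q.le_s t x) (Q.le_s t x) h.le (Q.s_pos t x).le)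

theorem inv_le_inv (t x : ℝ) : (σup * σup)⁻¹ ≤ (Q.s t x * Q.s t x)⁻¹ := by
  have h := Q.s_pos t x
  have h2 : Q.s t x ≤ σup := (le_abs_self _).trans (Q.isMultiplier_s.bound t x)
  exact inv_anti₀ (mul_pos h h) (mul_le_mul h2 h2 h.le (h.le.trans h2))

theorem isMultiplier_diffusion :
    IsMultiplier (fun t x => 1 / 2 * (Q.s t x * Q.s t x)) (|(1 / 2 : ℝ)| * (σup * σup)) :=
  (IsMultiplier.const _).mul (Q.isMultiplier_s.mul Q.isMultiplier_s)

theorem isMultiplier_drift :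
    IsMultiplier (fun t x => Q.s t x * Q.s t x + Q.s t x * Q.d t x - Q.r t)
      (σup * σup + σup * Cσ + R) :=
  ((Q.isMultiplier_s.mul Q.isMultiplier_s).add (Q.isMultiplier_s.mul Q.isMultiplier_d)).sub
    Q.isMultiplier_r

theorem isMultiplier_killing :
    IsMultiplier (fun t x => Q.r t * (Q.s t x * Q.s t x)⁻¹) (R * (σlow * σlow)⁻¹) :=
  Q.isMultiplier_r.mul Q.isMultiplier_inv

theorem isMultiplier_one_sub_killing :
    IsMultiplier (fun t x => 1 - Q.r t * (Q.s t x * Q.s t x)⁻¹)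
      (|(1 : ℝ)| + R * (σlow * σlow)⁻¹) :=
  (IsMultiplier.const 1).sub Q.isMultiplier_killing

theorem isMultiplier_square : IsMultiplier (fun t x => Q.s t x * Q.s t x) (σup * σup) :=
  Q.isMultiplier_s.mul Q.isMultiplier_s

theorem isMultiplier_square_deriv :
    IsMultiplier (fun t x => 2 * (Q.s t x * Q.d t x)) (|(2 : ℝ)| * (σup * Cσ)) :=
  (IsMultiplier.const 2).mul (Q.isMultiplier_s.mul Q.isMultiplier_d)

variable (J : Lp ℝ 2 (leb M) →L[ℝ] Lp ℝ 2 (leb M))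

/-- The operator of the Black–Scholes form in the variable `f = x ∂ₓu`, `J f = u`. -/
noncomputable def formOp (t : ℝ) : Lp ℝ 2 (leb M) →L[ℝ] Lp ℝ 2 (leb M) :=
  Q.isMultiplier_diffusion.op (leb M) t
    + (J.adjoint ∘L Q.isMultiplier_drift.op (leb M) t
      + J.adjoint ∘L Q.isMultiplier_r.op (leb M) t ∘L J)

/-- The lower order part of the form tested with `w ↦ s² w`. -/
noncomputable def lowerOp (t : ℝ) : Lp ℝ 2 (leb M) →L[ℝ] Lp ℝ 2 (leb M) :=
  Q.isMultiplier_one_sub_killing.op (leb M) t ∘L J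
    + J.adjoint ∘L Q.isMultiplier_killing.op (leb M) t ∘L J

/-- Multiplication of `u` by `s²`, in terms of `f = x ∂ₓu`. -/
noncomputable def squareOp (t : ℝ) : Lp ℝ 2 (leb M) →L[ℝ] Lp ℝ 2 (leb M) :=
  Q.isMultiplier_square.op (leb M) t + Q.isMultiplier_square_deriv.op (leb M) t ∘L J

theorem inner_formOp (t : ℝ) (f g : Lp ℝ 2 (leb M)) :
    ⟪Q.formOp J t f, g⟫ = ⟪Q.isMultiplier_diffusion.op (leb M) t f, g⟫
      + (⟪Q.isMultiplier_drift.op (leb M) t f, J g⟫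
        + ⟪Q.isMultiplier_r.op (leb M) t (J f), J g⟫) := by
  simp only [formOp, add_apply, ContinuousLinearMap.comp_apply,
    inner_add_left, ContinuousLinearMap.adjoint_inner_left]

variable {J}

/-- The product rule `x ∂ₓ(s² u) = s² x ∂ₓu + 2 s (x ∂ₓs) u`, integrated. -/
theorem logPrimitive_squareOp (hM : 0 < M) (hJ : ∀ f, J f =ᵐ[leb M] logPrimitive M f) (t : ℝ)
    (f : Lp ℝ 2 (leb M)) {x : ℝ} (hx : x ∈ Ioo 0 M) :
    logPrimitive M (Q.squareOp J t f) x = Q.s t x * Q.s t x * logPrimitive M f x := by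
  have hfi := integrable_coeFn_leb f
  have hni := integrable_coeFn_leb (Q.squareOp J t f)
  have hN : Q.squareOp J t f =ᵐ[leb M] fun y => Q.s t y * Q.s t y * f y
      + 2 * (Q.s t y * Q.d t y) * logPrimitive M f y := by
    filter_upwards [Lp.coeFn_add (Q.isMultiplier_square.op (leb M) t f)
      (Q.isMultiplier_square_deriv.op (leb M) t (J f)), Q.isMultiplier_square.coeFn_op t f,
      Q.isMultiplier_square_deriv.coeFn_op t (J f), hJ f] with y h1 h2 h3 h4
    refine h1.trans ?_
    rw [Pi.add_apply, h2, h3, h4]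
  -- on `[x, b]` the product rule holds; the boundary terms at `b` vanish as `b → M`
  have hb : ∀ b ∈ Ioo x M, logPrimitive M (Q.squareOp J t f) b
      - Q.s t b * Q.s t b * logPrimitive M f b
      = logPrimitive M (Q.squareOp J t f) x - Q.s t x * Q.s t x * logPrimitive M f x := by
    intro b hb
    have hpos : ∀ y ∈ Icc x b, y ∈ Ioo 0 M := fun y hy =>
      ⟨hx.1.trans_le hy.1, hy.2.trans_lt hb.2⟩
    have h1 := integral_product_rule hfi hx.1 hb.1.le hb.2
      (s := fun y => Q.s t y * Q.s t y)
      (s' := fun y => Q.d t y / y * Q.s t y + Q.s t y * (Q.d t y / y))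
      (C := Cσ / x * σup + σup * (Cσ / x))
      (fun y hy => (Q.hasDerivAt t y (hpos y hy)).mul (Q.hasDerivAt t y (hpos y hy)))
      (fun y hy => by
        have hd : |Q.d t y / y| ≤ Cσ / x := by
          rw [abs_div, abs_of_pos (hpos y hy).1]
          exact div_le_div₀ Q.isMultiplier_d.nonneg (Q.isMultiplier_d.bound t y) hx.1 hy.1
        refine (abs_add_le _ _).trans (add_le_add ?_ ?_)
        · rw [abs_mul]
          exact mul_le_mul hd (Q.isMultiplier_s.bound t y) (abs_nonneg _)
            ((abs_nonneg _).trans hd)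
        · rw [abs_mul]
          exact mul_le_mul (Q.isMultiplier_s.bound t y) hd (abs_nonneg _) Q.σup_pos.le)
    have h2 := logPrimitive_sub hni (Ioo_subset_Ioc_self hx)
      (show b ∈ Ioc 0 M from ⟨hx.1.trans hb.1, hb.2.le⟩)
    have h3 : ∫ y in x..b, Q.squareOp J t f y / y = ∫ y in x..b,
        ((Q.d t y / y * Q.s t y + Q.s t y * (Q.d t y / y)) * logPrimitive M f y
          + Q.s t y * Q.s t y * (f y / y)) := by
      refine intervalIntegral.integral_congr_ae ?_
      filter_upwards [ae_leb_iff.1 hN] with y hy h0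
      rw [uIoc_of_le hb.1.le] at h0
      rw [hy (hpos y (Ioc_subset_Icc_self h0))]
      ring
    rw [← h3, ← h2] at h1
    linarith
  have hl1 := tendsto_logPrimitive hM hni
  have hl2 : Tendsto (fun b => Q.s t b * Q.s t b * logPrimitive M f b) (𝓝[<] M) (𝓝 0) := by
    refine Tendsto.zero_mul_isBoundedUnder_le (tendsto_logPrimitive hM hfi)
      (isBoundedUnder_of ⟨σup * σup, fun b => ?_⟩) |>.congr fun b => mul_comm _ _
    exact Q.isMultiplier_square.bound t b
  have hl := hl1.sub hl2
  have hl' : Tendsto (fun b => logPrimitive M (Q.squareOp J t f) b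
      - Q.s t b * Q.s t b * logPrimitive M f b) (𝓝[<] M)
      (𝓝 (logPrimitive M (Q.squareOp J t f) x - Q.s t x * Q.s t x * logPrimitive M f x)) := by
    refine tendsto_const_nhds.congr' ?_
    filter_upwards [Ioo_mem_nhdsLT hx.2] with b hb'
    exact (hb b hb').symm
  have := tendsto_nhds_unique hl' hl
  linarith

theorem apply_squareOp (hM : 0 < M) (hJ : ∀ f, J f =ᵐ[leb M] logPrimitive M f) (t : ℝ)
    (f : Lp ℝ 2 (leb M)) : J (Q.squareOp J t f) =ᵐ[leb M] fun x => Q.s t x * Q.s t x * J f x := by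
  filter_upwards [hJ f, hJ (Q.squareOp J t f), ae_leb_mem] with x h1 h2 h3
  rw [h1, h2, Q.logPrimitive_squareOp hM hJ t f h3]

/-- Testing the form with `s² w` leaves no derivative of the coefficients. -/
theorem form_eq (hM : 0 < M) (hJ : ∀ f, J f =ᵐ[leb M] logPrimitive M f) (t : ℝ)
    (f q : Lp ℝ 2 (leb M)) :
    1 / 2 * ⟪f, Q.squareOp J t q⟫ + ⟪f, Q.lowerOp J t (Q.squareOp J t q)⟫
      = ⟪Q.formOp J t f, q⟫ := by
  have e1 : ⟪f, Q.squareOp J t q⟫ = ⟪Q.isMultiplier_square.op (leb M) t q, f⟫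
      + ⟪Q.isMultiplier_square_deriv.op (leb M) t (J q), f⟫ := by
    rw [real_inner_comm, squareOp, add_apply, inner_add_left,
      ContinuousLinearMap.comp_apply]
  have e2 : ⟪f, Q.lowerOp J t (Q.squareOp J t q)⟫
      = ⟪Q.isMultiplier_one_sub_killing.op (leb M) t (J (Q.squareOp J t q)), f⟫
        + ⟪Q.isMultiplier_killing.op (leb M) t (J (Q.squareOp J t q)), J f⟫ := by
    rw [real_inner_comm, lowerOp, add_apply, inner_add_left,
      ContinuousLinearMap.comp_apply, ContinuousLinearMap.comp_apply,
      ContinuousLinearMap.comp_apply, ContinuousLinearMap.adjoint_inner_left]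
  rw [e1, e2, inner_formOp]
  simp only [IsMultiplier.inner_op]
  have i1 := Q.isMultiplier_square.integrable_inner_op t q f
  have i2 := Q.isMultiplier_square_deriv.integrable_inner_op t (J q) f
  have i3 := Q.isMultiplier_one_sub_killing.integrable_inner_op t (J (Q.squareOp J t q)) f
  have i4 := Q.isMultiplier_killing.integrable_inner_op t (J (Q.squareOp J t q)) (J f)
  have i5 := Q.isMultiplier_diffusion.integrable_inner_op t f q
  have i6 := Q.isMultiplier_drift.integrable_inner_op t f (J q)
  have i7 := Q.isMultiplier_r.integrable_inner_op t (J f) (J q)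
  rw [← integral_add i1 i2, ← integral_const_mul, ← integral_add i3 i4,
    ← integral_add ((i1.fun_add i2).const_mul _) (i3.fun_add i4), ← integral_add i6 i7,
    ← integral_add i5 (i6.fun_add i7)]
  refine integral_congr_ae ?_
  filter_upwards [Q.apply_squareOp hM hJ t q] with x hx
  have hs := (Q.s_pos t x).ne'
  simp only [hx]
  field_simp
  ring

theorem stronglyMeasurable_formOp (w : Lp ℝ 2 (leb M)) :
    StronglyMeasurable fun t => Q.formOp J t w :=
  (Q.isMultiplier_diffusion.stronglyMeasurable_op w).add
    ((J.adjoint.continuous.comp_stronglyMeasurable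
      (Q.isMultiplier_drift.stronglyMeasurable_op w)).add
      (J.adjoint.continuous.comp_stronglyMeasurable
        (Q.isMultiplier_r.stronglyMeasurable_op (J w))))

theorem stronglyMeasurable_lowerOp (w : Lp ℝ 2 (leb M)) :
    StronglyMeasurable fun t => Q.lowerOp J t w :=
  (Q.isMultiplier_one_sub_killing.stronglyMeasurable_op (J w)).add
    (J.adjoint.continuous.comp_stronglyMeasurable
      (Q.isMultiplier_killing.stronglyMeasurable_op (J w)))

variable (J) in
theorem norm_adjoint_apply_le (w : Lp ℝ 2 (leb M)) : ‖J.adjoint w‖ ≤ ‖J‖ * ‖w‖ := by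
  have h := J.adjoint.le_opNorm w
  rwa [LinearIsometryEquiv.norm_map] at h

variable (J) in
theorem norm_formOp_le (t : ℝ) (f : Lp ℝ 2 (leb M)) :
    ‖Q.formOp J t f‖ ≤ (|(1 / 2 : ℝ)| * (σup * σup) + (‖J‖ * (σup * σup + σup * Cσ + R)
      + ‖J‖ * (R * ‖J‖))) * ‖f‖ := by
  have h1 := Q.isMultiplier_diffusion.norm_op_le t f
  have h2 := norm_adjoint_apply_le J (Q.isMultiplier_drift.op (leb M) t f)
  have h3 := Q.isMultiplier_drift.norm_op_le t f
  have h4 := norm_adjoint_apply_le J (Q.isMultiplier_r.op (leb M) t (J f))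
  have h5 := Q.isMultiplier_r.norm_op_le t (J f)
  have h6 := J.le_opNorm f
  have hR := Q.isMultiplier_r.nonneg
  have hJ0 := norm_nonneg J
  have h7 : ‖Q.formOp J t f‖ ≤ ‖Q.isMultiplier_diffusion.op (leb M) t f‖
      + (‖J.adjoint (Q.isMultiplier_drift.op (leb M) t f)‖
        + ‖J.adjoint (Q.isMultiplier_r.op (leb M) t (J f))‖) :=
    (norm_add_le _ _).trans (add_le_add le_rfl (norm_add_le _ _))
  have h8 := mul_le_mul_of_nonneg_left h3 hJ0
  have h9 := mul_le_mul_of_nonneg_left (h5.trans (mul_le_mul_of_nonneg_left h6 hR)) hJ0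
  linarith

theorem norm_lowerOp_le {C₁ : ℝ} {q : Lp ℝ 2 (leb M)} {k : ℝ} (hk : ‖J q‖ ≤ C₁ * k) (t : ℝ) :
    ‖Q.lowerOp J t q‖ ≤ ((|(1 : ℝ)| + R * (σlow * σlow)⁻¹ + ‖J‖ * (R * (σlow * σlow)⁻¹)) * C₁)
      * k := by
  have h1 := Q.isMultiplier_one_sub_killing.norm_op_le t (J q)
  have h2 := norm_adjoint_apply_le J (Q.isMultiplier_killing.op (leb M) t (J q))
  have h3 := Q.isMultiplier_killing.norm_op_le t (J q)
  have h4 : ‖Q.lowerOp J t q‖ ≤ ‖Q.isMultiplier_one_sub_killing.op (leb M) t (J q)‖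
      + ‖J.adjoint (Q.isMultiplier_killing.op (leb M) t (J q))‖ := norm_add_le _ _
  have h5 := mul_le_mul_of_nonneg_left h3 (norm_nonneg J)
  have h6 : 0 ≤ |(1 : ℝ)| + R * (σlow * σlow)⁻¹ + ‖J‖ * (R * (σlow * σlow)⁻¹) :=
    add_nonneg Q.isMultiplier_one_sub_killing.nonneg
      (mul_nonneg (norm_nonneg J) Q.isMultiplier_killing.nonneg)
  have h7 := mul_le_mul_of_nonneg_left hk h6
  linarith

/-- **Gårding's inequality** for the Black–Scholes form: the drift is absorbed by half of the diffusion
and a multiple of `k²`, where `k` stands for `‖u‖_{L²_μ}`. -/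
theorem formOp_coercive {C₁ : ℝ} {f : Lp ℝ 2 (leb M)} {k : ℝ} (hk : ‖J f‖ ≤ C₁ * k) (t : ℝ) :
    σlow * σlow / 4 * ‖f‖ ^ 2 ≤ ⟪Q.formOp J t f, f⟫
      + ((σup * σup + σup * Cσ + R) / σlow * C₁) ^ 2 * k ^ 2 := by
  have hσ := Q.σlow_pos
  set A := σup * σup + σup * Cσ + R with hA
  have hA0 : 0 ≤ A := Q.isMultiplier_drift.nonneg
  have h1 := Q.isMultiplier_diffusion.le_inner_op t f (c := σlow * σlow / 2) fun x => by
    have := mul_le_mul (Q.le_s t x) (Q.le_s t x) hσ.le (Q.s_pos t x).le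
    linarith
  have h2 : 0 * ‖J f‖ ^ 2 ≤ ⟪Q.isMultiplier_r.op (leb M) t (J f), J f⟫ :=
    Q.isMultiplier_r.le_inner_op t (J f) fun _ => Q.r_nonneg t
  have h3 := abs_real_inner_le_norm (Q.isMultiplier_drift.op (leb M) t f) (J f)
  have h4 := mul_le_mul (Q.isMultiplier_drift.norm_op_le t f) hk (norm_nonneg _)
    (mul_nonneg hA0 (norm_nonneg _))
  have h5 := neg_le_of_abs_le (h3.trans h4)
  rw [inner_formOp]
  have h6 : A * ‖f‖ * (C₁ * k) ≤ σlow * σlow / 4 * ‖f‖ ^ 2 + (A / σlow * C₁) ^ 2 * k ^ 2 := by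
    have h7 := sq_nonneg (σlow / 2 * ‖f‖ - A / σlow * C₁ * k)
    have h8 : 2 * (σlow / 2 * ‖f‖) * (A / σlow * C₁ * k) = A * ‖f‖ * (C₁ * k) := by
      field_simp
    nlinarith
  linarith

variable {C₀ C₁ : ℝ}

/-- The implicit system of the measure based Black–Scholes problem for the measure `ν`. The
unknown is `f = x ∂ₓu`, and `K`, `J` are the embeddings `f ↦ u` into `L²_ν` and `L²`. -/
noncomputable def system (hM : 0 < M) (hC₁ : 0 < C₁)
    (hJ : ∀ f, J f =ᵐ[leb M] logPrimitive M f) {ν : Measure ℝ} [IsFiniteMeasure ν]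
    (hν : ∀ᵐ x ∂ν, x ∈ Ioo 0 M) {K : Lp ℝ 2 (leb M) →L[ℝ] Lp ℝ 2 ν}
    (hK : ∀ f, K f =ᵐ[ν] logPrimitive M f) (hKb : ∀ f, ‖K f‖ ≤ C₀ * ‖f‖)
    (hJK : ∀ f, ‖J f‖ ≤ C₁ * ‖K f‖) :
    ImplicitSystem (Lp ℝ 2 (leb M)) (Lp ℝ 2 ν) (σup * σup)⁻¹ ((σlow * σlow)⁻¹ * C₀)
      ((|(1 : ℝ)| + R * (σlow * σlow)⁻¹ + ‖J‖ * (R * (σlow * σlow)⁻¹)) * C₁)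
      (|(1 / 2 : ℝ)| * (σup * σup) + (‖J‖ * (σup * σup + σup * Cσ + R) + ‖J‖ * (R * ‖J‖)))
      (σlow * σlow / 4) (((σup * σup + σup * Cσ + R) / σlow * C₁) ^ 2) where
  K := K
  P := fun t => Q.isMultiplier_inv.op ν t ∘L K
  D := Q.lowerOp J
  N := Q.squareOp J
  B := Q.formOp J
  K_injective := by
    rw [injective_iff_map_eq_zero]
    intro f hf
    have h := hJK f
    rw [hf, norm_zero, mul_zero] at h
    exact (injective_iff_map_eq_zero J).1 (injective_embedding hM hJ) f (norm_le_zero_iff.1 h)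
  stronglyMeasurable_P := fun w => Q.isMultiplier_inv.stronglyMeasurable_op (K w)
  stronglyMeasurable_D := Q.stronglyMeasurable_lowerOp
  stronglyMeasurable_B := Q.stronglyMeasurable_formOp
  P_coercive := fun t q => by
    rw [real_inner_comm]
    exact Q.isMultiplier_inv.le_inner_op t (K q) (Q.inv_le_inv t)
  P_bound := fun t q => by
    refine (Q.isMultiplier_inv.norm_op_le t (K q)).trans ?_
    rw [mul_assoc]
    exact mul_le_mul_of_nonneg_left (hKb q) Q.isMultiplier_inv.nonneg
  D_bound := fun t q => Q.norm_lowerOp_le (hJK q) t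
  B_bound := Q.norm_formOp_le J
  B_coercive := fun t q => Q.formOp_coercive (hJK q) t
  P_N := fun t q => by
    refine Lp.ext ?_
    filter_upwards [Q.isMultiplier_inv.coeFn_op t (K (Q.squareOp J t q)), hK q,
      hK (Q.squareOp J t q), hν] with x h1 h2 h3 h4
    rw [ContinuousLinearMap.comp_apply, h1, h2, h3, Q.logPrimitive_squareOp hM hJ t q h4,
      inv_mul_cancel_left₀ (mul_pos (Q.s_pos t x) (Q.s_pos t x)).ne']
  form_eq := Q.form_eq hM hJ
  m₀_pos := inv_pos.2 (mul_pos Q.σup_pos Q.σup_pos)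
  CD_nonneg := mul_nonneg (add_nonneg Q.isMultiplier_one_sub_killing.nonneg
      (mul_nonneg (norm_nonneg J) Q.isMultiplier_killing.nonneg)) hC₁.le
  c_pos := by have := Q.σlow_pos; positivity
  l_nonneg := sq_nonneg _

theorem system_B (hM : 0 < M) (hC₁ : 0 < C₁)
    (hJ : ∀ f, J f =ᵐ[leb M] logPrimitive M f) {ν : Measure ℝ} [IsFiniteMeasure ν]
    (hν : ∀ᵐ x ∂ν, x ∈ Ioo 0 M) {K : Lp ℝ 2 (leb M) →L[ℝ] Lp ℝ 2 ν}
    (hK : ∀ f, K f =ᵐ[ν] logPrimitive M f) (hKb : ∀ f, ‖K f‖ ≤ C₀ * ‖f‖)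
    (hJK : ∀ f, ‖J f‖ ≤ C₁ * ‖K f‖) :
    (Q.system hM hC₁ hJ hν hK hKb hJK).B = Q.formOp J := rfl

end Coefficients





/-- The coefficients agree with the given volatility and interest rate on `[0, T] × ]0, M[`. -/
def Coefficients.Extends {M σlow σup Cσ R : ℝ} (Q : Coefficients M σlow σup Cσ R) (T : ℝ)
    (σ : ℝ → ℝ → ℝ) (r : ℝ → ℝ) : Prop :=
  ∀ t ∈ Icc 0 T, Q.r t = r t ∧
    ∀ x ∈ Ioo 0 M, Q.s t x = σ t x ∧ Q.d t x = x * deriv (σ t) x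

open Classical in
/-- The coefficients extend, by constants outside `[0, T] × ]0, M[`, so that their bounds hold
everywhere. -/
theorem exists_coefficients_extends {M T : ℝ} (hM : 0 < M) (hT : 0 < T) {r : ℝ → ℝ} {R : ℝ}
    (hr_meas : Measurable r) (hr : ∀ t ∈ Icc 0 T, 0 ≤ r t ∧ r t ≤ R)
    {σ : ℝ → ℝ → ℝ} {σlow σup Cσ : ℝ} (hσlow : 0 < σlow)
    (hσ_meas : Measurable (Function.uncurry σ))
    (hσ : ∀ t ∈ Icc 0 T, ∀ x ∈ Icc 0 M, σlow ≤ σ t x ∧ σ t x ≤ σup)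
    (hσ_diff : ∀ t ∈ Icc 0 T, ∀ x ∈ Ioo 0 M,
      DifferentiableAt ℝ (σ t) x ∧ |x * deriv (σ t) x| ≤ Cσ) :
    ∃ Q : Coefficients M σlow σup Cσ R, Q.Extends T σ r := by
  have hE : MeasurableSet {p : ℝ × ℝ | p.1 ∈ Icc 0 T ∧ p.2 ∈ Ioo 0 M} :=
    (measurable_fst measurableSet_Icc).inter (measurable_snd measurableSet_Ioo)
  have h0T : (0 : ℝ) ∈ Icc 0 T := ⟨le_rfl, hT.le⟩
  have hlu : σlow ≤ σup := by
    have := hσ 0 h0T 0 ⟨le_rfl, hM.le⟩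
    linarith
  have hC0 : 0 ≤ Cσ := (abs_nonneg _).trans
    (hσ_diff 0 h0T (M / 2) ⟨by linarith, by linarith⟩).2
  have hR0 : 0 ≤ R := (hr 0 h0T).1.trans (hr 0 h0T).2
  let s : ℝ → ℝ → ℝ := fun t x => if t ∈ Icc 0 T ∧ x ∈ Ioo 0 M then σ t x else σlow
  let d : ℝ → ℝ → ℝ := fun t x => if t ∈ Icc 0 T ∧ x ∈ Ioo 0 M then x * deriv (σ t) x else 0
  have hs : ∀ t x, σlow ≤ s t x ∧ s t x ≤ σup := by
    intro t x
    by_cases h : t ∈ Icc 0 T ∧ x ∈ Ioo 0 M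
    · simp only [s, if_pos h]
      exact hσ t h.1 x (Ioo_subset_Icc_self h.2)
    · simp only [s, if_neg h]
      exact ⟨le_rfl, hlu⟩
  have hd_meas : Measurable (Function.uncurry d) := by
    -- the derivative is a pointwise limit of difference quotients
    let G : ℕ → ℝ × ℝ → ℝ := fun n p => if p.1 ∈ Icc 0 T ∧ p.2 ∈ Ioo 0 M then
      p.2 * ((1 / ((n : ℝ) + 1))⁻¹ * (σ p.1 (p.2 + 1 / ((n : ℝ) + 1)) - σ p.1 p.2)) else 0
    have hG : ∀ n, Measurable (G n) := fun n => by
      refine Measurable.ite hE (measurable_snd.mul (measurable_const.mul (Measurable.sub ?_ ?_)))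
        measurable_const
      · exact hσ_meas.comp (measurable_fst.prodMk (measurable_snd.add_const _))
      · exact hσ_meas
    refine measurable_of_tendsto_metrizable hG (tendsto_pi_nhds.2 fun p => ?_)
    by_cases h : p.1 ∈ Icc 0 T ∧ p.2 ∈ Ioo 0 M
    · simp only [G, Function.uncurry, d, if_pos h]
      have h1 := (hσ_diff p.1 h.1 p.2 h.2).1.hasDerivAt.tendsto_slope_zero
      have h2 : Tendsto (fun n : ℕ => 1 / ((n : ℝ) + 1)) atTop (𝓝[≠] 0) :=
        tendsto_nhdsWithin_iff.2 ⟨tendsto_one_div_add_atTop_nhds_zero_nat,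
          Eventually.of_forall fun n => Nat.one_div_pos_of_nat.ne'⟩
      exact (h1.comp h2).const_mul p.2
    · simp only [G, Function.uncurry, d, if_neg h]
      exact tendsto_const_nhds
  refine ⟨⟨s, d, fun t => if t ∈ Icc 0 T then r t else 0, ⟨?_, fun t x => ?_⟩,
    ⟨hd_meas, fun t x => ?_⟩, ⟨?_, fun t x => ?_⟩, hσlow, fun t x => (hs t x).1, fun t => ?_,
    fun t x hx => ?_⟩, fun t ht => ⟨if_pos ht, fun x hx => ⟨if_pos ⟨ht, hx⟩, if_pos ⟨ht, hx⟩⟩⟩⟩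
  · exact Measurable.ite hE hσ_meas measurable_const
  · rw [abs_of_pos (hσlow.trans_le (hs t x).1)]
    exact (hs t x).2
  · by_cases h : t ∈ Icc 0 T ∧ x ∈ Ioo 0 M
    · simp only [d, if_pos h]
      exact (hσ_diff t h.1 x h.2).2
    · simp only [d, if_neg h, abs_zero]
      exact hC0
  · exact (Measurable.ite measurableSet_Icc hr_meas measurable_const).comp measurable_fst
  · by_cases h : t ∈ Icc 0 T
    · simp only [if_pos h]
      rw [abs_of_nonneg (hr t h).1]
      exact (hr t h).2
    · simp only [if_neg h, abs_zero]
      exact hR0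
  · by_cases h : t ∈ Icc 0 T
    · simp only [if_pos h]
      exact (hr t h).1
    · simp only [if_neg h, le_refl]
  · by_cases h : t ∈ Icc 0 T
    · have h1 : d t x / x = deriv (σ t) x := by
        simp only [d, if_pos (And.intro h hx)]
        rw [mul_div_cancel_left₀ _ hx.1.ne']
      rw [h1]
      refine (hσ_diff t h x hx).1.hasDerivAt.congr_of_eventuallyEq ?_
      filter_upwards [isOpen_Ioo.mem_nhds hx] with y hy
      exact if_pos ⟨h, hy⟩
    · have h1 : s t = fun _ => σlow := funext fun y => if_neg fun h' => h h'.1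
      have h2 : d t x = 0 := if_neg fun h' => h h'.1
      rw [h1, h2, zero_div]
      exact hasDerivAt_const _ _

/-! ### Space-time measurability -/

section

variable {M : ℝ} {lam : Measure ℝ}

/-- Joint measurability of the primitives, cut off outside `]0, M[`. -/
theorem measurable_uncurry_logPrimitive (hM : 0 < M) {f : ℝ → Lp ℝ 2 (leb M)}
    (hf : StronglyMeasurable f) :
    Measurable fun p : ℝ × ℝ => (Ioo 0 M).indicator (logPrimitive M (f p.1)) p.2 := by
  -- truncation near `0` gives functions that are measurable in `t` and continuous in `x`
  let c : ℕ → ℝ → ℝ := fun n x => max (M / (n + 1)) (min x M)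
  have hc : ∀ n x, c n x ∈ Ioc 0 M := fun n x =>
    ⟨(div_pos hM (by positivity)).trans_le (le_max_left _ _),
      max_le (div_le_self hM.le (by linarith [(Nat.cast_nonneg n : (0 : ℝ) ≤ n)]))
        (min_le_right _ _)⟩
  let G : ℕ → ℝ × ℝ → ℝ := fun n p =>
    (Ioo 0 M).indicator (fun _ => logPrimitive M (f p.1) (c n p.2)) p.2
  have hG : ∀ n, Measurable (G n) := by
    intro n
    have h1 : StronglyMeasurable (Function.uncurry fun x t => logPrimitive M (f t) (c n x)) := by
      refine stronglyMeasurable_uncurry_of_continuous_of_stronglyMeasurable (fun t => ?_)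
        fun x => ?_
      · refine (continuousOn_logPrimitive (integrable_coeFn_leb (f t))).comp_continuous ?_ (hc n)
        exact continuous_const.max (continuous_id.min continuous_const)
      · exact (evalCLM (hc n x)).continuous.comp_stronglyMeasurable hf
    have h2 : Measurable fun p : ℝ × ℝ => logPrimitive M (f p.1) (c n p.2) :=
      h1.measurable.comp measurable_swap
    have h3 : G n = (Prod.snd ⁻¹' Ioo 0 M).indicator
        fun p : ℝ × ℝ => logPrimitive M (f p.1) (c n p.2) := by
      ext p
      by_cases hp : p.2 ∈ Ioo 0 M
      · rw [indicator_of_mem (show p ∈ Prod.snd ⁻¹' Ioo 0 M from hp)]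
        exact indicator_of_mem hp _
      · rw [indicator_of_notMem (show p ∉ Prod.snd ⁻¹' Ioo 0 M from hp)]
        exact indicator_of_notMem hp _
    rw [h3]
    exact h2.indicator (measurable_snd measurableSet_Ioo)
  refine measurable_of_tendsto_metrizable hG (tendsto_pi_nhds.2 fun p => ?_)
  by_cases hp : p.2 ∈ Ioo 0 M
  · refine tendsto_const_nhds.congr' ?_
    obtain ⟨N, hN⟩ := exists_nat_gt (M / p.2)
    filter_upwards [eventually_ge_atTop N] with n hn
    have hle : M / (n + 1) ≤ p.2 := by
      have h1 : (N : ℝ) ≤ n := Nat.cast_le.2 hn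
      rw [div_lt_iff₀ hp.1] at hN
      rw [div_le_iff₀ (by positivity)]
      nlinarith [hp.1]
    simp only [G, indicator_of_mem hp, c, min_eq_left hp.2.le, max_eq_right hle]
  · simp only [G, indicator_of_notMem hp]
    exact tendsto_const_nhds

/-- A measurable family in `L²` has jointly measurable representatives (of `f` and of its
primitive), obtained by differentiating the primitive. -/
theorem exists_joint_representative [SFinite lam] (hM : 0 < M) {f : ℝ → Lp ℝ 2 (leb M)}
    (hf : AEStronglyMeasurable f lam) :
    ∃ g : ℝ → ℝ → ℝ, (∀ t, (fun x => x * g t x) =ᵐ[leb M] f t) ∧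
      AEStronglyMeasurable (fun p : ℝ × ℝ => p.2 * g p.1 p.2) (lam.prod (leb M)) ∧
      AEStronglyMeasurable (fun p : ℝ × ℝ => logPrimitive M (f p.1) p.2) (lam.prod (leb M)) := by
  classical
  let F := hf.mk f
  have hF : StronglyMeasurable F := hf.stronglyMeasurable_mk
  have hfF : ∀ᵐ p ∂(lam.prod (leb M)), f p.1 = F p.1 :=
    Measure.quasiMeasurePreserving_fst.ae hf.ae_eq_mk
  have hmem : ∀ᵐ p ∂(lam.prod (leb M)), p.2 ∈ Ioo 0 M :=
    Measure.quasiMeasurePreserving_snd.ae ae_leb_mem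
  let U : ℝ × ℝ → ℝ := fun p => (Ioo 0 M).indicator (logPrimitive M (F p.1)) p.2
  have hU : Measurable U := measurable_uncurry_logPrimitive hM hF
  let G : ℝ × ℝ → ℝ := fun p => limsup (fun n : ℕ =>
    (1 / ((n : ℝ) + 1))⁻¹ * (U (p.1, p.2 + 1 / ((n : ℝ) + 1)) - U p)) atTop
  have hG : Measurable G := Measurable.limsup fun n => measurable_const.mul
    ((hU.comp (measurable_fst.prodMk (measurable_snd.add_const _))).sub hU)
  have hGF : ∀ t, ∀ᵐ x ∂(leb M), x * G (t, x) = F t x := by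
    intro t
    filter_upwards [ae_leb_mem, ae_leb_iff.2
      (ae_hasDerivAt_logPrimitive (integrable_coeFn_leb (F t)))] with x hx hd
    have h1 : HasDerivAt (fun y => U (t, y)) (F t x / x) x := by
      refine hd.congr_of_eventuallyEq ?_
      filter_upwards [isOpen_Ioo.mem_nhds hx] with y hy
      exact indicator_of_mem hy _
    have h2 : Tendsto (fun n : ℕ => 1 / ((n : ℝ) + 1)) atTop (𝓝[≠] 0) :=
      tendsto_nhdsWithin_iff.2 ⟨tendsto_one_div_add_atTop_nhds_zero_nat,
        Eventually.of_forall fun n => Nat.one_div_pos_of_nat.ne'⟩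
    have h3 : G (t, x) = F t x / x := (h1.tendsto_slope_zero.comp h2).limsup_eq
    rw [h3, mul_div_cancel₀ _ hx.1.ne']
  refine ⟨fun t x => if f t = F t then G (t, x) else f t x / x, fun t => ?_, ?_, ?_⟩
  · by_cases h : f t = F t
    · simp only [if_pos h]
      rw [h]
      exact hGF t
    · simp only [if_neg h]
      filter_upwards [ae_leb_mem] with x hx
      rw [mul_div_cancel₀ _ hx.1.ne']
  · refine AEStronglyMeasurable.congr (f := fun p => p.2 * G p)
      (measurable_snd.mul hG).aestronglyMeasurable ?_
    filter_upwards [hfF] with p hp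
    rw [if_pos hp]
  · refine hU.aestronglyMeasurable.congr ?_
    filter_upwards [hfF, hmem] with p hp hp'
    simp only [U, indicator_of_mem hp', hp]

theorem enorm_rpow_eq_lintegral (f : Lp ℝ 2 (leb M)) {w : ℝ → ℝ} (hw : w =ᵐ[leb M] f) :
    ‖f‖ₑ ^ (2 : ℝ≥0∞).toReal = ∫⁻ x, ‖w x‖ₑ ^ (2 : ℝ≥0∞).toReal ∂(leb M) := by
  rw [Lp.enorm_def, ← eLpNorm_congr_ae hw,
    eLpNorm_eq_lintegral_rpow_enorm_toReal two_ne_zero ENNReal.ofNat_ne_top, ← ENNReal.rpow_mul,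
    one_div, inv_mul_cancel₀ (by norm_num), ENNReal.rpow_one]

/-- Fubini's theorem for square integrable functions of `(t, x)` seen as families in `L²`. -/
theorem eLpNorm_prod_lt_top_iff {w : ℝ → ℝ → ℝ} {f : ℝ → Lp ℝ 2 (leb M)}
    (hw : AEStronglyMeasurable (fun p : ℝ × ℝ => w p.1 p.2) (lam.prod (leb M)))
    (hwf : ∀ᵐ t ∂lam, w t =ᵐ[leb M] f t) :
    eLpNorm (fun p : ℝ × ℝ => w p.1 p.2) 2 (lam.prod (leb M)) < ⊤ ↔ eLpNorm f 2 lam < ⊤ := by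
  rw [eLpNorm_lt_top_iff_lintegral_rpow_enorm_lt_top two_ne_zero ENNReal.ofNat_ne_top,
    eLpNorm_lt_top_iff_lintegral_rpow_enorm_lt_top two_ne_zero ENNReal.ofNat_ne_top,
    lintegral_prod _ (hw.enorm.pow_const _),
    lintegral_congr_ae (hwf.mono fun t ht => enorm_rpow_eq_lintegral (f t) ht)]

theorem memLp_prod {w : ℝ → ℝ → ℝ} {f : ℝ → Lp ℝ 2 (leb M)}
    (hw : AEStronglyMeasurable (fun p : ℝ × ℝ => w p.1 p.2) (lam.prod (leb M)))
    (hwf : ∀ᵐ t ∂lam, w t =ᵐ[leb M] f t) (hf : MemLp f 2 lam) :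
    MemLp (fun p : ℝ × ℝ => w p.1 p.2) 2 (lam.prod (leb M)) :=
  ⟨hw, (eLpNorm_prod_lt_top_iff hw hwf).2 hf.2⟩

theorem memLp_of_memLp_prod {w : ℝ → ℝ → ℝ} {f : ℝ → Lp ℝ 2 (leb M)}
    (hw : MemLp (fun p : ℝ × ℝ => w p.1 p.2) 2 (lam.prod (leb M)))
    (hwf : ∀ᵐ t ∂lam, w t =ᵐ[leb M] f t) : MemLp f 2 lam := by
  refine ⟨aestronglyMeasurable_of_forall_inner fun g => ?_,
    (eLpNorm_prod_lt_top_iff hw.1 hwf).1 hw.2⟩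
  have h1 : AEStronglyMeasurable (fun p : ℝ × ℝ => w p.1 p.2 * g p.2) (lam.prod (leb M)) :=
    hw.1.mul (Lp.aestronglyMeasurable g).comp_snd
  refine h1.integral_prod_right'.congr ?_
  filter_upwards [hwf] with t ht
  rw [L2.inner_def]
  refine integral_congr_ae ?_
  filter_upwards [ht] with x hx
  simp only [RCLike.inner_apply, conj_trivial, hx]
  ring

end





/-! ### Weak solutions as solutions of the implicit system -/

section

variable {M σlow σup Cσ R T : ℝ} {σ : ℝ → ℝ → ℝ} {r : ℝ → ℝ}
  {J : Lp ℝ 2 (leb M) →L[ℝ] Lp ℝ 2 (leb M)} {μ : Measure ℝ}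
  {K : Lp ℝ 2 (leb M) →L[ℝ] Lp ℝ 2 (μ.restrict (Ico 0 M))}

/-- The Black–Scholes form in terms of `f = x ∂ₓu` and of the test vector `x ∂ₓv`. -/
theorem Coefficients.bsForm_eq_inner (Q : Coefficients M σlow σup Cσ R) (hQ : Q.Extends T σ r)
    (hJ : ∀ f, J f =ᵐ[leb M] logPrimitive M f) {t : ℝ} (ht : t ∈ Icc 0 T) {u g : ℝ → ℝ}
    {f : Lp ℝ 2 (leb M)} (hg : (fun x => x * g x) =ᵐ[leb M] f)
    (hu : ∀ x ∈ Ioo 0 M, u x = logPrimitive M f x) {v : ℝ → ℝ} (hv : IsTest M v) :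
    bsForm M σ r t u g v (deriv v) = ⟪Q.formOp J t f, testVector hv⟫ := by
  obtain ⟨hr, hs⟩ := hQ t ht
  have hJv : ∀ᵐ x ∂(leb M), J (testVector hv) x = v x := by
    filter_upwards [hJ (testVector hv), ae_leb_mem] with x h1 h2
    rw [h1, logPrimitive_testVector hv h2]
  have hJf : ∀ᵐ x ∂(leb M), J f x = u x := by
    filter_upwards [hJ f, ae_leb_mem] with x h1 h2
    rw [h1, hu x h2]
  rw [Q.inner_formOp, IsMultiplier.inner_op, IsMultiplier.inner_op, IsMultiplier.inner_op, bsForm,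
    add_assoc]
  congr 1
  · refine integral_congr_ae ?_
    filter_upwards [ae_leb_mem, hg, coeFn_testVector hv] with x hx h1 h2
    rw [h2, ← h1, (hs x hx).1]
    ring
  · congr 1
    · refine integral_congr_ae ?_
      filter_upwards [ae_leb_mem, hg, hJv] with x hx h1 h2
      rw [h2, ← h1, (hs x hx).1, (hs x hx).2, hr]
      ring
    · refine integral_congr_ae ?_
      filter_upwards [hJv, hJf] with x h1 h2
      rw [h1, h2, hr]

theorem integral_mul_eq_inner_embedding (hν : ∀ᵐ x ∂(μ.restrict (Ico 0 M)), x ∈ Ioo 0 M)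
    (hK : ∀ f, K f =ᵐ[μ.restrict (Ico 0 M)] logPrimitive M f) {u : ℝ → ℝ} {f : Lp ℝ 2 (leb M)}
    (hu : ∀ x ∈ Ioo 0 M, u x = logPrimitive M f x) {v : ℝ → ℝ} (hv : IsTest M v) :
    ∫ x in Ico 0 M, u x * v x ∂μ = ⟪K f, K (testVector hv)⟫ := by
  rw [L2.inner_def]
  refine integral_congr_ae ?_
  filter_upwards [hν, hK f, hK (testVector hv)] with x h1 h2 h3
  simp only [RCLike.inner_apply, conj_trivial]
  rw [h2, h3, hu x h1, logPrimitive_testVector hv h1]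
  ring

theorem Coefficients.intervalIntegrable_formOp (Q : Coefficients M σlow σup Cσ R)
    {f : ℝ → Lp ℝ 2 (leb M)} (hf : MemLp f 2 (volume.restrict (Ioc 0 T))) {t : ℝ}
    (ht : t ∈ Icc 0 T) : IntervalIntegrable (fun s => Q.formOp J s (f s)) volume t T := by
  have h1 : MemLp (fun s => Q.formOp J s (f s)) 2 (volume.restrict (Ioc 0 T)) :=
    hf.of_le_mul (aestronglyMeasurable_apply Q.stronglyMeasurable_formOp hf.1)
      (Eventually.of_forall fun s => Q.norm_formOp_le J s (f s))
  refine (intervalIntegrable_iff_integrableOn_Ioc_of_le ht.2).2 ?_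
  have h2 : IntegrableOn (fun s => Q.formOp J s (f s)) (Ioc 0 T) := h1.integrable (by norm_num)
  exact h2.mono_set (Ioc_subset_Ioc_left ht.1)

theorem integral_bsForm_eq (Q : Coefficients M σlow σup Cσ R) (hQ : Q.Extends T σ r)
    (hJ : ∀ f, J f =ᵐ[leb M] logPrimitive M f) {u g : ℝ → ℝ → ℝ} {f : ℝ → Lp ℝ 2 (leb M)}
    (hf : MemLp f 2 (volume.restrict (Ioc 0 T)))
    (hg : ∀ t ∈ Icc 0 T, (fun x => x * g t x) =ᵐ[leb M] f t)
    (hu : ∀ t ∈ Icc 0 T, ∀ x ∈ Ioo 0 M, u t x = logPrimitive M (f t) x)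
    {v : ℝ → ℝ} (hv : IsTest M v) {t : ℝ} (ht : t ∈ Icc 0 T) :
    ∫ s in t..T, bsForm M σ r s (u s) (g s) v (deriv v)
      = ⟪∫ s in t..T, Q.formOp J s (f s), testVector hv⟫ := by
  have hi := (intervalIntegrable_iff_integrableOn_Ioc_of_le ht.2).1
    (Q.intervalIntegrable_formOp (J := J) hf ht)
  rw [intervalIntegral.integral_of_le ht.2, intervalIntegral.integral_of_le ht.2, real_inner_comm,
    ← integral_inner hi]
  refine setIntegral_congr_fun measurableSet_Ioc fun s hs => ?_
  have hs' : s ∈ Icc 0 T := ⟨ht.1.trans hs.1.le, hs.2⟩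
  rw [real_inner_comm, Q.bsForm_eq_inner hQ hJ hs' (hg s hs') (hu s hs') hv]

/-- The element `x ∂ₓv` of `L²` that represents `v ∈ V_𝓜`. -/
noncomputable def HasVDeriv.toVector {v g : ℝ → ℝ} (h : HasVDeriv M v g) : Lp ℝ 2 (leb M) :=
  h.memLp_deriv.toLp

theorem HasVDeriv.coeFn_toVector {v g : ℝ → ℝ} (h : HasVDeriv M v g) :
    h.toVector =ᵐ[leb M] fun x => x * g x := h.memLp_deriv.coeFn_toLp

theorem HasVDeriv.eq_logPrimitive_toVector (hM : 0 < M) {v g : ℝ → ℝ} (h : HasVDeriv M v g)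
    {x : ℝ} (hx : x ∈ Ioo 0 M) : v x = logPrimitive M h.toVector x := by
  rw [logPrimitive_congr h.coeFn_toVector (Ioo_subset_Ioc_self hx)]
  exact h.eq_logPrimitive hM hx

/-- A solution `f` of the implicit equation gives the weak solution `u` with `x ∂ₓu = f`. -/
theorem isWeakSolution_logPrimitive (hM : 0 < M) (Q : Coefficients M σlow σup Cσ R)
    (hQ : Q.Extends T σ r) (hJ : ∀ f, J f =ᵐ[leb M] logPrimitive M f)
    (hν : ∀ᵐ x ∂(μ.restrict (Ico 0 M)), x ∈ Ioo 0 M)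
    (hK : ∀ f, K f =ᵐ[μ.restrict (Ico 0 M)] logPrimitive M f) {h h' : ℝ → ℝ}
    (hh : HasVDeriv M h h') {f : ℝ → Lp ℝ 2 (leb M)}
    (hf : MemLp f 2 (volume.restrict (Ioc 0 T))) (hfT : f T = hh.toVector)
    (hsol : ∀ t ∈ Icc 0 T, ∀ v, ⟪K (f t), K v⟫
      = ⟪K hh.toVector, K v⟫ - ⟪∫ s in t..T, Q.formOp J s (f s), v⟫) :
    IsWeakSolution M T σ r h μ fun t x => logPrimitive M (f t) x := by
  have hf' : MemLp f 2 (volume.restrict (Icc 0 T)) := by rwa [← restrict_Ioc_eq_restrict_Icc]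
  obtain ⟨g, hg, hg1, hg2⟩ := exists_joint_representative hM hf'.1
  refine ⟨fun x hx => ?_, g, fun t _ => ?_, ?_, ?_, fun v hv t ht => ?_⟩
  · rw [hfT, hh.eq_logPrimitive_toVector hM hx]
  · exact hasVDeriv_logPrimitive hM (Lp.memLp (f t)) ((Lp.memLp (J (f t))).ae_eq (hJ _))
      (fun x _ => rfl) (hg t)
  · exact memLp_prod (f := fun t => J (f t)) hg2 (Eventually.of_forall fun t => (hJ (f t)).symm)
      (J.comp_memLp' hf')
  · exact memLp_prod (w := fun t x => x * g t x) hg1 (Eventually.of_forall hg) hf'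
  · rw [integral_bsForm_eq Q hQ hJ hf (fun t _ => hg t) (fun t _ x _ => rfl) hv ht,
      integral_mul_eq_inner_embedding hν hK (fun x hx => hh.eq_logPrimitive_toVector hM hx) hv,
      integral_mul_eq_inner_embedding hν hK (fun x _ => rfl) hv, hsol t ht]
    ring

open Classical in
/-- Every weak solution `u` comes from the solution `f = x ∂ₓu` of the implicit equation. -/
theorem IsWeakSolution.exists_vector (hM : 0 < M) (Q : Coefficients M σlow σup Cσ R)
    (hQ : Q.Extends T σ r) (hJ : ∀ f, J f =ᵐ[leb M] logPrimitive M f)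
    (hν : ∀ᵐ x ∂(μ.restrict (Ico 0 M)), x ∈ Ioo 0 M)
    (hK : ∀ f, K f =ᵐ[μ.restrict (Ico 0 M)] logPrimitive M f) {h h' : ℝ → ℝ}
    (hh : HasVDeriv M h h') {u : ℝ → ℝ → ℝ} (hu : IsWeakSolution M T σ r h μ u) :
    ∃ f : ℝ → Lp ℝ 2 (leb M), MemLp f 2 (volume.restrict (Ioc 0 T)) ∧
      (∀ t ∈ Icc 0 T, ∀ v, ⟪K (f t), K v⟫
        = ⟪K hh.toVector, K v⟫ - ⟪∫ s in t..T, Q.formOp J s (f s), v⟫) ∧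
      ∀ t ∈ Icc 0 T, ∀ x ∈ Ioo 0 M, u t x = logPrimitive M (f t) x := by
  obtain ⟨-, g, hV, -, hg, heq⟩ := hu
  let f : ℝ → Lp ℝ 2 (leb M) := fun t => if ht : t ∈ Icc 0 T then (hV t ht).toVector else 0
  have hft : ∀ t (ht : t ∈ Icc 0 T), f t = (hV t ht).toVector := fun t ht => dif_pos ht
  have hgf : ∀ t ∈ Icc 0 T, (fun x => x * g t x) =ᵐ[leb M] f t := fun t ht => by
    rw [hft t ht]
    exact (hV t ht).coeFn_toVector.symm
  have huf : ∀ t ∈ Icc 0 T, ∀ x ∈ Ioo 0 M, u t x = logPrimitive M (f t) x := fun t ht x hx => by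
    rw [hft t ht, (hV t ht).eq_logPrimitive_toVector hM hx]
  have hf : MemLp f 2 (volume.restrict (Ioc 0 T)) := by
    rw [restrict_Ioc_eq_restrict_Icc]
    refine memLp_of_memLp_prod (w := fun t x => x * g t x) hg ?_
    filter_upwards [ae_restrict_mem measurableSet_Icc] with t ht
    exact hgf t ht
  refine ⟨f, hf, fun t ht v => ?_, huf⟩
  -- both sides are continuous in `v`, and test functions are dense
  have hcl : IsClosed {v | ⟪K (f t), K v⟫
      = ⟪K hh.toVector, K v⟫ - ⟪∫ s in t..T, Q.formOp J s (f s), v⟫} :=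
    isClosed_eq (by fun_prop) (by fun_prop)
  refine hcl.closure_subset_iff.2 ?_ (dense_testVector hM v)
  rintro _ ⟨φ, hφ, rfl⟩
  have h1 := heq φ hφ.isTest t ht
  rw [integral_bsForm_eq Q hQ hJ hf hgf huf hφ.isTest ht,
    integral_mul_eq_inner_embedding hν hK (fun x hx => hh.eq_logPrimitive_toVector hM hx) hφ.isTest,
    integral_mul_eq_inner_embedding hν hK (huf t ht) hφ.isTest] at h1
  show ⟪K (f t), K _⟫ = _
  linarith

end

/-! ### Admissible measures -/

section

variable {M C₀ C₁ : ℝ}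

theorem ae_mem_Ioo_of_mem_admissible (hM : 0 < M) {μ : FiniteMeasure ℝ}
    (hμ : μ ∈ admissible M C₀ C₁) :
    ∀ᵐ x ∂((μ : Measure ℝ).restrict (Ico 0 M)), x ∈ Ioo 0 M := by
  have h0 : (μ : Measure ℝ).restrict (Ico 0 M) {0} = 0 :=
    measure_singleton_zero_eq_zero hM fun φ hφ => (hμ.2.2 φ hφ).1
  have h1 : ∀ᵐ x ∂((μ : Measure ℝ).restrict (Ico 0 M)), x ≠ 0 := by
    rw [ae_iff]
    simpa using h0
  filter_upwards [h1, ae_restrict_mem measurableSet_Ico] with x h1 h2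
  exact ⟨lt_of_le_of_ne h2.1 (Ne.symm h1), h2.2⟩

/-- The embedding of `V_𝓜` into `L²`; its continuity follows from the existence of one admissible
measure, by composing the two defining inequalities. -/
theorem exists_embedding_leb (hM : 0 < M) (hC₀ : 0 < C₀) (hC₁ : 0 < C₁)
    (hne : (admissible M C₀ C₁).Nonempty) :
    ∃ J : Lp ℝ 2 (leb M) →L[ℝ] Lp ℝ 2 (leb M), ∀ f, J f =ᵐ[leb M] logPrimitive M f := by
  obtain ⟨μ, hμ⟩ := hne
  have h0 : leb M (Ioo 0 M)ᶜ = 0 := ae_iff.1 ae_leb_mem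
  obtain ⟨J, hJ, -⟩ := exists_embedding hM h0 (mul_pos hC₁ hC₀).le fun φ hφ => by
    obtain ⟨h1, h2⟩ := hμ.2.2 φ hφ.isTest
    rw [ENNReal.ofReal_mul hC₁.le, mul_assoc]
    exact h2.trans (mul_le_mul_right h1 _)
  exact ⟨J, hJ⟩

theorem exists_embedding_of_mem_admissible (hM : 0 < M) (hC₀ : 0 < C₀) (hC₁ : 0 < C₁)
    {J : Lp ℝ 2 (leb M) →L[ℝ] Lp ℝ 2 (leb M)} (hJ : ∀ f, J f =ᵐ[leb M] logPrimitive M f)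
    {μ : FiniteMeasure ℝ} (hμ : μ ∈ admissible M C₀ C₁) :
    ∃ K : Lp ℝ 2 (leb M) →L[ℝ] Lp ℝ 2 ((μ : Measure ℝ).restrict (Ico 0 M)),
      (∀ f, K f =ᵐ[(μ : Measure ℝ).restrict (Ico 0 M)] logPrimitive M f) ∧
      (∀ f, ‖K f‖ ≤ C₀ * ‖f‖) ∧ ∀ f, ‖J f‖ ≤ C₁ * ‖K f‖ := by
  have hν := ae_mem_Ioo_of_mem_admissible hM hμ
  obtain ⟨K, hK, hKb⟩ := exists_embedding hM (ae_iff.1 hν) hC₀.le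
    fun φ hφ => (hμ.2.2 φ hφ.isTest).1
  exact ⟨K, hK, hKb, norm_embedding_le hM hC₁.le hν ae_leb_mem hK hJ
    fun φ hφ => (hμ.2.2 φ hφ.isTest).2⟩

end





/-! ### Compactness of the set of admissible measures -/

section

variable {M C₀ C₁ : ℝ}

theorem tvNorm_eq_of_mem_admissible (hM : 0 < M) {μ : FiniteMeasure ℝ}
    (hμ : μ ∈ admissible M C₀ C₁) : tvNorm μ = M := by
  have h : (μ : Measure ℝ).toSignedMeasure.toJordanDecomposition
      = ⟨μ, 0, Measure.MutuallySingular.zero_right⟩ := by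
    refine SignedMeasure.toJordanDecomposition_eq ?_
    simp [JordanDecomposition.toSignedMeasure]
  have h1 : (μ : Measure ℝ) univ = ENNReal.ofReal M := by
    rw [← hμ.2.1, ← measure_add_measure_compl (s := Icc 0 M) measurableSet_Icc, hμ.1, add_zero]
  rw [tvNorm, SignedMeasure.totalVariation, h]
  simp only [add_zero]
  rw [h1, ENNReal.toReal_ofReal hM.le]

theorem IsTest.exists_boundedContinuousFunction {φ : ℝ → ℝ} (hφ : IsTest M φ) :
    ∃ ψ : BoundedContinuousFunction ℝ ℝ, ∀ x, ψ x = φ x := by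
  obtain ⟨C, hC⟩ := hφ.2.1.exists_bound_of_continuous hφ.1.continuous
  exact ⟨BoundedContinuousFunction.ofNormedAddCommGroup φ hφ.1.continuous C hC, fun _ => rfl⟩

/-- As test functions vanish at `M`, their `L²_μ` norms depend continuously on `μ`. -/
theorem IsTest.exists_continuous_eLpNorm {φ : ℝ → ℝ} (hφ : IsTest M φ) :
    ∃ G : FiniteMeasure ℝ → ℝ≥0, Continuous G ∧ ∀ μ : FiniteMeasure ℝ,
      (μ : Measure ℝ) (Icc 0 M)ᶜ = 0 → eLpNorm φ 2 ((μ : Measure ℝ).restrict (Ico 0 M))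
        = (G μ : ℝ≥0∞) ^ (1 / (2 : ℝ≥0∞).toReal) := by
  obtain ⟨ψ, hψ⟩ := hφ.exists_boundedContinuousFunction
  have hφM : φ M = 0 := image_eq_zero_of_notMem_tsupport fun h => lt_irrefl M (hφ.2.2 h)
  refine ⟨_, FiniteMeasure.continuous_testAgainstNN_eval (ψ * ψ).nnnorm, fun μ hμ => ?_⟩
  rw [eLpNorm_eq_lintegral_rpow_enorm_toReal two_ne_zero ENNReal.ofNat_ne_top,
    FiniteMeasure.testAgainstNN_coe_eq, ← lintegral_indicator measurableSet_Ico]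
  congr 1
  refine lintegral_congr_ae ?_
  filter_upwards [show ∀ᵐ x ∂(μ : Measure ℝ), x ∈ Icc 0 M from ae_iff.2 hμ] with x hx
  have h1 : (((ψ * ψ).nnnorm x : ℝ≥0) : ℝ≥0∞) = ‖φ x‖ₑ ^ (2 : ℝ≥0∞).toReal := by
    simp [hψ, enorm_eq_nnnorm, sq]
  rw [h1]
  by_cases hxM : x = M
  · rw [indicator_of_notMem (by simp [hxM]), hxM, hφM]
    simp
  · rw [indicator_of_mem (show x ∈ Ico 0 M from ⟨hx.1, lt_of_le_of_ne hx.2 hxM⟩)]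

/-- **Prokhorov's theorem** on `[0, M]`; the mass condition and the defining inequalities are closed. -/
theorem isCompact_admissible (M C₀ C₁ : ℝ) : IsCompact (admissible M C₀ C₁) := by
  have hA := isCompact_setOfPred_finiteMeasure_le_of_isCompact (E := ℝ) M.toNNReal
    (isCompact_Icc (a := 0) (b := M))
  choose G hGc hG using fun (φ : ℝ → ℝ) (hφ : IsTest M φ) => hφ.exists_continuous_eLpNorm
  have hr : ∀ φ (hφ : IsTest M φ), Continuous fun μ : FiniteMeasure ℝ =>
      (G φ hφ μ : ℝ≥0∞) ^ (1 / (2 : ℝ≥0∞).toReal) := fun φ hφ =>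
    ENNReal.continuous_rpow_const.comp (ENNReal.continuous_coe.comp (hGc φ hφ))
  have hcl : IsClosed ({μ : FiniteMeasure ℝ | μ.mass = M.toNNReal} ∩
      ⋂ φ, ⋂ hφ : IsTest M φ, ({μ : FiniteMeasure ℝ | (G φ hφ μ : ℝ≥0∞) ^ (1 / (2 : ℝ≥0∞).toReal)
          ≤ ENNReal.ofReal C₀ * eLpNorm (fun x => x * deriv φ x) 2 (leb M)} ∩
        {μ : FiniteMeasure ℝ | eLpNorm φ 2 (leb M)
          ≤ ENNReal.ofReal C₁ * (G φ hφ μ : ℝ≥0∞) ^ (1 / (2 : ℝ≥0∞).toReal)})) := by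
    refine IsClosed.inter (isClosed_eq FiniteMeasure.continuous_mass continuous_const)
      (isClosed_iInter fun φ => isClosed_iInter fun hφ => ?_)
    exact (isClosed_le (hr φ hφ) continuous_const).inter (isClosed_le continuous_const
      ((ENNReal.continuous_const_mul ENNReal.ofReal_ne_top).comp (hr φ hφ)))
  convert hA.inter_right hcl using 1
  ext μ
  have hmass : (μ : Measure ℝ) (Icc 0 M)ᶜ = 0 →
      ((μ : Measure ℝ) (Icc 0 M) = ENNReal.ofReal M ↔ μ.mass = M.toNNReal) := by
    intro h0
    rw [← ENNReal.coe_inj, FiniteMeasure.ennreal_mass,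
      ← measure_add_measure_compl (μ := (μ : Measure ℝ)) (s := Icc 0 M) measurableSet_Icc, h0,
      add_zero]
    rfl
  have hnull : μ (Icc 0 M)ᶜ = 0 ↔ (μ : Measure ℝ) (Icc 0 M)ᶜ = 0 :=
    FiniteMeasure.null_iff_toMeasure_null _ _
  constructor
  · rintro ⟨h1, h2, h3⟩
    have hm := (hmass h1).1 h2
    refine ⟨⟨hm.le, hnull.2 h1⟩, hm, mem_iInter₂.2 fun φ hφ => ?_⟩
    have h4 := h3 φ hφ
    rwa [hG φ hφ μ h1] at h4
  · rintro ⟨⟨-, h1⟩, h2, h3⟩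
    have h1' := hnull.1 h1
    refine ⟨h1', (hmass h1').2 h2, fun φ hφ => ?_⟩
    rw [hG φ hφ μ h1']
    exact mem_iInter₂.1 h3 φ hφ

end

/-! ### Stability with respect to the measure -/

section

variable {M C₀ C₁ : ℝ}

theorem setIntegral_mul_test_eq {μ : Measure ℝ} {w φ : ℝ → ℝ} (hφ : IsInnerTest M φ) :
    ∫ x in Ico 0 M, w x * φ x ∂μ = ∫ x, w x * φ x ∂μ :=
  setIntegral_eq_integral_of_forall_compl_eq_zero fun x hx => by
    rw [image_eq_zero_of_notMem_tsupport fun h =>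
      hx (Ioo_subset_Ico_self (hφ.tsupport_subset h)), mul_zero]

theorem inner_embedding_testVector {μ : Measure ℝ}
    {K : Lp ℝ 2 (leb M) →L[ℝ] Lp ℝ 2 (μ.restrict (Ico 0 M))}
    (hν : ∀ᵐ x ∂(μ.restrict (Ico 0 M)), x ∈ Ioo 0 M)
    (hK : ∀ f, K f =ᵐ[μ.restrict (Ico 0 M)] logPrimitive M f) {φ : ℝ → ℝ} (hφ : IsInnerTest M φ)
    (f : Lp ℝ 2 (leb M)) :
    ⟪K f, K (testVector hφ.isTest)⟫ = ∫ x, logPrimitive M f x * φ x ∂μ := by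
  rw [← integral_mul_eq_inner_embedding hν hK (fun x _ => rfl) hφ.isTest,
    setIntegral_mul_test_eq hφ]

theorem IsInnerTest.continuous_logPrimitive_mul {φ : ℝ → ℝ} (hφ : IsInnerTest M φ)
    (f : Lp ℝ 2 (leb M)) : Continuous fun x => logPrimitive M f x * φ x := by
  refine ContinuousOn.continuous_of_tsupport_subset (s := Ioo 0 M) ?_ isOpen_Ioo
    (tsupport_mul_subset_right.trans hφ.tsupport_subset)
  exact ((continuousOn_logPrimitive (integrable_coeFn_leb f)).mono Ioo_subset_Ioc_self).mul
    hφ.contDiff.continuous.continuousOn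

theorem logPrimitive_sub_apply (f g : Lp ℝ 2 (leb M)) {x : ℝ} (hx : x ∈ Ioc 0 M) :
    logPrimitive M (f - g : Lp ℝ 2 (leb M)) x = logPrimitive M f x - logPrimitive M g x := by
  rw [← evalCLM_apply hx, map_sub, evalCLM_apply, evalCLM_apply]

/-- Weak convergence of `f i` to `0` implies locally uniform convergence of the primitives: by
Hölder continuity, the values at points where `|u i φ|` is maximal tend to zero. -/
theorem exists_bound_tendsto_zero (hM : 0 < M) {ι : Type*} (U : Ultrafilter ι) {φ : ℝ → ℝ}
    (hφ : IsInnerTest M φ) {f : ι → Lp ℝ 2 (leb M)} {C : ℝ} (hC : ∀ i, ‖f i‖ ≤ C)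
    (hf : ∀ v, Tendsto (fun i => ⟪f i, v⟫) U (𝓝 0)) :
    ∃ δ : ι → ℝ, Tendsto δ U (𝓝 0) ∧ ∀ i x, |logPrimitive M (f i) x * φ x| ≤ δ i := by
  obtain ⟨a, b, ha, hab, hb, hs⟩ := hφ.exists_Icc hM
  obtain ⟨B, hB⟩ := hφ.hasCompactSupport.exists_bound_of_continuous hφ.contDiff.continuous
  have hB0 : 0 ≤ B := (norm_nonneg _).trans (hB 0)
  have hmem : ∀ x ∈ Icc a b, x ∈ Ioc 0 M := fun x hx => ⟨ha.trans_le hx.1, hx.2.trans hb.le⟩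
  have hmax : ∀ i, ∃ y ∈ Icc a b, ∀ x ∈ Icc a b,
      |logPrimitive M (f i) x * φ x| ≤ |logPrimitive M (f i) y * φ y| := fun i =>
    isCompact_Icc.exists_isMaxOn ⟨a, le_rfl, hab⟩
      (hφ.continuous_logPrimitive_mul (f i)).abs.continuousOn
  choose y hy hymax using hmax
  obtain ⟨z, hz, hyz⟩ := isCompact_Icc.ultrafilter_le_nhds (U.map y)
    (le_principal_iff.2 (show y ⁻¹' Icc a b ∈ U from univ_mem' hy))
  have hyz' : Tendsto y U (𝓝 z) := hyz
  have hhol : ∀ i, |logPrimitive M (f i) (y i)|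
      ≤ |logPrimitive M (f i) z| + a⁻¹ * √|y i - z| * C := by
    intro i
    have h1 : |logPrimitive M (f i) (y i) - logPrimitive M (f i) z| ≤ a⁻¹ * √|y i - z| * ‖f i‖ := by
      rcases le_total (y i) z with h | h
      · rw [abs_sub_comm, abs_of_nonpos (sub_nonpos.2 h), neg_sub]
        refine (abs_logPrimitive_sub_le (f i) (hmem _ (hy i)).1 h (hmem _ hz).2).trans ?_
        gcongr
        exact (hy i).1
      · rw [abs_of_nonneg (sub_nonneg.2 h)]
        refine (abs_logPrimitive_sub_le (f i) (hmem _ hz).1 h (hmem _ (hy i)).2).trans ?_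
        gcongr
        exact hz.1
    have h2 := mul_le_mul_of_nonneg_left (hC i)
      (show 0 ≤ a⁻¹ * √|y i - z| by positivity)
    have h3 := abs_add_le (logPrimitive M (f i) (y i) - logPrimitive M (f i) z)
      (logPrimitive M (f i) z)
    rw [sub_add_cancel] at h3
    linarith
  refine ⟨fun i => (|logPrimitive M (f i) z| + a⁻¹ * √|y i - z| * C) * B, ?_, fun i x => ?_⟩
  · have h1 : Tendsto (fun i => logPrimitive M (f i) z) U (𝓝 0) := by
      have h := hf ((InnerProductSpace.toDual ℝ _).symm (evalCLM (hmem z hz)))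
      refine h.congr fun i => ?_
      rw [real_inner_comm, InnerProductSpace.toDual_symm_apply, evalCLM_apply]
    have h2 : Tendsto (fun i => √|y i - z|) U (𝓝 0) := by
      have h := ((hyz'.sub_const z).abs).sqrt
      simpa using h
    have h3 := ((h1.abs.add ((h2.const_mul a⁻¹).mul_const C)).mul_const B)
    simpa using h3
  · have h0 : 0 ≤ |logPrimitive M (f i) z| + a⁻¹ * √|y i - z| * C :=
      (abs_nonneg _).trans (hhol i)
    by_cases hx : x ∈ Icc a b
    · refine (hymax i x hx).trans ?_
      rw [abs_mul]
      exact mul_le_mul (hhol i) (hB (y i)) (abs_nonneg _) h0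
    · rw [image_eq_zero_of_notMem_tsupport fun h => hx (hs h), mul_zero, abs_zero]
      exact mul_nonneg h0 hB0

/-- Convergence of the forms `(f, g) ↦ ∫ u v dμ` along weakly convergent measures and weakly
convergent `f`. -/
theorem tendsto_inner_embedding (hM : 0 < M) {ι : Type*} (U : Ultrafilter ι)
    {m : ι → FiniteMeasure ℝ} {μ : FiniteMeasure ℝ} (hm : ∀ i, m i ∈ admissible M C₀ C₁)
    (hmU : Tendsto m U (𝓝 μ)) {φ : ℝ → ℝ}
    (hφ : IsInnerTest M φ) {f : ι → Lp ℝ 2 (leb M)} {g : Lp ℝ 2 (leb M)} {C : ℝ}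
    (hC : ∀ i, ‖f i‖ ≤ C) (hf : ∀ v, Tendsto (fun i => ⟪f i, v⟫) U (𝓝 ⟪g, v⟫)) :
    Tendsto (fun i => ∫ x, logPrimitive M (f i) x * φ x ∂(m i : Measure ℝ)) U
      (𝓝 (∫ x, logPrimitive M g x * φ x ∂(μ : Measure ℝ))) := by
  obtain ⟨δ, hδ, hfδ⟩ := exists_bound_tendsto_zero hM U hφ (f := fun i => f i - g) (C := C + ‖g‖)
    (fun i => (norm_sub_le _ _).trans (add_le_add (hC i) le_rfl)) (fun v => by
      have h := (hf v).sub_const ⟪g, v⟫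
      rw [sub_self] at h
      refine h.congr fun i => ?_
      rw [inner_sub_left])
  have hbdd : ∀ w : Lp ℝ 2 (leb M), ∃ ψ : BoundedContinuousFunction ℝ ℝ,
      ∀ x, ψ x = logPrimitive M w x * φ x := fun w => by
    have hc := hφ.continuous_logPrimitive_mul w
    obtain ⟨B, hB⟩ :=
      (hφ.hasCompactSupport.mul_left (f := logPrimitive M w)).exists_bound_of_continuous hc
    exact ⟨BoundedContinuousFunction.ofNormedAddCommGroup _ hc B hB, fun _ => rfl⟩
  have hint : ∀ (w : Lp ℝ 2 (leb M)) (ν : FiniteMeasure ℝ),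
      Integrable (fun x => logPrimitive M w x * φ x) (ν : Measure ℝ) := fun w ν => by
    obtain ⟨ψ, hψ⟩ := hbdd w
    exact (ψ.integrable (ν : Measure ℝ)).congr (Eventually.of_forall hψ)
  have h1 : Tendsto (fun i => ∫ x, logPrimitive M g x * φ x ∂(m i : Measure ℝ)) U
      (𝓝 (∫ x, logPrimitive M g x * φ x ∂(μ : Measure ℝ))) := by
    obtain ⟨ψ, hψ⟩ := hbdd g
    simpa only [hψ] using FiniteMeasure.tendsto_iff_forall_integral_tendsto.1 hmU ψ
  have h2 : Tendsto (fun i => ∫ x, logPrimitive M (f i - g : Lp ℝ 2 (leb M)) x * φ x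
      ∂(m i : Measure ℝ)) U (𝓝 0) := by
    have hδM : Tendsto (fun i => δ i * M) U (𝓝 0) := by simpa using hδ.mul_const M
    refine squeeze_zero_norm (fun i => ?_) hδM
    have h3 := norm_integral_le_of_norm_le_const (μ := (m i : Measure ℝ))
      (f := fun x => logPrimitive M (f i - g : Lp ℝ 2 (leb M)) x * φ x)
      (Eventually.of_forall fun x => hfδ i x)
    refine h3.trans_eq ?_
    congr 1
    have h4 : (m i : Measure ℝ) univ = ENNReal.ofReal M := by
      rw [← (hm i).2.1, ← measure_add_measure_compl (s := Icc 0 M) measurableSet_Icc, (hm i).1,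
        add_zero]
    rw [measureReal_def, h4, ENNReal.toReal_ofReal hM.le]
  have h3 := h2.add h1
  rw [zero_add] at h3
  refine h3.congr fun i => ?_
  rw [← integral_add (hint _ _) (hint _ _)]
  refine integral_congr_ae (Eventually.of_forall fun x => ?_)
  by_cases hx : x ∈ Ioo 0 M
  · simp only
    rw [logPrimitive_sub_apply _ _ (Ioo_subset_Ioc_self hx)]
    ring
  · simp only
    rw [image_eq_zero_of_notMem_tsupport fun h => hx (hφ.tsupport_subset h)]
    ring

end





/-! ### Lower semicontinuity -/

theorem lowerSemicontinuous_of_forall_ultrafilter {X : Type*} [TopologicalSpace X] {F : X → ℝ}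
    (h : ∀ (U : Ultrafilter X) (x : X) (y : ℝ), (U : Filter X) ≤ 𝓝 x → (∀ᶠ z in U, F z ≤ y) →
      F x ≤ y) : LowerSemicontinuous F := by
  intro x y hy
  by_contra hcon
  have hfr : ∃ᶠ z in 𝓝 x, F z ≤ y := by
    simpa only [Filter.Frequently, not_le] using hcon
  have hNe : (𝓝 x ⊓ 𝓟 {z : X | F z ≤ y}).NeBot := frequently_mem_iff_neBot.1 hfr
  have hU := Ultrafilter.of_le (𝓝 x ⊓ 𝓟 {z : X | F z ≤ y})
  exact absurd (h _ x y (hU.trans inf_le_left) (le_principal_iff.1 (hU.trans inf_le_right)))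
    (not_le.2 hy)

/-- Weak lower semicontinuity of `x ↦ ‖J x - e‖` along an ultrafilter. -/
theorem norm_sub_le_of_tendsto_inner {ι W V : Type*} [NormedAddCommGroup W]
    [InnerProductSpace ℝ W] [CompleteSpace W] [NormedAddCommGroup V] [InnerProductSpace ℝ V]
    [CompleteSpace V] (J : W →L[ℝ] V) (U : Ultrafilter ι) {x : ι → W} {x₀ : W} {e : V} {y : ℝ}
    (hx : ∀ v, Tendsto (fun i => ⟪x i, v⟫) U (𝓝 ⟪x₀, v⟫)) (hy : ∀ᶠ i in U, ‖J (x i) - e‖ ≤ y) :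
    ‖J x₀ - e‖ ≤ y := by
  obtain ⟨i, hi⟩ := hy.exists
  have hy0 : 0 ≤ y := (norm_nonneg _).trans hi
  generalize hz : J x₀ - e = z
  have hlim : Tendsto (fun i => ⟪J (x i) - e, z⟫) U (𝓝 ⟪z, z⟫) := by
    have h1 := (hx (J.adjoint z)).sub_const ⟪e, z⟫
    rw [ContinuousLinearMap.adjoint_inner_right, ← inner_sub_left, hz] at h1
    refine h1.congr fun i => ?_
    rw [ContinuousLinearMap.adjoint_inner_right, ← inner_sub_left]
  have hle : ⟪z, z⟫ ≤ y * ‖z‖ := by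
    refine le_of_tendsto hlim (hy.mono fun i hi => ?_)
    exact (real_inner_le_norm _ _).trans (mul_le_mul_of_nonneg_right hi (norm_nonneg _))
  rw [real_inner_self_eq_norm_sq] at hle
  by_contra h
  nlinarith [norm_nonneg z, not_le.1 h]

/-! ### Well-posedness and minimisation -/

section

variable {M σlow σup Cσ R T C₀ C₁ : ℝ} {σ : ℝ → ℝ → ℝ} {r : ℝ → ℝ}
  {J : Lp ℝ 2 (leb M) →L[ℝ] Lp ℝ 2 (leb M)} {h h' : ℝ → ℝ}

/-- The weak solution for an admissible measure, in terms of `f = x ∂ₓu`, is unique. -/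
theorem IsWeakSolution.eq_logPrimitive (hM : 0 < M) (hC₁ : 0 < C₁)
    (Q : Coefficients M σlow σup Cσ R) (hQ : Q.Extends T σ r)
    (hJ : ∀ f, J f =ᵐ[leb M] logPrimitive M f) {μ : FiniteMeasure ℝ}
    (hν : ∀ᵐ x ∂((μ : Measure ℝ).restrict (Ico 0 M)), x ∈ Ioo 0 M)
    {K : Lp ℝ 2 (leb M) →L[ℝ] Lp ℝ 2 ((μ : Measure ℝ).restrict (Ico 0 M))}
    (hK : ∀ f, K f =ᵐ[(μ : Measure ℝ).restrict (Ico 0 M)] logPrimitive M f)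
    (hKb : ∀ f, ‖K f‖ ≤ C₀ * ‖f‖) (hJK : ∀ f, ‖J f‖ ≤ C₁ * ‖K f‖)
    (hh : HasVDeriv M h h') {f : ℝ → Lp ℝ 2 (leb M)}
    (hf : MemLp f 2 (volume.restrict (Ioc 0 T)))
    (hsol : ∀ t ∈ Icc 0 T, (Q.system hM hC₁ hJ hν hK hKb hJK).SolvesAt T hh.toVector f t (f t))
    {u : ℝ → ℝ → ℝ} (hu : IsWeakSolution M T σ r h μ u) {t : ℝ} (ht : t ∈ Icc 0 T) {x : ℝ}
    (hx : x ∈ Ioo 0 M) : u t x = logPrimitive M (f t) x := by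
  obtain ⟨f', hf', hsol', huf'⟩ := hu.exists_vector hM Q hQ hJ hν hK hh
  rw [huf' t ht x hx,
    (Q.system hM hC₁ hJ hν hK hKb hJK).solution_unique hf hf' hsol hsol' t ht]

/-- For an admissible measure there is exactly one weak solution, as a function on `[0, T] × ]0, M[`. -/
theorem exists_unique_isWeakSolution (hM : 0 < M) (hT : 0 ≤ T) (hC₀ : 0 < C₀) (hC₁ : 0 < C₁)
    (Q : Coefficients M σlow σup Cσ R) (hQ : Q.Extends T σ r) (hh : HasVDeriv M h h')
    {μ : FiniteMeasure ℝ} (hμ : μ ∈ admissible M C₀ C₁) :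
    ∃ u, IsWeakSolution M T σ r h μ u ∧ ∀ u', IsWeakSolution M T σ r h μ u' →
      ∀ t ∈ Icc 0 T, ∀ x ∈ Ioo 0 M, u' t x = u t x := by
  obtain ⟨J, hJ⟩ := exists_embedding_leb hM hC₀ hC₁ ⟨μ, hμ⟩
  have hν := ae_mem_Ioo_of_mem_admissible hM hμ
  obtain ⟨K, hK, hKb, hJK⟩ := exists_embedding_of_mem_admissible hM hC₀ hC₁ hJ hμ
  obtain ⟨f, hf, hsol, hfT, -⟩ :=
    (Q.system hM hC₁ hJ hν hK hKb hJK).exists_solution hT hh.toVector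
  exact ⟨_, isWeakSolution_logPrimitive hM Q hQ hJ hν hK hh hf hfT hsol,
    fun u' hu' t ht x hx => hu'.eq_logPrimitive hM hC₁ Q hQ hJ hν hK hKb hJK hh hf hsol ht hx⟩

/-- On admissible measures, the Tikhonov functional is the misfit in `L²` plus a constant. -/
theorem tikhonov_eq (hM : 0 < M) (hJ : ∀ f, J f =ᵐ[leb M] logPrimitive M f)
    {μ : FiniteMeasure ℝ} (hμ : μ ∈ admissible M C₀ C₁) {f₀ : Lp ℝ 2 (leb M)}
    (hf₀ : ∀ x ∈ Ioo 0 M, solutionOperator M T σ r h μ x = logPrimitive M f₀ x) {uε : ℝ → ℝ}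
    (huε : MemLp uε 2 (leb M)) (α : ℝ) :
    tikhonov M T σ r h uε α μ = ‖J f₀ - huε.toLp‖ ^ 2 / 2 + α * M := by
  have h1 : (fun x => solutionOperator M T σ r h μ x - uε x)
      =ᵐ[leb M] (J f₀ - huε.toLp : Lp ℝ 2 (leb M)) := by
    filter_upwards [hJ f₀, huε.coeFn_toLp, Lp.coeFn_sub (J f₀) huε.toLp, ae_leb_mem]
      with x h1 h2 h3 h4
    rw [h3, Pi.sub_apply, h1, h2, hf₀ x h4]
  rw [tikhonov, tvNorm_eq_of_mem_admissible hM hμ, eLpNorm_congr_ae h1, Lp.norm_def]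

/-- The operators `K† K` depend continuously on the admissible measure. -/
theorem tendsto_gram_embedding (hM : 0 < M) (U : Ultrafilter (admissible M C₀ C₁))
    (i₀ : admissible M C₀ C₁) (hU : (U : Filter (admissible M C₀ C₁)) ≤ 𝓝 i₀)
    (hν : ∀ i : admissible M C₀ C₁,
      ∀ᵐ x ∂((i.1 : Measure ℝ).restrict (Ico 0 M)), x ∈ Ioo 0 M)
    (K : ∀ i : admissible M C₀ C₁,
      Lp ℝ 2 (leb M) →L[ℝ] Lp ℝ 2 ((i.1 : Measure ℝ).restrict (Ico 0 M)))
    (hK : ∀ i f, K i f =ᵐ[(i.1 : Measure ℝ).restrict (Ico 0 M)] logPrimitive M f)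
    (hKb : ∀ i f, ‖K i f‖ ≤ C₀ * ‖f‖) (g : Lp ℝ 2 (leb M)) :
    Tendsto (fun i => gram (K i) g) U (𝓝 (gram (K i₀) g)) := by
  have hUm : Tendsto (fun i : admissible M C₀ C₁ => i.1) U (𝓝 i₀.1) :=
    (continuous_subtype_val.tendsto i₀).mono_left hU
  refine tendsto_adjoint_comp_self U K (K i₀) hKb (dense_testVector hM) ?_ g
  rintro _ ⟨φ, hφ, rfl⟩ x z C hx hxz
  rw [inner_embedding_testVector (hν i₀) (hK i₀) hφ]
  refine (tendsto_inner_embedding hM U (fun i => i.2) hUm hφ hx hxz).congr fun i => ?_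
  rw [inner_embedding_testVector (hν i) (hK i) hφ]

/-- The solution operator in terms of `f = x ∂ₓu`: its values at time `0` depend weakly
continuously on the admissible measure. -/
theorem exists_initial_value (hM : 0 < M) (hT : 0 ≤ T) (hC₀ : 0 < C₀) (hC₁ : 0 < C₁)
    (Q : Coefficients M σlow σup Cσ R) (hQ : Q.Extends T σ r) (hh : HasVDeriv M h h')
    (hJ : ∀ f, J f =ᵐ[leb M] logPrimitive M f) :
    ∃ F : admissible M C₀ C₁ → Lp ℝ 2 (leb M),
      (∀ i, ∀ x ∈ Ioo 0 M, solutionOperator M T σ r h i.1 x = logPrimitive M (F i) x) ∧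
      ∀ (U : Ultrafilter (admissible M C₀ C₁)) i₀, (U : Filter (admissible M C₀ C₁)) ≤ 𝓝 i₀ →
        ∀ v, Tendsto (fun i => ⟪F i, v⟫) U (𝓝 ⟪F i₀, v⟫) := by
  have hν : ∀ i : admissible M C₀ C₁,
      ∀ᵐ x ∂((i.1 : Measure ℝ).restrict (Ico 0 M)), x ∈ Ioo 0 M := fun i =>
    ae_mem_Ioo_of_mem_admissible hM i.2
  choose K hK hKb hJK using fun i : admissible M C₀ C₁ =>
    exists_embedding_of_mem_admissible hM hC₀ hC₁ hJ i.2
  choose f hf hsol hfT hfb using fun i : admissible M C₀ C₁ =>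
    (Q.system hM hC₁ hJ (hν i) (hK i) (hKb i) (hJK i)).exists_solution hT hh.toVector
  refine ⟨fun i => f i 0, fun i x hx => ?_, fun U i₀ hU v => ?_⟩
  · have hex : ∃ u, IsWeakSolution M T σ r h (i.1 : Measure ℝ) u :=
      ⟨_, isWeakSolution_logPrimitive hM Q hQ hJ (hν i) (hK i) hh (hf i) (hfT i) (hsol i)⟩
    rw [solutionOperator, dif_pos hex]
    exact hex.choose_spec.eq_logPrimitive hM hC₁ Q hQ hJ (hν i) (hK i) (hKb i) (hJK i) hh (hf i)
      (hsol i) ⟨le_rfl, hT⟩ hx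
  · exact (Q.system hM hC₁ hJ (hν i₀) (hK i₀) (hKb i₀) (hJK i₀)).tendsto_inner_initial_value U
      (fun i => Q.system hM hC₁ hJ (hν i) (hK i) (hKb i) (hJK i))
      (fun i => (Q.system_B hM hC₁ hJ (hν i) (hK i) (hKb i) (hJK i)).trans
        (Q.system_B hM hC₁ hJ (hν i₀) (hK i₀) (hKb i₀) (hJK i₀)).symm)
      (tendsto_gram_embedding hM U i₀ hU hν K hK hKb) hT hf hsol hfb (hf i₀) (hsol i₀) v

/-- The misfit is lower semicontinuous, and the total variation is constant, on the compact set of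
admissible measures. -/
theorem exists_forall_tikhonov_le (hM : 0 < M) (hT : 0 ≤ T) (hC₀ : 0 < C₀) (hC₁ : 0 < C₁)
    (hne : (admissible M C₀ C₁).Nonempty)
    (Q : Coefficients M σlow σup Cσ R) (hQ : Q.Extends T σ r) (hh : HasVDeriv M h h')
    {uε : ℝ → ℝ} (huε : MemLp uε 2 (leb M)) (α : ℝ) :
    ∃ μ ∈ admissible M C₀ C₁, ∀ ν ∈ admissible M C₀ C₁,
      tikhonov M T σ r h uε α μ ≤ tikhonov M T σ r h uε α ν := by
  obtain ⟨J, hJ⟩ := exists_embedding_leb hM hC₀ hC₁ hne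
  obtain ⟨F, hF, hFw⟩ := exists_initial_value hM hT hC₀ hC₁ Q hQ hh hJ
  have hlsc : LowerSemicontinuous fun i : admissible M C₀ C₁ => ‖J (F i) - huε.toLp‖ :=
    lowerSemicontinuous_of_forall_ultrafilter fun U i₀ y hU hy =>
      norm_sub_le_of_tendsto_inner J U (hFw U i₀ hU) hy
  have : CompactSpace (admissible M C₀ C₁) :=
    isCompact_iff_compactSpace.1 (isCompact_admissible M C₀ C₁)
  obtain ⟨i, -, hi⟩ := LowerSemicontinuousOn.exists_isMinOn (s := (univ : Set (admissible M C₀ C₁)))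
    ⟨⟨_, hne.some_mem⟩, mem_univ _⟩ isCompact_univ (hlsc.lowerSemicontinuousOn _)
  refine ⟨i.1, i.2, fun ν hν => ?_⟩
  rw [tikhonov_eq hM hJ i.2 (hF i) huε, tikhonov_eq hM hJ hν (hF ⟨ν, hν⟩) huε]
  have h1 : ‖J (F i) - huε.toLp‖ ≤ ‖J (F ⟨ν, hν⟩) - huε.toLp‖ :=
    hi (mem_univ (⟨ν, hν⟩ : admissible M C₀ C₁))
  gcongr

end

end MeasureBlackScholes

theorem mainTheorem1
    (M T : ℝ) (hM : 0 < M) (hT : 0 < T)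
    (r : ℝ → ℝ) (R : ℝ) (hr_meas : Measurable r)
    (hr : ∀ t ∈ Set.Icc 0 T, 0 ≤ r t ∧ r t ≤ R)
    (σ : ℝ → ℝ → ℝ) (σlow σup Cσ : ℝ) (hσlow : 0 < σlow)
    (hσ_meas : Measurable (Function.uncurry σ))
    (hσ : ∀ t ∈ Set.Icc 0 T, ∀ x ∈ Set.Icc 0 M, σlow ≤ σ t x ∧ σ t x ≤ σup)
    (hσ_diff : ∀ t ∈ Set.Icc 0 T, ∀ x ∈ Set.Ioo 0 M,
      DifferentiableAt ℝ (σ t) x ∧ |x * deriv (σ t) x| ≤ Cσ)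
    (C₀ C₁ : ℝ) (hC₀ : 0 < C₀) (hC₁ : 0 < C₁)
    (hne : (MeasureBlackScholes.admissible M C₀ C₁).Nonempty)
    (h : ℝ → ℝ) (hh : MeasureBlackScholes.MemV M h)
    (uε : ℝ → ℝ) (huε : MeasureTheory.MemLp uε 2 (MeasureBlackScholes.leb M))
    (α : ℝ) :
    (∀ μ ∈ MeasureBlackScholes.admissible M C₀ C₁,
      ∃ u : ℝ → ℝ → ℝ, MeasureBlackScholes.IsWeakSolution M T σ r h μ u ∧
        ∀ u' : ℝ → ℝ → ℝ, MeasureBlackScholes.IsWeakSolution M T σ r h μ u' →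
          ∀ t ∈ Set.Icc 0 T, ∀ x ∈ Set.Ioo 0 M, u' t x = u t x) ∧
    ∃ μ ∈ MeasureBlackScholes.admissible M C₀ C₁,
      ∀ ν ∈ MeasureBlackScholes.admissible M C₀ C₁,
        MeasureBlackScholes.tikhonov M T σ r h uε α μ
          ≤ MeasureBlackScholes.tikhonov M T σ r h uε α ν := by
  obtain ⟨h', hh'⟩ := hh
  obtain ⟨Q, hQ⟩ := MeasureBlackScholes.exists_coefficients_extends hM hT hr_meas hr hσlow hσ_meas
    hσ hσ_diff
  exact ⟨fun μ hμ => MeasureBlackScholes.exists_unique_isWeakSolution hM hT.le hC₀ hC₁ Q hQ hh' hμ,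
    MeasureBlackScholes.exists_forall_tikhonov_le hM hT.le hC₀ hC₁ hne Q hQ hh' huε α⟩
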